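/- All syntax is taken up to renaming of bound variables; $A{=}T$ abbreviates $A:T..T$, and $\Gamma\vdash S=:=T$ means $\Gamma\vdash S<:T$ and $\Gamma\vdash T<:S$. **The calculus cDOT.** Paths $p::=x\mid p.a$. Types $\top,\ \bot,\ \{a:T\},\ \{A:S..T\},\ S\wedge T,\ \mu(x:T),\ \forall(x:S)T,\ p.A,\ p.\mathrm{type}$. Terms $p$, values $v$, applications $p\,q$, $\mathsf{let}\ x=t\ \mathsf{in}\ u$, $\mathsf{case}\ p\ \mathsf{of}\ y:q.A\Rightarrow t\ \mathsf{else}\ u$. Values are $\lambda(x:T)t$ and tagged objects $\nu(x:T)[q.A]\,d$, with definitions $d::=\{a=p\}\mid\{a=v\}\mid\{A=T\}\mid d\wedge d'$. *Term typing* $\Gamma\vdash t:T$: variables; $\lambda(x:T)t:\forall(x:T)U$ if $\Gamma,x:T\vdash t:U$; $p\,q:T[q/x]$ if $p:\forall(x:S)T$, $q:S$; $\nu(x:T)[q.A]d:\mu(x:T)$ if $x;\Gamma,x:T\vdash d:T$ and $\Gamma,x:T\vdash x:q.A$; $p.a:T$ iff $p:\{a:T\}$; $\mathsf{let}\ x=t\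 \mathsf{in}\ u:U$ if $t:T$, $\Gamma,x:T\vdash u:U$, $x\notin fv(U)$; $\mathsf{case}\ p\ \mathsf{of}\ y:q.A\Rightarrow t\ \mathsf{else}\ u:U$ if $p,q$ are typeable, $\Gamma,y:p.\mathrm{type}\wedge q.A\vdash t:U$, $u:U$, $y\notin fv(U)$; $p:T$ if $p:q.\mathrm{type}$, $q:T$; $p:p.\mathrm{type}$ if $p$ is typeable; $p.a:q.a.\mathrm{type}$ if $p:q.\mathrm{type}$ and $q.a$ is typeable; $p:\mu(x:T)$ iff $p:T[p/x]$; $p:T\wedge U$ if $p:T$, $p:U$; subsumption. *Definition typing* $p;\Gamma\vdash d:T$: $\{A=T\}:\{A:T..T\}$; $\{a=\lambda(x:T)t\}:\{a:\forall(x:U)V\}$ if $\Gamma\vdash\lambda(x:T)t:\forall(x:U)V$; $\{a=\nu(x:T)[q.A]d\}:\{a:\mu(x:T)\}$ if $p.a;\Gamma\vdash d[p.a/x]:T[p.a/x]$, $\Gamma\vdash p.a:(q.A)[p.a/x]$ and $T$ has tight bounds; $\{a=q\}:\{a:q.\mathrm{type}\}$ if $q$ is typeable; $d_1\wedge d_2:T_1\wedge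 T_2$ if $d_1:T_1$, $d_2:T_2$ and $d_1,d_2$ define disjoint sets of labels. *Subtyping*: reflexivity, transitivity, $\top$, $\bot$, the three rules for $\wedge$; covariance of fields; $\{A:S_1..T_1\}<:\{A:S_2..T_2\}$ if $S_2<:S_1$, $T_1<:T_2$; $\forall(x:S_1)T_1<:\forall(x:S_2)T_2$ if $S_2<:S_1$ and $\Gamma,x:S_2\vdash T_1<:T_2$; $S<:p.A<:T$ if $p:\{A:S..T\}$; replacement of $p$ by $q$ or of $q$ by $p$ inside a type if $p:q.\mathrm{type}$ and $q$ is typeable; and the inversion rules: if $U$ has the unique member $\{a:T_1\}$ and $U<:\{a:T_2\}$, then $T_1<:T_2$; if $U$ has the unique member $\{A:S_1..T_1\}$ and $U<:\{A:S_2..T_2\}$, then $S_2<:S_1$ and $T_1<:T_2$. Here $\{A:S..T\}$, $\{a:T\}$ and $\mu(x:T)$ are their own unique members, with label sets $\{A\}$, $\{a\}$, $\emptyset$; the unique members of $U_1\wedge U_2$ are those of $U_1$ and of $U_2$, provided that both have label sets and that these are disjoint; the label set of $U_1\wedge U_2$ is their union. **The calculus $\lambda_{2,G\mu}$.** Types $\alpha,\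 1,\ \tau_1*\tau_2,\ \tau_1\to\tau_2,\ (\vec\tau)T,\ \forall\alpha.\tau$. A signature $\Sigma$ consists of finitely many datatypes $T$, each with an arity and finitely many constructors $c=c_{T,i}$ with $\Sigma(c)=\forall\beta_{c,1},\dots,\beta_{c,m_c}.\,\tau_c\to(\sigma_{c,1},\dots,\sigma_{c,k})T$, where $k$ is the arity of $T$ and $\tau_c,\vec\sigma_c$ mention no type variables but $\vec\beta_c$. Terms $x,\ c[\vec\tau](e),\ \langle\rangle,\ \langle e_1:\tau_1,e_2:\tau_2\rangle,\ \mathsf{fst}\,e,\ \mathsf{snd}\,e,\ \lambda x{:}\tau.e,\ e_1\,e_2,\ \Lambda\alpha.e,\ e[\tau],\ \mathsf{fix}\,f{:}\tau.e,\ \mathsf{let}\,x=e_1\,\mathsf{in}\,e_2$ and $\mathsf{matchgadt}\ e\ \mathsf{as}\ T\ \mathsf{returning}\ \tau\ \mathsf{with}\ (c_{T,i}[\vec\beta](x)\Rightarrow e_i)_i$ with exactly one branch per constructor of $T$, in the order of $\Sigma$. $\Delta$ consists of type variables and equations $\tau\equiv\tau'$; $\Pi$ assigns types to term variables. The judgment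 $\Delta;\Pi\vdash e:\tau$ has the usual rules of System F with unit, products, fix and let (type annotations and type arguments, but not those of pairs, are required to be well formed under $\Delta$), and: $c[\vec\tau](e):((\vec\sigma_c)T)[\vec\tau/\vec\beta_c]$ if $e:\tau_c[\vec\tau/\vec\beta_c]$; the match has type $\tau$ if $\tau$ is well formed under $\Delta$, $e:(\vec\delta)T$ and, for each $c=c_{T,i}$, $\Delta,\vec\beta,\vec\sigma_c\equiv\vec\delta;\ \Pi,x:\tau_c\vdash e_i:\tau$ with fresh $\vec\beta=\vec\beta_c$; and conversion of $e:\tau_1$ to $e:\tau_2$ if $\Delta\vdash'\tau_1\equiv\tau_2$. The entailment $\vdash'$ is generated, regardless of the order of the equations, by: $\Delta\vdash'\tau\equiv\tau$ if $\Delta$ has no equations and $\tau$ is well formed; an equation $\alpha\equiv\alpha$ may be dropped; an equation $\alpha\equiv\tau$ or $\tau\equiv\alpha$ with $\alpha\notin fv(\tau)$ may be removed by substituting $\tau$ for $\alpha$ in the other equations and in the goal; an equation $(\vec\tau)T\equiv(\vec\sigma)T$ or $\tau_1*\tau_2\equiv\sigma_1*\sigma_2$ may be replaced by the equations between its components. **Encodings.**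 Let $\Theta$ be a partial map from type variables to projections $p.A$ and from term variables to cDOT terms; $lib$ and $env$ are names (paths). Below, several arguments are applied one after the other, with intermediate results bound by $\mathsf{let}$, $\nu[q.A](s:\dots)$ is a tagged object whose members are listed with its type being the intersection of the member types, and all new variables are fresh. cDOT has no empty definitions, so an object with no members gets one dummy type member; an intersection of no types is $\top$. Types: $\mathcal T(\alpha,\Theta)=\Theta(\alpha)$; $\mathcal T(1,\Theta)=lib.\mathrm{Unit}$; $\mathcal T(\tau_1*\tau_2,\Theta)=lib.\mathrm{Tuple}\wedge\{T_1=\mathcal T(\tau_1,\Theta)\}\wedge\{T_2=\mathcal T(\tau_2,\Theta)\}$; $\mathcal T(\tau_1\to\tau_2,\Theta)=\forall(x:\mathcal T(\tau_1,\Theta))\mathcal T(\tau_2,\Theta)$; $\mathcal T((\vec\tau)T,\Theta)=env.T\wedge\bigwedge_j\{A_j=\mathcal T(\tau_j,\Theta)\}$; $\mathcal T(\forall\alpha.\tau,\Theta)=\forall(x:\{T:\bot..\top\})\mathcal T(\tau,\Theta[\alpha\mapsto x.T])$. Terms, with $E_\Theta(e)=\mathcal E(e,\Theta)$, $T_\Theta(\tau)=\mathcal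 T(\tau,\Theta)$ and $\mathrm{ob}\{\dots\}=\nu[lib.\mathrm{Any}](\_:\{\dots\})$: - $E_\Theta(x)=\Theta(x)$; $E_\Theta(\langle\rangle)=lib.unit$; $E_\Theta(\lambda x{:}\tau.e)=\lambda(x:T_\Theta(\tau))E_{\Theta[x\mapsto x]}(e)$; $E_\Theta(\Lambda\alpha.e)=\lambda(x:\{T:\bot..\top\})E_{\Theta[\alpha\mapsto x.T]}(e)$; $E_\Theta(\mathsf{let}\,x=e_1\,\mathsf{in}\,e_2)=\mathsf{let}\ x=E_\Theta(e_1)\ \mathsf{in}\ E_{\Theta[x\mapsto x]}(e_2)$. - $E_\Theta(c_{T,i}[\vec\tau](e))=\mathsf{let}\ ts=\mathrm{ob}\{B_{i,j}=T_\Theta(\tau_j)\}_j\ \mathsf{in\ let}\ v=E_\Theta(e)\ \mathsf{in}\ env.c_{T,i}\ ts\ v$. - $E_\Theta(\langle e_1:\tau_1,e_2:\tau_2\rangle)=\mathsf{let}\ x_1=E_\Theta(e_1)\ \mathsf{in\ let}\ x_2=E_\Theta(e_2)\ \mathsf{in\ let}\ tl=\mathrm{ob}\{T_1=T_\Theta(\tau_1);T_2=T_\Theta(\tau_2)\}\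 \mathsf{in}\ lib.tuple\ tl\ x_1\ x_2$; $E_\Theta(\mathsf{fst}\,e)=\mathsf{let}\ x=E_\Theta(e)\ \mathsf{in}\ x.fst$, and similarly for $\mathsf{snd}$. - $E_\Theta(e_1\,e_2)=\mathsf{let}\ f=E_\Theta(e_1)\ \mathsf{in\ let}\ x=E_\Theta(e_2)\ \mathsf{in}\ f\,x$; $E_\Theta(e[\tau])=\mathsf{let}\ f=E_\Theta(e)\ \mathsf{in\ let}\ x=\mathrm{ob}\{T=T_\Theta(\tau)\}\ \mathsf{in}\ f\,x$. - $E_\Theta(\mathsf{fix}\,f{:}\tau.e)=\mathsf{let}\ s=\nu[lib.\mathrm{Any}](s:\{fix:\forall(\_:lib.\mathrm{Unit})T_\Theta(\tau)\})\{fix=\lambda(\_:lib.\mathrm{Unit})E_{\Theta[f\mapsto s.fix\ lib.unit]}(e)\}\ \mathsf{in}\ s.fix\ lib.unit$. - $E_\Theta(\mathsf{matchgadt}\dots)=\mathsf{let}\ r=\mathrm{ob}\{R=T_\Theta(\tau)\}\ \mathsf{in\ let}\ v=E_\Theta(e)\ \mathsf{in\ let}\ case_i=\lambda(arg:env.T_{c_{T,i}}\wedge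 v.\mathrm{type})\ \mathsf{let}\ x=arg.data\ \mathsf{in}\ E_{\Theta[\beta_j\mapsto arg.B_{i,j},x\mapsto x]}(e_i)\ \ (\text{all } i)\ \mathsf{in}\ v.pmatch\ r\ case_1\cdots case_n$. The object $lib$ has tag $lib.\mathrm{Any}$ and the members $\mathrm{Any}=\top$; $\mathrm{Unit}=\{U:\bot..\top\}$; $unit=\nu[lib.\mathrm{Unit}](\_:\{U=\top\})$; $\mathrm{Tuple}=\mu(s:\{T_1:\bot..\top;T_2:\bot..\top;fst:s.T_1;snd:s.T_2\})$; and $tuple=\lambda(tl:\{T_1:\bot..\top;T_2:\bot..\top\})\lambda(x_1:tl.T_1)\lambda(x_2:tl.T_2)\,\mathsf{let}\ s=\nu[lib.\mathrm{Tuple}](s:\{T_1=tl.T_1;T_2=tl.T_2;fst=x_1;snd=x_2\})\ \mathsf{in}\ s$, the last one with the type $\forall(tl)\forall(x_1:tl.T_1)\forall(x_2:tl.T_2)\,lib.\mathrm{Tuple}\wedge\{T_1=tl.T_1\}\wedge\{T_2=tl.T_2\}$. The object $env$ (`EncodeSigma`) has tag $lib.\mathrm{Any}$ and, for each datatype $T$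 with constructors $c_1,\dots,c_n$ and each $c=c_i$, where $\theta_y=[\beta_{c,j}\mapsto y.B_{i,j}]_j$, the members - $T=\mu(s:\{A_j:\bot..\top\}_j\wedge\{pmatch:P_s\})$ with $P_s=\forall(r:\{R:\bot..\top\})\,\forall(case_1:\forall(arg:env.T_{c_1}\wedge s.\mathrm{type})\,r.R)\cdots\forall(case_n:\forall(arg:env.T_{c_n}\wedge s.\mathrm{type})\,r.R)\ r.R$; - $T_c=\mu(s:env.T\wedge\{B_{i,j}:\bot..\top\}_j\wedge\{A_j=\mathcal T(\sigma_{c,j},\theta_s)\}_j\wedge\{data:\mathcal T(\tau_c,\theta_s)\})$; - $c:\forall(ts:\{B_{i,j}:\bot..\top\}_j)\,\forall(v:\mathcal T(\tau_c,\theta_{ts}))\,\mathcal T((\vec\sigma_c)T,\theta_{ts})$, defined by $c=\lambda(ts)\lambda(v)\,\mathsf{let}\ s=\nu[env.T_c](s:\{B_{i,j}=ts.B_{i,j}\}_j\{A_j=\mathcal T(\sigma_{c,j},\theta_s)\}_j\{data=v\}\{pmatch=m\})\ \mathsf{in}\ s$, where $m=\lambda(r)\lambda(case_1)\cdots\lambda(case_n)\,\mathsf{let}\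 h=\nu[lib.\mathrm{Any}](\_:\{z=s\})\ \mathsf{in}\ case_i\ h.z$ has the declared type $P_s$. $\mathrm{EncodeProgram}(e,\Sigma)=\mathsf{let}\ lib=\dots\ \mathsf{in\ let}\ env=\dots\ \mathsf{in}\ \mathcal E(e,\emptyset)$. **Correspondence.** $\Psi(\Delta;\Theta;\Gamma)$ holds if (a) for each type variable $\alpha$ of $\Delta$, $\Theta(\alpha)=p.A$ is defined and $\Gamma\vdash p:\{A:\bot..\top\}$; (b) $\Gamma\vdash\mathcal T(\tau,\Theta)=:=\mathcal T(\tau',\Theta)$ for each equation $\tau\equiv\tau'$ of $\Delta$; (c) $\Gamma$ types $lib$ and $env$ with the intersections of the declared types of their members listed above (where $lib.unit$ is declared with type $lib.\mathrm{Unit}$). $\Phi(\Delta;\Pi;\Theta;\Gamma)$ holds if $\Psi(\Delta;\Theta;\Gamma)$ and, for each $x:\tau$ in $\Pi$, $\Theta(x)$ is defined and $\Gamma\vdash\Theta(x):\mathcal T(\tau,\Theta)$. **Theorem (Type Preservation).** For every signature $\Sigma$: 1. If $\Delta;\Pi\vdash e:\tau$ is derivable, then for every $\Theta$ whose domain contains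 the free type and term variables of $e$ and the free type variables of $\tau$, and every cDOT environment $\Gamma$ with $\Phi(\Delta;\Pi;\Theta;\Gamma)$, we have $\Gamma\vdash\mathcal E(e,\Theta):\mathcal T(\tau,\Theta)$. 2. There are types $L$ and $E$ such that the object $lib$ has type $L$ in the empty environment, the object $env$ has type $E$ in the environment $lib:L$, and $\Phi(\emptyset;\emptyset;\emptyset;\ (lib:L,\ env:E))$ holds. 3. Consequently, if $\emptyset;\emptyset\vdash e:\tau$, then $\mathrm{EncodeProgram}(e,\Sigma)$ is well typed in cDOT: there is a type $U$ with $\emptyset\vdash\mathrm{EncodeProgram}(e,\Sigma):U$. -/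

import Mathlib

/-! Syntax with binding is nameless (de Bruijn indices) throughout, so terms and types are taken
up to renaming of bound variables and freshness side conditions become shifts. -/

/-! ## The calculus cDOT -/

namespace CDOT

/-- Names of type members.  `A j`, `B i j`, `gadt t` (the member `env.T`), `con t i` (the member
`env.T_c` of the `i`-th constructor of `T`) and the named ones are those used by the encoding. -/
inductive TyLab
  | any | unit | U | tuple | T1 | T2 | T | R | pad
  | A (j : ℕ) | B (i j : ℕ) | gadt (t : ℕ) | con (t i : ℕ) | other (k : ℕ)

/-- Names of term members.  `con t i` is the member `env.c` for the `i`-th constructor of the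
`t`-th datatype. -/
inductive TmLab
  | unit | tuple | fst | snd | data | pmatch | fix | z
  | con (t i : ℕ) | other (k : ℕ)

inductive Label
  | ty (A : TyLab)
  | tm (a : TmLab)

/-- Paths `x.a.b.…`. -/
inductive Path
  | var (x : ℕ)
  | sel (p : Path) (a : TmLab)

inductive Typ
  | top
  | bot
  /-- `{a : T}` -/
  | fld (a : TmLab) (T : Typ)
  /-- `{A : S..T}` -/
  | typ (A : TyLab) (S T : Typ)
  | and (S T : Typ)
  /-- `μ(x : T)`, binding index `0` in `T` -/
  | mu (T : Typ)
  /-- `∀(x : S) T`, binding index `0` in `T` -/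
  | all (S T : Typ)
  /-- `p.A` -/
  | sel (p : Path) (A : TyLab)
  /-- `p.type` -/
  | sngl (p : Path)

mutual
/-- Terms. -/
inductive Tm
  | path (p : Path)
  | val (v : Val)
  | app (p q : Path)
  /-- `let x = t in u`, binding index `0` in `u` -/
  | letIn (t u : Tm)
  /-- `case p of y : q.A => t else u`, binding index `0` in `t` -/
  | caseOf (p q : Path) (A : TyLab) (t u : Tm)
/-- Values. -/
inductive Val
  /-- the tagged object `ν(x : T)[q.A] d`, binding index `0` in `q`, `T` and `d` -/
  | obj (q : Path) (A : TyLab) (T : Typ) (d : Def)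
  /-- `λ(x : T) t`, binding index `0` in `t` -/
  | lam (T : Typ) (t : Tm)
/-- Definitions; a field holds a stable term, i.e. a path or a value. -/
inductive Def
  | path (a : TmLab) (q : Path)
  | val (a : TmLab) (v : Val)
  | typ (A : TyLab) (T : Typ)
  | and (d e : Def)
end

/-! Simultaneous substitution of paths for variables. -/

def Path.subst (σ : ℕ → Path) : Path → Path
  | .var x => σ x
  | .sel p a => .sel (p.subst σ) a

def up (k : ℕ) : ℕ → Path := fun x => .var (x + k)

/-- Weakening by `k` variables. -/
def Path.shift (k : ℕ) (p : Path) : Path := p.subst (up k)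

/-- The substitution below a binder. -/
def lift (σ : ℕ → Path) : ℕ → Path
  | 0 => .var 0
  | x + 1 => (σ x).shift 1

/-- The substitution `[p/x]` for the variable `x` with index `0`. -/
def inst (p : Path) : ℕ → Path
  | 0 => p
  | x + 1 => .var x

def Typ.subst : (ℕ → Path) → Typ → Typ
  | _, .top => .top
  | _, .bot => .bot
  | σ, .fld a T => .fld a (T.subst σ)
  | σ, .typ A S T => .typ A (S.subst σ) (T.subst σ)
  | σ, .and S T => .and (S.subst σ) (T.subst σ)
  | σ, .mu T => .mu (T.subst (lift σ))
  | σ, .all S T => .all (S.subst σ) (T.subst (lift σ))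
  | σ, .sel p A => .sel (p.subst σ) A
  | σ, .sngl p => .sngl (p.subst σ)

mutual
def Tm.subst : (ℕ → Path) → Tm → Tm
  | σ, .path p => .path (p.subst σ)
  | σ, .val v => .val (v.subst σ)
  | σ, .app p q => .app (p.subst σ) (q.subst σ)
  | σ, .letIn t u => .letIn (t.subst σ) (u.subst (lift σ))
  | σ, .caseOf p q A t u =>
      .caseOf (p.subst σ) (q.subst σ) A (t.subst (lift σ)) (u.subst σ)
def Val.subst : (ℕ → Path) → Val → Val
  | σ, .obj q A T d =>
      .obj (q.subst (lift σ)) A (T.subst (lift σ)) (d.subst (lift σ))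
  | σ, .lam T t => .lam (T.subst σ) (t.subst (lift σ))
def Def.subst : (ℕ → Path) → Def → Def
  | σ, .path a q => .path a (q.subst σ)
  | σ, .val a v => .val a (v.subst σ)
  | σ, .typ A T => .typ A (T.subst σ)
  | σ, .and d e => .and (d.subst σ) (e.subst σ)
end

def Typ.shift (k : ℕ) (T : Typ) : Typ := T.subst (up k)
def Tm.shift (k : ℕ) (t : Tm) : Tm := t.subst (up k)

/-- Type environments; index `0` is the last binding.  A binding `x : T` may refer to `x` itself
(as in the premises of the rule for objects), so `T` is scoped in the environment up to and
including `x`. -/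
abbrev Env := List Typ

/-- `Γ, x : T` for a type `T` scoped in `Γ`. -/
def Env.bind (Γ : Env) (T : Typ) : Env := T.shift 1 :: Γ

/-- `Γ(x) = T`, with `T` weakened to the whole of `Γ`. -/
inductive Lookup : Env → ℕ → Typ → Prop
  | zero (Γ : Env) (T : Typ) : Lookup (T :: Γ) 0 T
  | succ (Γ : Env) (S T : Typ) (x : ℕ) (h : Lookup Γ x T) : Lookup (S :: Γ) (x + 1) (T.shift 1)

/-- `r'` is `r` with the prefix `p` replaced by `q`. -/
inductive PathRepl (p q : Path) : Path → Path → Prop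
  | here : PathRepl p q p q
  | sel (r r' : Path) (a : TmLab) (h : PathRepl p q r r') : PathRepl p q (.sel r a) (.sel r' a)

/-- The second type is the first one with one occurrence of the path `p` replaced by `q`
(several replacements are obtained by transitivity of subtyping). -/
inductive Repl : Path → Path → Typ → Typ → Prop
  | fld (p q : Path) (a : TmLab) (T T' : Typ) (h : Repl p q T T') :
      Repl p q (.fld a T) (.fld a T')
  | typLo (p q : Path) (A : TyLab) (S S' T : Typ) (h : Repl p q S S') :
      Repl p q (.typ A S T) (.typ A S' T)
  | typHi (p q : Path) (A : TyLab) (S T T' : Typ) (h : Repl p q T T') :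
      Repl p q (.typ A S T) (.typ A S T')
  | andL (p q : Path) (S S' T : Typ) (h : Repl p q S S') : Repl p q (.and S T) (.and S' T)
  | andR (p q : Path) (S T T' : Typ) (h : Repl p q T T') : Repl p q (.and S T) (.and S T')
  | mu (p q : Path) (T T' : Typ) (h : Repl (p.shift 1) (q.shift 1) T T') :
      Repl p q (.mu T) (.mu T')
  | allDom (p q : Path) (S S' T : Typ) (h : Repl p q S S') : Repl p q (.all S T) (.all S' T)
  | allCod (p q : Path) (S T T' : Typ) (h : Repl (p.shift 1) (q.shift 1) T T') :
      Repl p q (.all S T) (.all S T')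
  | sel (p q r r' : Path) (A : TyLab) (h : PathRepl p q r r') :
      Repl p q (.sel r A) (.sel r' A)
  | sngl (p q r r' : Path) (h : PathRepl p q r r') : Repl p q (.sngl r) (.sngl r')

/-- Unique membership with labels. -/
inductive UniqueLab : Typ → Typ → Set Label → Prop
  | oneTyp (A : TyLab) (S T : Typ) : UniqueLab (.typ A S T) (.typ A S T) {Label.ty A}
  | oneFld (a : TmLab) (T : Typ) : UniqueLab (.fld a T) (.fld a T) {Label.tm a}
  | oneRec (T : Typ) : UniqueLab (.mu T) (.mu T) ∅
  | andLeft (U₁ U₂ T₁ T₂ : Typ) (L₁ L₂ : Set Label) (h₁ : UniqueLab U₁ T₁ L₁)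
      (h₂ : UniqueLab U₂ T₂ L₂) (h : L₁ ∩ L₂ = ∅) : UniqueLab (.and U₁ U₂) T₁ (L₁ ∪ L₂)
  | andRight (U₁ U₂ T₁ T₂ : Typ) (L₁ L₂ : Set Label) (h₁ : UniqueLab U₁ T₁ L₁)
      (h₂ : UniqueLab U₂ T₂ L₂) (h : L₁ ∩ L₂ = ∅) : UniqueLab (.and U₁ U₂) T₂ (L₁ ∪ L₂)

/-- Unique membership. -/
def Unique (T U : Typ) : Prop := ∃ L, UniqueLab T U L

/-- Labels defined by a definition. -/
def Def.dom : Def → Set Label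
  | .path a _ => {Label.tm a}
  | .val a _ => {Label.tm a}
  | .typ A _ => {Label.ty A}
  | .and d e => d.dom ∪ e.dom

/-- Tight bounds. -/
def Typ.Tight : Typ → Prop
  | .typ _ U V => U = V
  | .mu U => U.Tight
  | .fld _ U => U.Tight
  | .and U V => U.Tight ∧ V.Tight
  | _ => True

/-! A premise that a path is typeable is spelled out as a premise that it has some type. -/
mutual
/-- Term typing `Γ ⊢ t : T`. -/
inductive HasTy : Env → Tm → Typ → Prop
  | var (Γ : Env) (x : ℕ) (T : Typ) (h : Lookup Γ x T) : HasTy Γ (.path (.var x)) T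
  | allI (Γ : Env) (T U : Typ) (t : Tm) (h : HasTy (Γ.bind T) t U) :
      HasTy Γ (.val (.lam T t)) (.all T U)
  | allE (Γ : Env) (p q : Path) (S T : Typ) (hp : HasTy Γ (.path p) (.all S T))
      (hq : HasTy Γ (.path q) S) : HasTy Γ (.app p q) (T.subst (inst q))
  | objI (Γ : Env) (q : Path) (A : TyLab) (T : Typ) (d : Def)
      (hd : DefTy (.var 0) (T :: Γ) d T) (ht : HasTy (T :: Γ) (.path (.var 0)) (.sel q A)) :
      HasTy Γ (.val (.obj q A T d)) (.mu T)
  | fldE (Γ : Env) (p : Path) (a : TmLab) (T : Typ) (h : HasTy Γ (.path p) (.fld a T)) :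
      HasTy Γ (.path (.sel p a)) T
  | fldI (Γ : Env) (p : Path) (a : TmLab) (T : Typ) (h : HasTy Γ (.path (.sel p a)) T) :
      HasTy Γ (.path p) (.fld a T)
  | letIn (Γ : Env) (t u : Tm) (T U : Typ) (ht : HasTy Γ t T)
      (hu : HasTy (Γ.bind T) u (U.shift 1)) : HasTy Γ (.letIn t u) U
  | caseOf (Γ : Env) (p q : Path) (A : TyLab) (t u : Tm) (P Q U : Typ)
      (hp : HasTy Γ (.path p) P) (hq : HasTy Γ (.path q) Q)
      (ht : HasTy (Γ.bind (.and (.sngl p) (.sel q A))) t (U.shift 1)) (hu : HasTy Γ u U) :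
      HasTy Γ (.caseOf p q A t u) U
  | snglTrans (Γ : Env) (p q : Path) (T : Typ) (hp : HasTy Γ (.path p) (.sngl q))
      (hq : HasTy Γ (.path q) T) : HasTy Γ (.path p) T
  | snglSelf (Γ : Env) (p : Path) (T : Typ) (h : HasTy Γ (.path p) T) :
      HasTy Γ (.path p) (.sngl p)
  | snglE (Γ : Env) (p q : Path) (a : TmLab) (T : Typ) (hp : HasTy Γ (.path p) (.sngl q))
      (hq : HasTy Γ (.path (.sel q a)) T) : HasTy Γ (.path (.sel p a)) (.sngl (.sel q a))
  | recI (Γ : Env) (p : Path) (T : Typ) (h : HasTy Γ (.path p) (T.subst (inst p))) :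
      HasTy Γ (.path p) (.mu T)
  | recE (Γ : Env) (p : Path) (T : Typ) (h : HasTy Γ (.path p) (.mu T)) :
      HasTy Γ (.path p) (T.subst (inst p))
  | andI (Γ : Env) (p : Path) (T U : Typ) (hT : HasTy Γ (.path p) T)
      (hU : HasTy Γ (.path p) U) : HasTy Γ (.path p) (.and T U)
  | sub (Γ : Env) (t : Tm) (T U : Typ) (ht : HasTy Γ t T) (hs : Sub Γ T U) : HasTy Γ t U
/-- Subtyping `Γ ⊢ S <: T`. -/
inductive Sub : Env → Typ → Typ → Prop
  | top (Γ : Env) (T : Typ) : Sub Γ T .top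
  | bot (Γ : Env) (T : Typ) : Sub Γ .bot T
  | refl (Γ : Env) (T : Typ) : Sub Γ T T
  | trans (Γ : Env) (S T U : Typ) (h₁ : Sub Γ S T) (h₂ : Sub Γ T U) : Sub Γ S U
  | andLeft (Γ : Env) (T U : Typ) : Sub Γ (.and T U) T
  | andRight (Γ : Env) (T U : Typ) : Sub Γ (.and T U) U
  | andI (Γ : Env) (S T U : Typ) (h₁ : Sub Γ S T) (h₂ : Sub Γ S U) : Sub Γ S (.and T U)
  | fld (Γ : Env) (a : TmLab) (T U : Typ) (h : Sub Γ T U) : Sub Γ (.fld a T) (.fld a U)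
  | fldInv (Γ : Env) (a : TmLab) (U T₁ T₂ : Typ) (hu : Unique U (.fld a T₁))
      (h : Sub Γ U (.fld a T₂)) : Sub Γ T₁ T₂
  | typ (Γ : Env) (A : TyLab) (S₁ S₂ T₁ T₂ : Typ) (hS : Sub Γ S₂ S₁) (hT : Sub Γ T₁ T₂) :
      Sub Γ (.typ A S₁ T₁) (.typ A S₂ T₂)
  | typInvLo (Γ : Env) (A : TyLab) (U S₁ S₂ T₁ T₂ : Typ) (hu : Unique U (.typ A S₁ T₁))
      (h : Sub Γ U (.typ A S₂ T₂)) : Sub Γ S₂ S₁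
  | typInvHi (Γ : Env) (A : TyLab) (U S₁ S₂ T₁ T₂ : Typ) (hu : Unique U (.typ A S₁ T₁))
      (h : Sub Γ U (.typ A S₂ T₂)) : Sub Γ T₁ T₂
  | subSel (Γ : Env) (p : Path) (A : TyLab) (S T : Typ)
      (h : HasTy Γ (.path p) (.typ A S T)) : Sub Γ S (.sel p A)
  | selSub (Γ : Env) (p : Path) (A : TyLab) (S T : Typ)
      (h : HasTy Γ (.path p) (.typ A S T)) : Sub Γ (.sel p A) T
  | snglPQ (Γ : Env) (p q : Path) (Q T T' : Typ) (hp : HasTy Γ (.path p) (.sngl q))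
      (hq : HasTy Γ (.path q) Q) (h : Repl p q T T') : Sub Γ T T'
  | snglQP (Γ : Env) (p q : Path) (Q T T' : Typ) (hp : HasTy Γ (.path p) (.sngl q))
      (hq : HasTy Γ (.path q) Q) (h : Repl q p T T') : Sub Γ T T'
  | all (Γ : Env) (S₁ S₂ T₁ T₂ : Typ) (hS : Sub Γ S₂ S₁) (hT : Sub (Γ.bind S₂) T₁ T₂) :
      Sub Γ (.all S₁ T₁) (.all S₂ T₂)
/-- Definition typing `p; Γ ⊢ d : T`. -/
inductive DefTy : Path → Env → Def → Typ → Prop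
  | typ (p : Path) (Γ : Env) (A : TyLab) (T : Typ) : DefTy p Γ (.typ A T) (.typ A T T)
  | lam (p : Path) (Γ : Env) (a : TmLab) (T U V : Typ) (t : Tm)
      (h : HasTy Γ (.val (.lam T t)) (.all U V)) :
      DefTy p Γ (.val a (.lam T t)) (.fld a (.all U V))
  | obj (p : Path) (Γ : Env) (a : TmLab) (q : Path) (A : TyLab) (T : Typ) (d : Def)
      (hd : DefTy (.sel p a) Γ (d.subst (inst (.sel p a))) (T.subst (inst (.sel p a))))
      (ht : HasTy Γ (.path (.sel p a)) (.sel (q.subst (inst (.sel p a))) A))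
      (hT : T.Tight) : DefTy p Γ (.val a (.obj q A T d)) (.fld a (.mu T))
  | path (p : Path) (Γ : Env) (a : TmLab) (q : Path) (T : Typ) (h : HasTy Γ (.path q) T) :
      DefTy p Γ (.path a q) (.fld a (.sngl q))
  | and (p : Path) (Γ : Env) (d e : Def) (T U : Typ) (hd : DefTy p Γ d T)
      (he : DefTy p Γ e U) (h : d.dom ∩ e.dom = ∅) : DefTy p Γ (.and d e) (.and T U)
end

/-- Type equality `Γ ⊢ S =:= T`. -/
def TyEq (Γ : Env) (S T : Typ) : Prop := Sub Γ S T ∧ Sub Γ T S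

end CDOT

/-! ## The calculus `λ_{2,Gμ}` -/

namespace GMu

/-- Arities of a signature: `N` datatypes, datatype `t` with `ar t` parameters and `ncon t`
constructors, the `i`-th of which has `tvs t i` type parameters. -/
structure Shape where
  N : ℕ
  ar : Fin N → ℕ
  ncon : Fin N → ℕ
  tvs : (t : Fin N) → Fin (ncon t) → ℕ

inductive Ty (S : Shape)
  | var (α : ℕ)
  | unit
  | prod (τ₁ τ₂ : Ty S)
  | arr (τ₁ τ₂ : Ty S)
  | gadt (t : Fin S.N) (args : Fin (S.ar t) → Ty S)
  /-- `∀ α. τ`, binding index `0` -/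
  | all (τ : Ty S)

/-- Terms.  Type variables and term variables (both `x`- and `f`-variables) are indexed separately.
A match has exactly one branch per constructor of the matched datatype, in the order of the
signature; the branch `c[β₀,…,β_{m-1}](x) => e` binds the type variable `β_j` as index `j` and
the term variable `x` as index `0` in `e`. -/
inductive Exp (S : Shape)
  | var (x : ℕ)
  /-- `c[τ₀,…](e)` -/
  | con (t : Fin S.N) (i : Fin (S.ncon t)) (args : Fin (S.tvs t i) → Ty S) (e : Exp S)
  | unit
  /-- `⟨e₁ : τ₁, e₂ : τ₂⟩` -/
  | pair (e₁ : Exp S) (τ₁ : Ty S) (e₂ : Exp S) (τ₂ : Ty S)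
  | fst (e : Exp S)
  | snd (e : Exp S)
  /-- `λ x : τ. e` -/
  | lam (τ : Ty S) (e : Exp S)
  | app (e₁ e₂ : Exp S)
  /-- `Λ α. e` -/
  | tlam (e : Exp S)
  /-- `e[τ]` -/
  | tapp (e : Exp S) (τ : Ty S)
  /-- `fix f : τ. e` -/
  | fix (τ : Ty S) (e : Exp S)
  /-- `let x = e₁ in e₂ end` -/
  | letIn (e₁ e₂ : Exp S)
  /-- `matchgadt e as T returning τ with ms` -/
  | matchG (t : Fin S.N) (e : Exp S) (τ : Ty S) (ms : Fin (S.ncon t) → Exp S)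

variable {S : Shape}

/-- Renaming of type variables. -/
def Ty.rename : (ℕ → ℕ) → Ty S → Ty S
  | ρ, .var α => .var (ρ α)
  | _, .unit => .unit
  | ρ, .prod a b => .prod (a.rename ρ) (b.rename ρ)
  | ρ, .arr a b => .arr (a.rename ρ) (b.rename ρ)
  | ρ, .gadt t args => .gadt t (fun j => (args j).rename ρ)
  | ρ, .all a => .all (a.rename (fun α => match α with | 0 => 0 | n + 1 => ρ n + 1))

def Ty.shift (k : ℕ) (τ : Ty S) : Ty S := τ.rename (fun α => α + k)

/-- The substitution below a binder. -/
def liftTy (σ : ℕ → Ty S) : ℕ → Ty S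
  | 0 => .var 0
  | α + 1 => (σ α).shift 1

/-- Capture-avoiding simultaneous substitution. -/
def Ty.subst : (ℕ → Ty S) → Ty S → Ty S
  | σ, .var α => σ α
  | _, .unit => .unit
  | σ, .prod a b => .prod (a.subst σ) (b.subst σ)
  | σ, .arr a b => .arr (a.subst σ) (b.subst σ)
  | σ, .gadt t args => .gadt t (fun j => (args j).subst σ)
  | σ, .all a => .all (a.subst (liftTy σ))

/-- `[β₀ ↦ τ₀, …, β_{k-1} ↦ τ_{k-1}]` for the variables with the indices `0, …, k-1`. -/
def instTys (k : ℕ) (τs : Fin k → Ty S) : ℕ → Ty S :=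
  fun α => if h : α < k then τs ⟨α, h⟩ else .var (α - k)

/-- `[α ↦ τ]`, where `α` remains a variable in scope. -/
def replTy (α : ℕ) (τ : Ty S) : ℕ → Ty S := fun β => if β = α then τ else .var β

def Ty.fv : Ty S → Set ℕ
  | .var α => {α}
  | .unit => ∅
  | .prod a b => a.fv ∪ b.fv
  | .arr a b => a.fv ∪ b.fv
  | .gadt _ args => ⋃ j, (args j).fv
  | .all a => {α | α + 1 ∈ a.fv}

/-- Free type variables of a term. -/
def Exp.fvTy : Exp S → Set ℕ
  | .var _ => ∅
  | .con _ _ args e => (⋃ j, (args j).fv) ∪ e.fvTy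
  | .unit => ∅
  | .pair e₁ τ₁ e₂ τ₂ => e₁.fvTy ∪ τ₁.fv ∪ (e₂.fvTy ∪ τ₂.fv)
  | .fst e => e.fvTy
  | .snd e => e.fvTy
  | .lam τ e => τ.fv ∪ e.fvTy
  | .app e₁ e₂ => e₁.fvTy ∪ e₂.fvTy
  | .tlam e => {α | α + 1 ∈ e.fvTy}
  | .tapp e τ => e.fvTy ∪ τ.fv
  | .fix τ e => τ.fv ∪ e.fvTy
  | .letIn e₁ e₂ => e₁.fvTy ∪ e₂.fvTy
  | .matchG t e τ ms => e.fvTy ∪ τ.fv ∪ ⋃ i, {α | α + S.tvs t i ∈ (ms i).fvTy}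

/-- Free term variables of a term. -/
def Exp.fvTm : Exp S → Set ℕ
  | .var x => {x}
  | .con _ _ _ e => e.fvTm
  | .unit => ∅
  | .pair e₁ _ e₂ _ => e₁.fvTm ∪ e₂.fvTm
  | .fst e => e.fvTm
  | .snd e => e.fvTm
  | .lam _ e => {x | x + 1 ∈ e.fvTm}
  | .app e₁ e₂ => e₁.fvTm ∪ e₂.fvTm
  | .tlam e => e.fvTm
  | .tapp e _ => e.fvTm
  | .fix _ e => {x | x + 1 ∈ e.fvTm}
  | .letIn e₁ e₂ => e₁.fvTm ∪ {x | x + 1 ∈ e₂.fvTm}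
  | .matchG _ e _ ms => e.fvTm ∪ ⋃ i, {x | x + 1 ∈ (ms i).fvTm}

/-- `Δ ⊢ τ : *`, where `Δ` has `n` type variables (arities are right by construction). -/
def Ty.WF (n : ℕ) (τ : Ty S) : Prop := ∀ α ∈ τ.fv, α < n

/-- A signature: the `i`-th constructor `c` of the datatype `T` with index `t` has
`Σ(c) = ∀ β₀ … β_{m-1}. arg t i → (idx t i 0, …) T`, where `m = tvs t i` and `β_j` has index `j`. -/
structure Sig extends Shape where
  arg : (t : Fin N) → (i : Fin (ncon t)) → Ty toShape
  idx : (t : Fin N) → (i : Fin (ncon t)) → Fin (ar t) → Ty toShape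

/-- The types in a constructor signature mention only the type parameters of the constructor. -/
def Sig.Closed (sg : Sig) : Prop :=
  ∀ t i, (sg.arg t i).WF (sg.tvs t i) ∧ ∀ j, (sg.idx t i j).WF (sg.tvs t i)

/-- Constraints `Δ`: `n` type variables and equations between types. -/
structure Constr (S : Shape) where
  n : ℕ
  eqs : List (Ty S × Ty S)

/-- Substitution in a list of equations. -/
def substEqs (σ : ℕ → Ty S) (E : List (Ty S × Ty S)) : List (Ty S × Ty S) :=
  E.map (fun e => (e.1.subst σ, e.2.subst σ))

/-- `Δ, β₀, …, β_{k-1}`. -/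
def Constr.addVars (k : ℕ) (Δ : Constr S) : Constr S :=
  ⟨Δ.n + k, Δ.eqs.map (fun e => (e.1.shift k, e.2.shift k))⟩

/-- `Δ, E` for a list `E` of equations. -/
def Constr.addEqs (Δ : Constr S) (E : List (Ty S × Ty S)) : Constr S := ⟨Δ.n, Δ.eqs ++ E⟩

/-- The restricted entailment `Δ ⊢' τ₁ ≡ τ₂`.  The order of the equations is immaterial. -/
inductive Entails : Constr S → Ty S → Ty S → Prop
  | refl (n : ℕ) (τ : Ty S) (h : τ.WF n) : Entails ⟨n, []⟩ τ τ
  | drop (n : ℕ) (E : List (Ty S × Ty S)) (α : ℕ) (τ₁ τ₂ : Ty S)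
      (h : Entails ⟨n, E⟩ τ₁ τ₂) : Entails ⟨n, (.var α, .var α) :: E⟩ τ₁ τ₂
  | substL (n : ℕ) (E : List (Ty S × Ty S)) (α : ℕ) (τ τ₁ τ₂ : Ty S) (hα : α ∉ τ.fv)
      (h : Entails ⟨n, substEqs (replTy α τ) E⟩ (τ₁.subst (replTy α τ)) (τ₂.subst (replTy α τ))) :
      Entails ⟨n, (τ, .var α) :: E⟩ τ₁ τ₂
  | substR (n : ℕ) (E : List (Ty S × Ty S)) (α : ℕ) (τ τ₁ τ₂ : Ty S) (hα : α ∉ τ.fv)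
      (h : Entails ⟨n, substEqs (replTy α τ) E⟩ (τ₁.subst (replTy α τ)) (τ₂.subst (replTy α τ))) :
      Entails ⟨n, (.var α, τ) :: E⟩ τ₁ τ₂
  | gadt (n : ℕ) (E : List (Ty S × Ty S)) (t : Fin S.N) (a b : Fin (S.ar t) → Ty S)
      (τ₁ τ₂ : Ty S) (h : Entails ⟨n, List.ofFn (fun j => (a j, b j)) ++ E⟩ τ₁ τ₂) :
      Entails ⟨n, (.gadt t a, .gadt t b) :: E⟩ τ₁ τ₂
  | prod (n : ℕ) (E : List (Ty S × Ty S)) (a₁ a₂ b₁ b₂ τ₁ τ₂ : Ty S)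
      (h : Entails ⟨n, (a₁, b₁) :: (a₂, b₂) :: E⟩ τ₁ τ₂) :
      Entails ⟨n, (.prod a₁ a₂, .prod b₁ b₂) :: E⟩ τ₁ τ₂
  | perm (n : ℕ) (E E' : List (Ty S × Ty S)) (τ₁ τ₂ : Ty S) (hE : E.Perm E')
      (h : Entails ⟨n, E⟩ τ₁ τ₂) : Entails ⟨n, E'⟩ τ₁ τ₂

/-- The typing judgment `Δ; Π ⊢ e : τ`.  Index `0` is the last binding of the list `P` for `Π`. -/
inductive HasTy (sg : Sig) :
    Constr sg.toShape → List (Ty sg.toShape) → Exp sg.toShape → Ty sg.toShape → Prop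
  | var (Δ : Constr sg.toShape) (P : List (Ty sg.toShape)) (x : ℕ) (τ : Ty sg.toShape)
      (h : P[x]? = some τ) : HasTy sg Δ P (.var x) τ
  | con (Δ : Constr sg.toShape) (P : List (Ty sg.toShape)) (t : Fin sg.N) (i : Fin (sg.ncon t))
      (args : Fin (sg.tvs t i) → Ty sg.toShape) (e : Exp sg.toShape)
      (hargs : ∀ j, (args j).WF Δ.n)
      (h : HasTy sg Δ P e ((sg.arg t i).subst (instTys (sg.tvs t i) args))) :
      HasTy sg Δ P (.con t i args e)
        ((Ty.gadt t (sg.idx t i)).subst (instTys (sg.tvs t i) args))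
  | unit (Δ : Constr sg.toShape) (P : List (Ty sg.toShape)) : HasTy sg Δ P .unit .unit
  | pair (Δ : Constr sg.toShape) (P : List (Ty sg.toShape)) (e₁ e₂ : Exp sg.toShape)
      (τ₁ τ₂ : Ty sg.toShape) (h₁ : HasTy sg Δ P e₁ τ₁) (h₂ : HasTy sg Δ P e₂ τ₂) :
      HasTy sg Δ P (.pair e₁ τ₁ e₂ τ₂) (.prod τ₁ τ₂)
  | fst (Δ : Constr sg.toShape) (P : List (Ty sg.toShape)) (e : Exp sg.toShape)
      (τ₁ τ₂ : Ty sg.toShape) (h : HasTy sg Δ P e (.prod τ₁ τ₂)) : HasTy sg Δ P (.fst e) τ₁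
  | snd (Δ : Constr sg.toShape) (P : List (Ty sg.toShape)) (e : Exp sg.toShape)
      (τ₁ τ₂ : Ty sg.toShape) (h : HasTy sg Δ P e (.prod τ₁ τ₂)) : HasTy sg Δ P (.snd e) τ₂
  | lam (Δ : Constr sg.toShape) (P : List (Ty sg.toShape)) (e : Exp sg.toShape)
      (τ₁ τ₂ : Ty sg.toShape) (hτ : τ₁.WF Δ.n) (h : HasTy sg Δ (τ₁ :: P) e τ₂) :
      HasTy sg Δ P (.lam τ₁ e) (.arr τ₁ τ₂)
  | app (Δ : Constr sg.toShape) (P : List (Ty sg.toShape)) (e₁ e₂ : Exp sg.toShape)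
      (τ₁ τ₂ : Ty sg.toShape) (h₁ : HasTy sg Δ P e₁ (.arr τ₁ τ₂)) (h₂ : HasTy sg Δ P e₂ τ₁) :
      HasTy sg Δ P (.app e₁ e₂) τ₂
  | tlam (Δ : Constr sg.toShape) (P : List (Ty sg.toShape)) (e : Exp sg.toShape)
      (τ : Ty sg.toShape) (h : HasTy sg (Δ.addVars 1) (P.map (Ty.shift 1)) e τ) :
      HasTy sg Δ P (.tlam e) (.all τ)
  | tapp (Δ : Constr sg.toShape) (P : List (Ty sg.toShape)) (e : Exp sg.toShape)
      (τ τ₁ : Ty sg.toShape) (hτ : τ₁.WF Δ.n) (h : HasTy sg Δ P e (.all τ)) :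
      HasTy sg Δ P (.tapp e τ₁) (τ.subst (instTys 1 (fun _ => τ₁)))
  | fix (Δ : Constr sg.toShape) (P : List (Ty sg.toShape)) (e : Exp sg.toShape)
      (τ : Ty sg.toShape) (hτ : τ.WF Δ.n) (h : HasTy sg Δ (τ :: P) e τ) :
      HasTy sg Δ P (.fix τ e) τ
  | letIn (Δ : Constr sg.toShape) (P : List (Ty sg.toShape)) (e₁ e₂ : Exp sg.toShape)
      (τ₁ τ₂ : Ty sg.toShape) (h₁ : HasTy sg Δ P e₁ τ₁) (h₂ : HasTy sg Δ (τ₁ :: P) e₂ τ₂) :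
      HasTy sg Δ P (.letIn e₁ e₂) τ₂

  | matchG (Δ : Constr sg.toShape) (P : List (Ty sg.toShape)) (t : Fin sg.N)
      (e : Exp sg.toShape) (τ : Ty sg.toShape) (ms : Fin (sg.ncon t) → Exp sg.toShape)
      (δ : Fin (sg.ar t) → Ty sg.toShape) (hτ : τ.WF Δ.n) (he : HasTy sg Δ P e (.gadt t δ))
      (hms : ∀ i, HasTy sg
        ((Δ.addVars (sg.tvs t i)).addEqs
          (List.ofFn (fun j => (sg.idx t i j, (δ j).shift (sg.tvs t i)))))
        (sg.arg t i :: P.map (Ty.shift (sg.tvs t i))) (ms i) (τ.shift (sg.tvs t i))) :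
      HasTy sg Δ P (.matchG t e τ ms) τ
  | eq (Δ : Constr sg.toShape) (P : List (Ty sg.toShape)) (e : Exp sg.toShape)
      (τ₁ τ₂ : Ty sg.toShape) (h : HasTy sg Δ P e τ₁) (hτ : Entails Δ τ₁ τ₂) :
      HasTy sg Δ P e τ₂

end GMu

/-! ## The encoding -/

namespace Enc

open CDOT (TyLab TmLab Path Typ Tm Val Def Env)
open GMu (Shape Ty Exp Sig Constr)

/-- The partial substitution `Θ`, mapping type variables to type projections `p.A` (given as
`(p, A)`) and term variables to cDOT terms, together with the names of `lib` and `env` in the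
cDOT scope at hand. -/
structure Subst where
  lib : Path
  env : Path
  ty : ℕ → Option (Path × TyLab)
  tm : ℕ → Option Tm

/-- `Θ` below `k` more cDOT binders. -/
def Subst.shift (k : ℕ) (Θ : Subst) : Subst where
  lib := Θ.lib.shift k
  env := Θ.env.shift k
  ty α := (Θ.ty α).map (fun s => (s.1.shift k, s.2))
  tm x := (Θ.tm x).map (Tm.shift k)

/-- `Θ[β₀ ↦ f 0, …, β_{k-1} ↦ f (k-1)]` for new type variables `β₀, …, β_{k-1}`. -/
def Subst.addTys (k : ℕ) (f : ℕ → Path × TyLab) (Θ : Subst) : Subst :=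
  { Θ with ty := fun α => if α < k then some (f α) else Θ.ty (α - k) }

/-- `Θ[x ↦ t]` for a new term variable `x`. -/
def Subst.addTm (t : Tm) (Θ : Subst) : Subst :=
  { Θ with tm := fun x => match x with | 0 => some t | y + 1 => Θ.tm y }

/-- The empty substitution. -/
def Subst.empty (lib env : Path) : Subst := ⟨lib, env, fun _ => none, fun _ => none⟩

def Subst.domTy (Θ : Subst) : Set ℕ := {α | (Θ.ty α).isSome}
def Subst.domTm (Θ : Subst) : Set ℕ := {x | (Θ.tm x).isSome}

/-- `{A = T}`. -/
def eqDecl (A : TyLab) (T : Typ) : Typ := .typ A T T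
/-- `{A : ⊥..⊤}`. -/
def absDecl (A : TyLab) : Typ := .typ A .bot .top

/-- `T₀ ∧ T₁ ∧ …`, and `⊤` if there is nothing to intersect. -/
def bigAnd : List Typ → Typ
  | [] => .top
  | [T] => T
  | T :: U :: Ts => .and T (bigAnd (U :: Ts))

/-- `d₀ ∧ d₁ ∧ …`, used for non-empty lists only. -/
def bigDef : List Def → Def
  | [] => .typ .pad .top
  | [d] => d
  | d :: e :: ds => .and d (bigDef (e :: ds))

/-- cDOT has no empty definitions: an object without members gets a dummy member. -/
def withPad : List (Def × Typ) → List (Def × Typ)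
  | [] => [(.typ .pad .top, .typ .pad .top .top)]
  | m :: ms => m :: ms

/-- The object with the tag `q.A` and the given members, each with its declared type; `q` and the
members are scoped below the self variable. -/
def mkObj (q : Path) (A : TyLab) (ms : List (Def × Typ)) : Val :=
  .obj q A (bigAnd ((withPad ms).map Prod.snd)) (bigDef ((withPad ms).map Prod.fst))

/-- The member `A = T`. -/
def tyMem (A : TyLab) (T : Typ) : Def × Typ := (.typ A T, eqDecl A T)

/-- `ν[lib.Any](_ : {A₀ = T₀; A₁ = T₁; …})`. -/
def tyObj (lib : Path) (l : List (TyLab × Typ)) : Val :=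
  mkObj (lib.shift 1) .any (l.map (fun m => tyMem m.1 (m.2.shift 1)))

/-- The application `p q r₀ r₁ …`, sequenced by `let`; `p` and `q` are below `k` more binders
than the remaining arguments. -/
def appsAux : ℕ → Path → Path → List Path → Tm
  | _, p, q, [] => .app p q
  | k, p, q, r :: rs => .letIn (.app p q) (appsAux (k + 1) (.var 0) (r.shift (k + 1)) rs)

/-- The application `p q r₀ r₁ …`, sequenced by `let`. -/
def apps (p q : Path) (rs : List Path) : Tm := appsAux 0 p q rs

/-- `let x₀ = t₀ in let x₁ = t₁ in … u`. -/
def lets (ts : List Tm) (u : Tm) : Tm := ts.foldr Tm.letIn u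

/-- The encoding of types.  Variables outside of the domain of `Θ` get the dummy value `⊤`. -/
def encTy {S : Shape} : Subst → Ty S → Typ
  | Θ, .var α => match Θ.ty α with
      | some s => .sel s.1 s.2
      | none => .top
  | Θ, .unit => .sel Θ.lib .unit
  | Θ, .prod a b =>
      .and (.and (.sel Θ.lib .tuple) (eqDecl .T1 (encTy Θ a))) (eqDecl .T2 (encTy Θ b))
  | Θ, .arr a b => .all (encTy Θ a) ((encTy Θ b).shift 1)
  | Θ, .gadt t args =>
      (List.ofFn (fun j => eqDecl (.A j) (encTy Θ (args j)))).foldl Typ.and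
        (.sel Θ.env (.gadt t))
  | Θ, .all a => .all (absDecl .T) (encTy ((Θ.shift 1).addTys 1 (fun _ => (.var 0, .T))) a)

/-- The encoding of terms.  Variables outside of the domain of `Θ` get a dummy value. -/
def encTm {S : Shape} : Subst → Exp S → Tm
  | Θ, .var x => (Θ.tm x).getD (.path Θ.lib)
  | Θ, .con t i args e =>
      .letIn (.val (tyObj Θ.lib (List.ofFn (fun j => (.B i j, encTy Θ (args j))))))
        (.letIn ((encTm Θ e).shift 1)
          (apps (.sel (Θ.env.shift 2) (.con t i)) (.var 1) [.var 0]))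
  | Θ, .unit => .path (.sel Θ.lib .unit)
  | Θ, .pair e₁ τ₁ e₂ τ₂ =>
      .letIn (encTm Θ e₁) (.letIn ((encTm Θ e₂).shift 1)
        (.letIn
          (.val (tyObj (Θ.lib.shift 2)
            [(.T1, (encTy Θ τ₁).shift 2), (.T2, (encTy Θ τ₂).shift 2)]))
          (apps (.sel (Θ.lib.shift 3) .tuple) (.var 0) [.var 2, .var 1])))
  | Θ, .fst e => .letIn (encTm Θ e) (.path (.sel (.var 0) .fst))
  | Θ, .snd e => .letIn (encTm Θ e) (.path (.sel (.var 0) .snd))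
  | Θ, .lam τ e =>
      .val (.lam (encTy Θ τ) (encTm ((Θ.shift 1).addTm (.path (.var 0))) e))
  | Θ, .app e₁ e₂ =>
      .letIn (encTm Θ e₁) (.letIn ((encTm Θ e₂).shift 1) (.app (.var 1) (.var 0)))
  | Θ, .tlam e =>
      .val (.lam (absDecl .T) (encTm ((Θ.shift 1).addTys 1 (fun _ => (.var 0, .T))) e))
  | Θ, .tapp e τ =>
      .letIn (encTm Θ e) (.letIn (.val (tyObj (Θ.lib.shift 1) [(.T, (encTy Θ τ).shift 1)]))
        (.app (.var 1) (.var 0)))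
  | Θ, .fix τ e =>
      .letIn
        (.val (mkObj (Θ.lib.shift 1) .any
          [(.val .fix (.lam (.sel (Θ.lib.shift 1) .unit)
              (encTm ((Θ.shift 2).addTm
                (.app (.sel (.var 1) .fix) (.sel (Θ.lib.shift 2) .unit))) e)),
            .fld .fix (.all (.sel (Θ.lib.shift 1) .unit) ((encTy Θ τ).shift 2)))]))
        (.app (.sel (.var 0) .fix) (.sel (Θ.lib.shift 1) .unit))
  | Θ, .letIn e₁ e₂ =>
      .letIn (encTm Θ e₁) (encTm ((Θ.shift 1).addTm (.path (.var 0))) e₂)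
  | Θ, .matchG t e τ ms =>
      .letIn (.val (tyObj Θ.lib [(.R, encTy Θ τ)]))
        (.letIn ((encTm Θ e).shift 1)
          (lets
            (List.ofFn (fun i : Fin (S.ncon t) =>
              .val (.lam
                (.and (.sel (Θ.env.shift (i + 2)) (.con t i)) (.sngl (.var i)))
                (.letIn (.path (.sel (.var 0) .data))
                  (encTm
                    (((Θ.shift (i + 4)).addTys (S.tvs t i) (fun j => (.var 1, .B i j))).addTm
                      (.path (.var 0)))
                    (ms i))))))
            (apps (.sel (.var (S.ncon t)) .pmatch) (.var (S.ncon t + 1))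
              ((List.range (S.ncon t)).map (fun i => .var (S.ncon t - 1 - i))))))

/-! ### The object `lib` -/

/-- `{U : ⊥..⊤}`. -/
def unitTy : Typ := absDecl .U

/-- `μ(s : {T₁ : ⊥..⊤; T₂ : ⊥..⊤; fst : s.T₁; snd : s.T₂})`. -/
def tupleTy : Typ :=
  .mu (bigAnd [absDecl .T1, absDecl .T2, .fld .fst (.sel (.var 0) .T1),
    .fld .snd (.sel (.var 0) .T2)])

/-- The type of `lib.tuple`. -/
def tupleFunTy (lib : Path) : Typ :=
  .all (bigAnd [absDecl .T1, absDecl .T2])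
    (.all (.sel (.var 0) .T1) (.all (.sel (.var 1) .T2)
      (.and (.and (.sel (lib.shift 3) .tuple) (eqDecl .T1 (.sel (.var 2) .T1)))
        (eqDecl .T2 (.sel (.var 2) .T2)))))

/-- `λ(tl) λ(x₁ : tl.T₁) λ(x₂ : tl.T₂) let s = ν[lib.Tuple](s : …) in s`. -/
def tupleFun (lib : Path) : Val :=
  .lam (bigAnd [absDecl .T1, absDecl .T2])
    (.val (.lam (.sel (.var 0) .T1) (.val (.lam (.sel (.var 1) .T2)
      (.letIn
        (.val (mkObj (lib.shift 4) .tuple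
          [tyMem .T1 (.sel (.var 3) .T1), tyMem .T2 (.sel (.var 3) .T2),
            (.path .fst (.var 2), .fld .fst (.sngl (.var 2))),
            (.path .snd (.var 1), .fld .snd (.sngl (.var 1)))]))
        (.path (.var 0)))))))

/-- The types that the name `lib` has in an environment. -/
def libTy (lib : Path) : Typ :=
  bigAnd [eqDecl .any .top, eqDecl .unit unitTy, .fld .unit (.sel lib .unit),
    eqDecl .tuple tupleTy, .fld .tuple (tupleFunTy lib)]

/-- The object bound to `lib`. -/
def libVal : Val :=
  mkObj (.var 0) .any
    [tyMem .any .top, tyMem .unit unitTy,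
      (.val .unit (mkObj (.var 1) .unit [tyMem .U .top]), .fld .unit (.mu (eqDecl .U .top))),
      tyMem .tuple tupleTy,
      (.val .tuple (tupleFun (.var 0)), .fld .tuple (tupleFunTy (.var 0)))]

/-! ### The object `env` -/

/-- `[β₀ ↦ x.B_{i,0}, …, β_{k-1} ↦ x.B_{i,k-1}]`. -/
def theta (lib env x : Path) (i k : ℕ) : Subst :=
  (Subst.empty lib env).addTys k (fun j => (x, .B i j))

/-- The type `∀(arg : env.T_c ∧ s.type) r.R` of the visitor for the `i`-th constructor. -/
def caseTy (env s r : Path) (t i : ℕ) : Typ :=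
  .all (.and (.sel env (.con t i)) (.sngl s)) (.sel (r.shift 1) .R)

/-- `∀(case_{c_i} : …) … r.R`, for the listed constructors. -/
def casesTy (t : ℕ) : List ℕ → Path → Path → Path → Typ
  | [], _, _, r => .sel r .R
  | i :: is, env, s, r =>
      .all (caseTy env s r t i) (casesTy t is (env.shift 1) (s.shift 1) (r.shift 1))

/-- The type of `pmatch` in an object `s` of a datatype with `n` constructors. -/
def pmatchTy (env s : Path) (t n : ℕ) : Typ :=
  .all (absDecl .R) (casesTy t (List.range n) (env.shift 1) (s.shift 1) (.var 0))

/-- `λ(case_{c_i} : …) … body`, for the listed constructors. -/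
def casesLam (t : ℕ) : List ℕ → Path → Path → Path → Tm → Tm
  | [], _, _, _, body => body
  | i :: is, env, s, r, body =>
      .val (.lam (caseTy env s r t i)
        (casesLam t is (env.shift 1) (s.shift 1) (r.shift 1) body))

/-- `λ(r) λ(case_{c_0}) … λ(case_{c_{n-1}}) let h = ν[lib.Any](_ : {z = s}) in case_{c_i} h.z`. -/
def pmatchVal (lib env s : Path) (t n i : ℕ) : Val :=
  .lam (absDecl .R)
    (casesLam t (List.range n) (env.shift 1) (s.shift 1) (.var 0)
      (.letIn
        (.val (mkObj (lib.shift (n + 2)) .any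
          [(.path .z (s.shift (n + 2)), .fld .z (.sngl (s.shift (n + 2))))]))
        (.app (.var (n - i)) (.sel (.var 0) .z))))

/-- The type `T`, i.e. `μ(s : {A_j : ⊥..⊤; …; pmatch : …})`. -/
def gadtTy (sg : Sig) (env : Path) (t : Fin sg.N) : Typ :=
  .mu (bigAnd (List.ofFn (fun j : Fin (sg.ar t) => absDecl (.A j)) ++
    [.fld .pmatch (pmatchTy (env.shift 1) (.var 0) t (sg.ncon t))]))

/-- The type `T_c`, i.e. `μ(s : env.T ∧ {B_{i,j} : ⊥..⊤; …; A_j = …; …; data : …})`. -/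
def conTy (sg : Sig) (lib env : Path) (t : Fin sg.N) (i : Fin (sg.ncon t)) : Typ :=
  .mu (bigAnd (.sel (env.shift 1) (.gadt t) ::
    (List.ofFn (fun j : Fin (sg.tvs t i) => absDecl (.B i j)) ++
      List.ofFn (fun j : Fin (sg.ar t) => eqDecl (.A j)
        (encTy (theta (lib.shift 1) (env.shift 1) (.var 0) i (sg.tvs t i)) (sg.idx t i j))) ++
      [.fld .data
        (encTy (theta (lib.shift 1) (env.shift 1) (.var 0) i (sg.tvs t i)) (sg.arg t i))])))

/-- The type `{B_{i,0} : ⊥..⊤; …}` of the first argument of a constructor. -/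
def tsTy (sg : Sig) (t : Fin sg.N) (i : Fin (sg.ncon t)) : Typ :=
  bigAnd (List.ofFn (fun j : Fin (sg.tvs t i) => absDecl (.B i j)))

/-- The type of `env.c`. -/
def conFunTy (sg : Sig) (lib env : Path) (t : Fin sg.N) (i : Fin (sg.ncon t)) : Typ :=
  .all (tsTy sg t i)
    (.all (encTy (theta (lib.shift 1) (env.shift 1) (.var 0) i (sg.tvs t i)) (sg.arg t i))
      (encTy (theta (lib.shift 2) (env.shift 2) (.var 1) i (sg.tvs t i))
        (.gadt t (sg.idx t i))))

/-- The definition of `env.c`. -/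
def conFun (sg : Sig) (lib env : Path) (t : Fin sg.N) (i : Fin (sg.ncon t)) : Val :=
  .lam (tsTy sg t i)
    (.val (.lam (encTy (theta (lib.shift 1) (env.shift 1) (.var 0) i (sg.tvs t i)) (sg.arg t i))
      (.letIn
        (.val (mkObj (env.shift 3) (.con t i)
          (List.ofFn (fun j : Fin (sg.tvs t i) => tyMem (.B i j) (.sel (.var 2) (.B i j))) ++
            List.ofFn (fun j : Fin (sg.ar t) => tyMem (.A j)
              (encTy (theta (lib.shift 3) (env.shift 3) (.var 0) i (sg.tvs t i))
                (sg.idx t i j))) ++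
            [(.path .data (.var 1), .fld .data (.sngl (.var 1))),
              (.val .pmatch (pmatchVal (lib.shift 3) (env.shift 3) (.var 0) t (sg.ncon t) i),
                .fld .pmatch (pmatchTy (env.shift 3) (.var 0) t (sg.ncon t)))])))
        (.path (.var 0)))))

/-- `EncodeGADT`: the members of `env` for one datatype. -/
def encGadt (sg : Sig) (lib env : Path) (t : Fin sg.N) : List (Def × Typ) :=
  tyMem (.gadt t) (gadtTy sg env t) ::
    (List.ofFn (fun i : Fin (sg.ncon t) =>
      [tyMem (.con t i) (conTy sg lib env t i),
        (.val (.con t i) (conFun sg lib env t i),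
          .fld (.con t i) (conFunTy sg lib env t i))])).flatten

def envMembers (sg : Sig) (lib env : Path) : List (Def × Typ) :=
  (List.ofFn (encGadt sg lib env)).flatten

/-- The types that the name `env` has in an environment. -/
def envTy (sg : Sig) (lib env : Path) : Typ := bigAnd ((envMembers sg lib env).map Prod.snd)

/-- `EncodeSigma`: the object bound to `env`. -/
def encSig (sg : Sig) (lib : Path) : Val :=
  mkObj (lib.shift 1) .any (envMembers sg (lib.shift 1) (.var 0))

/-- `EncodeProgram`: `let lib = … in let env = … in` the encoding of `e`. -/
def encProgram (sg : Sig) (e : Exp sg.toShape) : Tm :=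
  .letIn (.val libVal)
    (.letIn (.val (encSig sg (.var 0))) (encTm (Subst.empty (.var 1) (.var 0)) e))

/-! ### Correspondence of environments -/

/-- Equational correspondence `Ψ(Δ; Θ; Γ)`. -/
structure EqCorr (sg : Sig) (Δ : Constr sg.toShape) (Θ : Subst) (Γ : Env) : Prop where
  vars : ∀ α < Δ.n, ∃ p A, Θ.ty α = some (p, A) ∧ CDOT.HasTy Γ (.path p) (absDecl A)
  eqs : ∀ e ∈ Δ.eqs, CDOT.TyEq Γ (encTy Θ e.1) (encTy Θ e.2)
  lib : CDOT.HasTy Γ (.path Θ.lib) (libTy Θ.lib)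
  env : CDOT.HasTy Γ (.path Θ.env) (envTy sg Θ.lib Θ.env)

/-- Environment correspondence `Φ(Δ; Π; Θ; Γ)`. -/
structure EnvCorr (sg : Sig) (Δ : Constr sg.toShape) (P : List (Ty sg.toShape)) (Θ : Subst)
    (Γ : Env) : Prop where
  eqCorr : EqCorr sg Δ Θ Γ
  terms : ∀ x τ, P[x]? = some τ → ∃ t, Θ.tm x = some t ∧ CDOT.HasTy Γ t (encTy Θ τ)

end Enc

/-!
Both directions of the translation are governed by one observation: the encoding of types is
compositional in `Θ`.  On the cDOT side it commutes with substitution of paths and on the source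
side with renaming, as equalities of types (`encTy_subst_rename`).  For a substitution of types on
the source side it commutes only up to type equality (`encTy_subst`): a type member `x.T` of an
object created for a type argument `τ` is equal to, but not identical with, the encoding of `τ`.
Weakening for cDOT (`HasTy.rename`) makes this equality a congruence below binders.

The entailment is sound (`tyEq_of_entails`).  Eliminating an equation `α ≡ τ` is the congruence
above.  Decomposing an equation between datatypes or between products needs the inversion rule of
cDOT, whose premise asks for a unique member, while the encoding `env.T ∧ {A₀ = …} ∧ …` starts with
a projection, which has no label set.  However, `env.T` is equal to the recursive type it
abbreviates, whose label set is empty, so the inversion rule applies to `μ(…) ∧ {A₀ = …} ∧ …`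
(`tyEq_of_sub_eqDecl`).

With this, the encoding of terms preserves typing by induction on the typing derivation
(`hasTy_encTm`).  In a branch for the constructor `c` of a match on `v`, the argument has both the
type `env.T_c`, by which its members `A_j` are the indices of `c`, and the type `v.type`, by which
they are the arguments of the type of `v`; hence the equations that the branch assumes hold in cDOT
(`hasTy_branch`).  The objects `lib` and `env` are typed directly (`hasTy_libVal`, `hasTy_encSig`):
already the self variable of each of them has the types that the encoding declares for its name, so
that the bodies of their methods can refer to these types.
-/

/-! ### Substitution in cDOT -/

namespace CDOT

namespace Path

theorem subst_subst (σ τ : ℕ → Path) (p : Path) :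
    (p.subst σ).subst τ = p.subst (fun x => (σ x).subst τ) := by
  induction p with
  | var x => rfl
  | sel p a ih => simp [Path.subst, ih]

theorem subst_var (p : Path) : p.subst Path.var = p := by
  induction p with
  | var x => rfl
  | sel p a ih => simp [Path.subst, ih]

theorem shift_subst (σ : ℕ → Path) (k : ℕ) (p : Path) :
    (p.shift k).subst σ = p.subst (fun x => σ (x + k)) := by
  simp [Path.shift, subst_subst, up, Path.subst]

theorem shift_subst_lift (σ : ℕ → Path) (p : Path) :
    (p.shift 1).subst (lift σ) = (p.subst σ).shift 1 := by
  simp only [shift_subst, lift]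
  simp [Path.shift, subst_subst]

@[simp] theorem shift_subst_inst (p q : Path) : (p.shift 1).subst (inst q) = p := by
  simp only [shift_subst, inst]
  exact subst_var p

@[simp] theorem shift_zero (p : Path) : p.shift 0 = p := subst_var p

@[simp] theorem shift_shift (j k : ℕ) (p : Path) : (p.shift j).shift k = p.shift (j + k) := by
  simp [Path.shift, subst_subst, up, Path.subst, Nat.add_assoc]
  rfl

@[simp] theorem shift_var (k x : ℕ) : (Path.var x).shift k = .var (x + k) := rfl

end Path

theorem lift_comp (σ τ : ℕ → Path) :
    (fun x => (lift σ x).subst (lift τ)) = lift (fun x => (σ x).subst τ) := by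
  funext x
  cases x with
  | zero => rfl
  | succ x => exact Path.shift_subst_lift τ (σ x)

theorem lift_var : lift Path.var = Path.var := by
  funext x
  cases x <;> rfl

namespace Typ

theorem subst_subst (σ τ : ℕ → Path) (T : Typ) :
    (T.subst σ).subst τ = T.subst (fun x => (σ x).subst τ) := by
  induction T generalizing σ τ <;>
    simp_all [Typ.subst, lift_comp, Path.subst_subst]

theorem subst_var (T : Typ) : T.subst Path.var = T := by
  induction T <;> simp_all [Typ.subst, lift_var, Path.subst_var]

theorem shift_subst (σ : ℕ → Path) (k : ℕ) (T : Typ) :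
    (T.shift k).subst σ = T.subst (fun x => σ (x + k)) := by
  simp [Typ.shift, subst_subst, up, Path.subst]

theorem shift_subst_lift (σ : ℕ → Path) (T : Typ) :
    (T.shift 1).subst (lift σ) = (T.subst σ).shift 1 := by
  simp only [shift_subst, lift]
  simp [Typ.shift, subst_subst, Path.shift]

@[simp] theorem shift_subst_inst (T : Typ) (q : Path) : (T.shift 1).subst (inst q) = T := by
  simp only [shift_subst, inst]
  exact subst_var T

@[simp] theorem shift_zero (T : Typ) : T.shift 0 = T := subst_var T

@[simp] theorem shift_shift (j k : ℕ) (T : Typ) : (T.shift j).shift k = T.shift (j + k) := by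
  simp [Typ.shift, subst_subst, up, Path.subst, Nat.add_assoc]
  rfl

theorem subst_inst_subst (σ : ℕ → Path) (p : Path) (T : Typ) :
    (T.subst (inst p)).subst σ = (T.subst (lift σ)).subst (inst (p.subst σ)) := by
  simp only [subst_subst]
  congr 1
  funext x
  cases x with
  | zero => rfl
  | succ x => simp [inst, lift, Path.subst]

/-- Unrolling a weakened recursive type at its own variable. -/
@[simp] theorem subst_lift_up_inst (T : Typ) :
    (T.subst (lift (up 1))).subst (inst (.var 0)) = T := by
  rw [subst_subst]
  convert subst_var T using 2
  funext x
  cases x <;> rfl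

end Typ

mutual
theorem Tm.subst_subst (σ τ : ℕ → Path) :
    ∀ t : Tm, (t.subst σ).subst τ = t.subst (fun x => (σ x).subst τ)
  | .path p => by simp [Tm.subst, Path.subst_subst]
  | .val v => by simp [Tm.subst, Val.subst_subst σ τ v]
  | .app p q => by simp [Tm.subst, Path.subst_subst]
  | .letIn t u => by
      simp [Tm.subst, Tm.subst_subst σ τ t, Tm.subst_subst (lift σ) (lift τ) u, lift_comp]
  | .caseOf p q A t u => by
      simp [Tm.subst, Path.subst_subst, Tm.subst_subst (lift σ) (lift τ) t,
        Tm.subst_subst σ τ u, lift_comp]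
theorem Val.subst_subst (σ τ : ℕ → Path) :
    ∀ v : Val, (v.subst σ).subst τ = v.subst (fun x => (σ x).subst τ)
  | .obj q A T d => by
      simp [Val.subst, Path.subst_subst, Typ.subst_subst,
        Def.subst_subst (lift σ) (lift τ) d, lift_comp]
  | .lam T t => by
      simp [Val.subst, Typ.subst_subst, Tm.subst_subst (lift σ) (lift τ) t, lift_comp]
theorem Def.subst_subst (σ τ : ℕ → Path) :
    ∀ d : Def, (d.subst σ).subst τ = d.subst (fun x => (σ x).subst τ)
  | .path a q => by simp [Def.subst, Path.subst_subst]
  | .val a v => by simp [Def.subst, Val.subst_subst σ τ v]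
  | .typ A T => by simp [Def.subst, Typ.subst_subst]
  | .and d e => by simp [Def.subst, Def.subst_subst σ τ d, Def.subst_subst σ τ e]
end

theorem Def.subst_inst_subst (σ : ℕ → Path) (p : Path) (d : Def) :
    (d.subst (inst p)).subst σ = (d.subst (lift σ)).subst (inst (p.subst σ)) := by
  simp only [Def.subst_subst]
  congr 1
  funext x
  cases x with
  | zero => rfl
  | succ x => simp [inst, lift, Path.subst]

theorem Path.subst_inst_subst (σ : ℕ → Path) (p q : Path) :
    (q.subst (inst p)).subst σ = (q.subst (lift σ)).subst (inst (p.subst σ)) := by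
  simp only [Path.subst_subst]
  congr 1
  funext x
  cases x with
  | zero => rfl
  | succ x => simp [inst, lift, Path.subst]

@[simp] theorem Tm.shift_path (k : ℕ) (p : Path) : (Tm.path p).shift k = .path (p.shift k) := by
  simp [Tm.shift, Tm.subst, Path.shift]

@[simp] theorem Tm.shift_shift (j k : ℕ) (t : Tm) : (t.shift j).shift k = t.shift (j + k) := by
  simp [Tm.shift, Tm.subst_subst, up, Path.subst, Nat.add_assoc]
  rfl

/-! ### Weakening in cDOT -/

theorem PathRepl.subst (σ : ℕ → Path) {p q r r' : Path} (h : PathRepl p q r r') :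
    PathRepl (p.subst σ) (q.subst σ) (r.subst σ) (r'.subst σ) := by
  induction h with
  | here => exact .here
  | sel r r' a _ ih => exact .sel _ _ a ih

theorem Repl.subst {p q : Path} {T T' : Typ} (h : Repl p q T T') (σ : ℕ → Path) :
    Repl (p.subst σ) (q.subst σ) (T.subst σ) (T'.subst σ) := by
  induction h generalizing σ with
  | fld p q a T T' _ ih => exact .fld _ _ _ _ _ (ih σ)
  | typLo p q A S S' T _ ih => exact .typLo _ _ _ _ _ _ (ih σ)
  | typHi p q A S T T' _ ih => exact .typHi _ _ _ _ _ _ (ih σ)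
  | andL p q S S' T _ ih => exact .andL _ _ _ _ _ (ih σ)
  | andR p q S T T' _ ih => exact .andR _ _ _ _ _ (ih σ)
  | mu p q T T' _ ih =>
      refine .mu _ _ _ _ ?_
      simpa only [Path.shift_subst_lift] using ih (lift σ)
  | allDom p q S S' T _ ih => exact .allDom _ _ _ _ _ (ih σ)
  | allCod p q S T T' _ ih =>
      refine .allCod _ _ _ _ _ ?_
      simpa only [Path.shift_subst_lift] using ih (lift σ)
  | sel p q r r' A h => exact .sel _ _ _ _ _ (h.subst σ)
  | sngl p q r r' h => exact .sngl _ _ _ _ (h.subst σ)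

theorem UniqueLab.subst {U T : Typ} {L : Set Label} (h : UniqueLab U T L) (σ : ℕ → Path) :
    UniqueLab (U.subst σ) (T.subst σ) L := by
  induction h with
  | oneTyp A S T => exact .oneTyp _ _ _
  | oneFld a T => exact .oneFld _ _
  | oneRec T => exact .oneRec _
  | andLeft U₁ U₂ T₁ T₂ L₁ L₂ _ _ h ih₁ ih₂ => exact .andLeft _ _ _ _ _ _ ih₁ ih₂ h
  | andRight U₁ U₂ T₁ T₂ L₁ L₂ _ _ h ih₁ ih₂ => exact .andRight _ _ _ _ _ _ ih₁ ih₂ h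

theorem Unique.subst {U T : Typ} (h : Unique U T) (σ : ℕ → Path) :
    Unique (U.subst σ) (T.subst σ) :=
  h.imp fun _ h => h.subst σ

theorem Def.dom_subst (σ : ℕ → Path) : ∀ d : Def, (d.subst σ).dom = d.dom
  | .path _ _ => by simp [Def.subst, Def.dom]
  | .val _ _ => by simp [Def.subst, Def.dom]
  | .typ _ _ => by simp [Def.subst, Def.dom]
  | .and d e => by simp [Def.subst, Def.dom, Def.dom_subst σ d, Def.dom_subst σ e]

theorem Typ.Tight.subst {T : Typ} (h : T.Tight) (σ : ℕ → Path) : (T.subst σ).Tight := by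
  induction T generalizing σ <;> simp_all [Typ.subst, Typ.Tight]

/-- `σ` renames the variables of `Γ` to variables of `Γ'` with the corresponding types. -/
def Ren (σ : ℕ → Path) (Γ Γ' : Env) : Prop :=
  ∀ x T, Lookup Γ x T → ∃ y, σ x = .var y ∧ Lookup Γ' y (T.subst σ)

theorem Ren.lift {σ : ℕ → Path} {Γ Γ' : Env} (h : Ren σ Γ Γ') (T : Typ) :
    Ren (lift σ) (T :: Γ) (T.subst (lift σ) :: Γ') := by
  intro x U hx
  cases hx with
  | zero => exact ⟨0, rfl, .zero _ _⟩
  | succ _ _ U x hx =>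
      obtain ⟨y, hy, hl⟩ := h x U hx
      refine ⟨y + 1, by simp [CDOT.lift, hy, Path.shift, Path.subst, up], ?_⟩
      rw [Typ.shift_subst_lift]
      exact .succ _ _ _ _ hl

theorem Ren.bind {σ : ℕ → Path} {Γ Γ' : Env} (h : Ren σ Γ Γ') (T : Typ) :
    Ren (CDOT.lift σ) (Γ.bind T) (Γ'.bind (T.subst σ)) := by
  have := h.lift (T.shift 1)
  rwa [Typ.shift_subst_lift] at this

theorem Ren.up (D Γ : Env) : Ren (up D.length) Γ (D ++ Γ) := by
  intro x T hx
  refine ⟨x + D.length, rfl, ?_⟩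
  change Lookup _ _ (T.shift D.length)
  induction D with
  | nil => simpa using hx
  | cons S D ih => simpa [Nat.add_assoc] using Lookup.succ _ S _ _ ih

mutual
/-- Typing is stable under renaming of the variables of the environment; together with the two
theorems below, this is weakening for the three judgments. -/
theorem HasTy.rename {Γ : Env} {t : Tm} {T : Typ} :
    HasTy Γ t T → ∀ {σ : ℕ → Path} {Γ' : Env}, Ren σ Γ Γ' → HasTy Γ' (t.subst σ) (T.subst σ)
  | .var Γ x T h, σ, Γ', hr => by
      obtain ⟨y, hy, hl⟩ := hr x T h
      simpa [Tm.subst, Path.subst, hy] using HasTy.var _ _ _ hl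
  | .allI Γ T U t h, σ, Γ', hr => by
      simpa [Tm.subst, Val.subst, Typ.subst] using HasTy.allI _ _ _ _ (h.rename (hr.bind T))
  | .allE Γ p q S T hp hq, σ, Γ', hr => by
      have h₁ := hp.rename hr
      have h₂ := hq.rename hr
      simp only [Tm.subst, Typ.subst, Typ.subst_inst_subst] at h₁ h₂ ⊢
      exact .allE _ _ _ _ _ h₁ h₂
  | .objI Γ q A T d hd ht, σ, Γ', hr => by
      have h₁ := hd.rename (hr.lift T)
      have h₂ := ht.rename (hr.lift T)
      simp only [Tm.subst, Val.subst, Typ.subst] at h₁ h₂ ⊢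
      exact .objI _ _ _ _ _ h₁ h₂
  | .fldE Γ p a T h, σ, Γ', hr => by
      have h₁ := h.rename hr
      simp only [Tm.subst, Typ.subst] at h₁ ⊢
      exact .fldE _ _ _ _ h₁
  | .fldI Γ p a T h, σ, Γ', hr => by
      have h₁ := h.rename hr
      simp only [Tm.subst, Typ.subst] at h₁ ⊢
      exact .fldI _ _ _ _ h₁
  | .letIn Γ t u T U ht hu, σ, Γ', hr => by
      have h₁ := ht.rename hr
      have h₂ := hu.rename (hr.bind T)
      simp only [Tm.subst, Typ.shift_subst_lift] at h₁ h₂ ⊢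
      exact .letIn _ _ _ _ _ h₁ h₂
  | .caseOf Γ p q A t u P Q U hp hq ht hu, σ, Γ', hr => by
      have h₁ := hp.rename hr
      have h₂ := hq.rename hr
      have h₃ := ht.rename (hr.bind _)
      have h₄ := hu.rename hr
      simp only [Tm.subst, Typ.subst, Typ.shift_subst_lift] at h₁ h₂ h₃ h₄ ⊢
      exact .caseOf _ _ _ _ _ _ _ _ _ h₁ h₂ h₃ h₄
  | .snglTrans Γ p q T hp hq, σ, Γ', hr => by
      have h₁ := hp.rename hr
      have h₂ := hq.rename hr
      simp only [Tm.subst, Typ.subst] at h₁ h₂ ⊢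
      exact .snglTrans _ _ _ _ h₁ h₂
  | .snglSelf Γ p T h, σ, Γ', hr => by
      have h₁ := h.rename hr
      simp only [Tm.subst, Typ.subst] at h₁ ⊢
      exact .snglSelf _ _ _ h₁
  | .snglE Γ p q a T hp hq, σ, Γ', hr => by
      have h₁ := hp.rename hr
      have h₂ := hq.rename hr
      simp only [Tm.subst, Typ.subst] at h₁ h₂ ⊢
      exact .snglE _ _ _ _ _ h₁ h₂
  | .recI Γ p T h, σ, Γ', hr => by
      have h₁ := h.rename hr
      simp only [Tm.subst, Typ.subst, Typ.subst_inst_subst] at h₁ ⊢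
      exact .recI _ _ _ h₁
  | .recE Γ p T h, σ, Γ', hr => by
      have h₁ := h.rename hr
      simp only [Tm.subst, Typ.subst, Typ.subst_inst_subst] at h₁ ⊢
      exact .recE _ _ _ h₁
  | .andI Γ p T U hT hU, σ, Γ', hr => by
      have h₁ := hT.rename hr
      have h₂ := hU.rename hr
      simp only [Tm.subst, Typ.subst] at h₁ h₂ ⊢
      exact .andI _ _ _ _ h₁ h₂
  | .sub Γ t T U ht hs, σ, Γ', hr => .sub _ _ _ _ (ht.rename hr) (hs.rename hr)
theorem Sub.rename {Γ : Env} {S T : Typ} :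
    Sub Γ S T → ∀ {σ : ℕ → Path} {Γ' : Env}, Ren σ Γ Γ' → Sub Γ' (S.subst σ) (T.subst σ)
  | .top Γ T, _, _, _ => .top _ _
  | .bot Γ T, _, _, _ => .bot _ _
  | .refl Γ T, _, _, _ => .refl _ _
  | .trans Γ S T U h₁ h₂, _, _, hr => .trans _ _ _ _ (h₁.rename hr) (h₂.rename hr)
  | .andLeft Γ T U, _, _, _ => .andLeft _ _ _
  | .andRight Γ T U, _, _, _ => .andRight _ _ _
  | .andI Γ S T U h₁ h₂, _, _, hr => .andI _ _ _ _ (h₁.rename hr) (h₂.rename hr)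
  | .fld Γ a T U h, _, _, hr => .fld _ _ _ _ (h.rename hr)
  | .fldInv Γ a U T₁ T₂ hu h, σ, _, hr =>
      .fldInv _ a (U.subst σ) _ (T₂.subst σ) (hu.subst σ) (h.rename hr)
  | .typ Γ A S₁ S₂ T₁ T₂ hS hT, _, _, hr => .typ _ _ _ _ _ _ (hS.rename hr) (hT.rename hr)
  | .typInvLo Γ A U S₁ S₂ T₁ T₂ hu h, σ, _, hr =>
      .typInvLo _ A (U.subst σ) _ _ _ (T₂.subst σ) (hu.subst σ) (h.rename hr)
  | .typInvHi Γ A U S₁ S₂ T₁ T₂ hu h, σ, _, hr =>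
      .typInvHi _ A (U.subst σ) _ (S₂.subst σ) _ _ (hu.subst σ) (h.rename hr)
  | .subSel Γ p A S T h, σ, _, hr => by
      have h₁ := h.rename hr
      simp only [Tm.subst, Typ.subst] at h₁ ⊢
      exact .subSel _ _ _ _ _ h₁
  | .selSub Γ p A S T h, σ, _, hr => by
      have h₁ := h.rename hr
      simp only [Tm.subst, Typ.subst] at h₁ ⊢
      exact .selSub _ _ _ _ _ h₁
  | .snglPQ Γ p q Q T T' hp hq h, σ, _, hr => by
      have h₁ := hp.rename hr
      have h₂ := hq.rename hr
      simp only [Tm.subst, Typ.subst] at h₁ h₂ ⊢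
      exact .snglPQ _ _ _ _ _ _ h₁ h₂ (h.subst σ)
  | .snglQP Γ p q Q T T' hp hq h, σ, _, hr => by
      have h₁ := hp.rename hr
      have h₂ := hq.rename hr
      simp only [Tm.subst, Typ.subst] at h₁ h₂ ⊢
      exact .snglQP _ _ _ _ _ _ h₁ h₂ (h.subst σ)
  | .all Γ S₁ S₂ T₁ T₂ hS hT, _, _, hr =>
      .all _ _ _ _ _ (hS.rename hr) (hT.rename (hr.bind S₂))
theorem DefTy.rename {p : Path} {Γ : Env} {d : Def} {T : Typ} :
    DefTy p Γ d T → ∀ {σ : ℕ → Path} {Γ' : Env}, Ren σ Γ Γ' →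
      DefTy (p.subst σ) Γ' (d.subst σ) (T.subst σ)
  | .typ p Γ A T, σ, Γ', hr => by
      simpa [Def.subst, Typ.subst] using DefTy.typ _ _ _ _
  | .lam p Γ a T U V t h, σ, Γ', hr => by
      have h₁ := h.rename hr
      simp only [Tm.subst, Val.subst, Def.subst, Typ.subst] at h₁ ⊢
      exact .lam _ _ _ _ _ _ _ h₁
  | .obj p Γ a q A T d hd ht hT, σ, Γ', hr => by
      have h₁ := hd.rename hr
      have h₂ := ht.rename hr
      simp only [Tm.subst, Val.subst, Def.subst, Typ.subst, Path.subst_inst_subst,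
        Typ.subst_inst_subst, Def.subst_inst_subst] at h₁ h₂ ⊢
      exact .obj _ _ _ _ _ _ _ h₁ h₂ (hT.subst _)
  | .path p Γ a q T h, σ, Γ', hr => by
      have h₁ := h.rename hr
      simp only [Tm.subst, Def.subst, Typ.subst] at h₁ ⊢
      exact .path _ _ _ _ _ h₁
  | .and p Γ d e T U hd he h, σ, Γ', hr => by
      have h₁ := hd.rename hr
      have h₂ := he.rename hr
      simp only [Def.subst, Typ.subst]
      exact .and _ _ _ _ _ _ h₁ h₂ (by rwa [Def.dom_subst, Def.dom_subst])
end

theorem HasTy.weaken {Γ : Env} {t : Tm} {T : Typ} (h : HasTy Γ t T) (D : Env) :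
    HasTy (D ++ Γ) (t.shift D.length) (T.shift D.length) :=
  h.rename (Ren.up D Γ)

theorem HasTy.weaken_cons {Γ : Env} {t : Tm} {T : Typ} (h : HasTy Γ t T) (S : Typ) :
    HasTy (S :: Γ) (t.shift 1) (T.shift 1) :=
  h.weaken [S]

theorem Sub.weaken_cons {Γ : Env} {S T : Typ} (h : Sub Γ S T) (U : Typ) :
    Sub (U :: Γ) (S.shift 1) (T.shift 1) :=
  h.rename (Ren.up [U] Γ)

end CDOT

/-! ### Derived rules of cDOT -/

namespace CDOT

open Enc (bigAnd bigDef withPad mkObj tyMem tyObj eqDecl absDecl)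

namespace TyEq

theorem refl (Γ : Env) (T : Typ) : TyEq Γ T T := ⟨.refl _ _, .refl _ _⟩

theorem symm {Γ : Env} {S T : Typ} (h : TyEq Γ S T) : TyEq Γ T S := ⟨h.2, h.1⟩

theorem trans {Γ : Env} {S T U : Typ} (h : TyEq Γ S T) (h' : TyEq Γ T U) : TyEq Γ S U :=
  ⟨.trans _ _ _ _ h.1 h'.1, .trans _ _ _ _ h'.2 h.2⟩

theorem and {Γ : Env} {S S' T T' : Typ} (h : TyEq Γ S S') (h' : TyEq Γ T T') :
    TyEq Γ (.and S T) (.and S' T') :=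
  ⟨.andI _ _ _ _ (.trans _ _ _ _ (.andLeft _ _ _) h.1) (.trans _ _ _ _ (.andRight _ _ _) h'.1),
    .andI _ _ _ _ (.trans _ _ _ _ (.andLeft _ _ _) h.2) (.trans _ _ _ _ (.andRight _ _ _) h'.2)⟩

theorem eqDecl {Γ : Env} {S T : Typ} (A : TyLab) (h : TyEq Γ S T) :
    TyEq Γ (eqDecl A S) (Enc.eqDecl A T) :=
  ⟨.typ _ _ _ _ _ _ h.2 h.1, .typ _ _ _ _ _ _ h.1 h.2⟩

theorem all {Γ : Env} {S S' T T' : Typ} (h : TyEq Γ S S') (h₁ : TyEq (Γ.bind S') T T')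
    (h₂ : TyEq (Γ.bind S) T T') : TyEq Γ (.all S T) (.all S' T') :=
  ⟨.all _ _ _ _ _ h.2 h₁.1, .all _ _ _ _ _ h.1 h₂.2⟩

theorem weaken_cons {Γ : Env} {S T : Typ} (h : TyEq Γ S T) (U : Typ) :
    TyEq (U :: Γ) (S.shift 1) (T.shift 1) :=
  ⟨h.1.weaken_cons U, h.2.weaken_cons U⟩

theorem weaken {Γ : Env} {S T : Typ} (h : TyEq Γ S T) (D : Env) :
    TyEq (D ++ Γ) (S.shift D.length) (T.shift D.length) :=
  ⟨h.1.rename (Ren.up D Γ), h.2.rename (Ren.up D Γ)⟩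

theorem sel {Γ : Env} {p : Path} {A : TyLab} {T : Typ}
    (h : HasTy Γ (.path p) (Enc.eqDecl A T)) : TyEq Γ (.sel p A) T :=
  ⟨.selSub _ _ _ _ _ h, .subSel _ _ _ _ _ h⟩

end TyEq

theorem HasTy.top {Γ : Env} {t : Tm} {T : Typ} (h : HasTy Γ t T) : HasTy Γ t .top :=
  .sub _ _ _ _ h (.top _ _)

theorem HasTy.andLeft {Γ : Env} {t : Tm} {T U : Typ} (h : HasTy Γ t (.and T U)) : HasTy Γ t T :=
  .sub _ _ _ _ h (.andLeft _ _ _)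

theorem HasTy.andRight {Γ : Env} {t : Tm} {T U : Typ} (h : HasTy Γ t (.and T U)) :
    HasTy Γ t U :=
  .sub _ _ _ _ h (.andRight _ _ _)

theorem Sub.abs_of_eq (Γ : Env) (A : TyLab) (T : Typ) : Sub Γ (eqDecl A T) (absDecl A) :=
  .typ _ _ _ _ _ _ (.bot _ _) (.top _ _)

theorem HasTy.abs {Γ : Env} {t : Tm} {A : TyLab} {T : Typ} (h : HasTy Γ t (eqDecl A T)) :
    HasTy Γ t (absDecl A) :=
  .sub _ _ _ _ h (.abs_of_eq _ _ _)

/-- The last variable of an environment has the type it was bound with. -/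
theorem HasTy.var_zero (Γ : Env) (T : Typ) : HasTy (Γ.bind T) (.path (.var 0)) (T.shift 1) :=
  .var _ _ _ (.zero _ _)

/-- The self variable of an object, in the scope of the object. -/
theorem HasTy.self (Γ : Env) (T : Typ) : HasTy (T :: Γ) (.path (.var 0)) T :=
  .var _ _ _ (.zero _ _)

/-- A variable bound to an object has the unrolled type of the object. -/
theorem HasTy.var_zero_mu (Γ : Env) (T : Typ) :
    HasTy (Γ.bind (.mu T)) (.path (.var 0)) T := by
  have h := HasTy.recE _ _ _ (HasTy.var_zero Γ (.mu T))
  rwa [Typ.subst_lift_up_inst] at h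

/-! #### Intersections and conjunctions of definitions -/

theorem Sub.bigAnd_mem (Γ : Env) {l : List Typ} {T : Typ} (h : T ∈ l) :
    Sub Γ (bigAnd l) T := by
  induction l with
  | nil => cases h
  | cons S l ih =>
      cases l with
      | nil =>
          obtain rfl := List.mem_singleton.1 h
          exact .refl _ _
      | cons U l =>
          rcases List.mem_cons.1 h with rfl | h
          · exact .andLeft _ _ _
          · exact .trans _ _ _ _ (.andRight _ _ _) (ih h)

theorem HasTy.bigAnd_mem {Γ : Env} {t : Tm} {l : List Typ} {T : Typ}
    (h : HasTy Γ t (bigAnd l)) (hT : T ∈ l) : HasTy Γ t T :=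
  .sub _ _ _ _ h (.bigAnd_mem _ hT)

theorem HasTy.bigAnd {Γ : Env} {p : Path} {l : List Typ} {U : Typ} (hp : HasTy Γ (.path p) U)
    (h : ∀ T ∈ l, HasTy Γ (.path p) T) : HasTy Γ (.path p) (bigAnd l) := by
  induction l with
  | nil => exact hp.top
  | cons S l ih =>
      cases l with
      | nil => exact h S (by simp)
      | cons U l =>
          exact .andI _ _ _ _ (h S (by simp)) (ih fun T hT => h T (by simp [hT]))

theorem Sub.foldl_and_init (Γ : Env) (l : List Typ) (T : Typ) :
    Sub Γ (l.foldl Typ.and T) T := by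
  induction l generalizing T with
  | nil => exact .refl _ _
  | cons S l ih => exact .trans _ _ _ _ (ih _) (.andLeft _ _ _)

theorem Sub.foldl_and_mem (Γ : Env) {l : List Typ} {S : Typ} (hS : S ∈ l) (T : Typ) :
    Sub Γ (l.foldl Typ.and T) S := by
  induction l generalizing T with
  | nil => cases hS
  | cons U l ih =>
      rcases List.mem_cons.1 hS with rfl | hS
      · exact .trans _ _ _ _ (.foldl_and_init _ _ (.and T S)) (.andRight _ _ _)
      · exact ih hS _

theorem HasTy.foldl_and {Γ : Env} {p : Path} {l : List Typ} {T : Typ}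
    (hT : HasTy Γ (.path p) T) (h : ∀ S ∈ l, HasTy Γ (.path p) S) :
    HasTy Γ (.path p) (l.foldl Typ.and T) := by
  induction l generalizing T with
  | nil => exact hT
  | cons S l ih =>
      exact ih (.andI _ _ _ _ hT (h S (by simp))) fun U hU => h U (by simp [hU])

theorem Sub.foldl_and_mono {Γ : Env} {S T : Typ} (l : List Typ) (h : Sub Γ S T) :
    Sub Γ (l.foldl Typ.and S) (l.foldl Typ.and T) := by
  induction l generalizing S T with
  | nil => exact h
  | cons U l ih =>
      exact ih (.andI _ _ _ _ (.trans _ _ _ _ (.andLeft _ _ _) h) (.andRight _ _ _))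

theorem TyEq.foldl_and {Γ : Env} {n : ℕ} {f g : Fin n → Typ} (h : ∀ j, TyEq Γ (f j) (g j))
    {S T : Typ} (hST : TyEq Γ S T) :
    TyEq Γ ((List.ofFn f).foldl Typ.and S) ((List.ofFn g).foldl Typ.and T) := by
  induction n generalizing S T with
  | zero => simpa using hST
  | succ n ih =>
      simp only [List.ofFn_succ, List.foldl_cons]
      exact ih (fun j => h j.succ) (hST.and (h 0))

theorem Typ.subst_foldl_and (σ : ℕ → Path) (l : List Typ) (T : Typ) :
    (l.foldl Typ.and T).subst σ = (l.map (Typ.subst σ)).foldl Typ.and (T.subst σ) := by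
  induction l generalizing T with
  | nil => rfl
  | cons S l ih => simp [ih, Typ.subst]

theorem Typ.subst_bigAnd (σ : ℕ → Path) (l : List Typ) :
    (bigAnd l).subst σ = bigAnd (l.map (Typ.subst σ)) := by
  induction l with
  | nil => rfl
  | cons S l ih =>
      cases l with
      | nil => rfl
      | cons U l => simpa [Enc.bigAnd, Typ.subst] using ih

theorem mem_dom_bigDef {l : List Def} (hl : l ≠ []) {x : Label} :
    x ∈ (bigDef l).dom ↔ ∃ d ∈ l, x ∈ d.dom := by
  induction l with
  | nil => exact absurd rfl hl
  | cons d l ih =>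
      cases l with
      | nil => simp [bigDef]
      | cons e l =>
          have h := ih (by simp)
          simp only [bigDef, Def.dom, Set.mem_union, h]
          simp

theorem DefTy.bigDef {p : Path} {Γ : Env} {ms : List (Def × Typ)} (hne : ms ≠ [])
    (h : ∀ m ∈ ms, DefTy p Γ m.1 m.2)
    (hd : ms.Pairwise fun m m' => Disjoint m.1.dom m'.1.dom) :
    DefTy p Γ (bigDef (ms.map Prod.fst)) (bigAnd (ms.map Prod.snd)) := by
  induction ms with
  | nil => exact absurd rfl hne
  | cons m ms ih =>
      cases ms with
      | nil => exact h m (by simp)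
      | cons m' ms =>
          obtain ⟨hm, hd⟩ := List.pairwise_cons.1 hd
          refine .and _ _ _ _ _ _ (h m (by simp))
            (ih (by simp) (fun n hn => h n (by simp [hn])) hd) ?_
          rw [← Set.disjoint_iff_inter_eq_empty, Set.disjoint_left]
          intro x hx hx'
          obtain ⟨d, hd', hx'⟩ := (mem_dom_bigDef (by simp)).1 hx'
          obtain ⟨n, hn, rfl⟩ := (List.mem_map (l := m' :: ms)).1 hd'
          exact Set.disjoint_left.1 (hm n hn) hx hx'

/-! #### Objects -/

/-- The type of the members of `mkObj q A ms`, in the scope of its self variable. -/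
def membersTy (ms : List (Def × Typ)) : Typ := bigAnd ((withPad ms).map Prod.snd)

theorem HasTy.membersTy_mem {Γ : Env} {t : Tm} {ms : List (Def × Typ)}
    (h : HasTy Γ t (membersTy ms)) {m : Def × Typ} (hm : m ∈ ms) : HasTy Γ t m.2 := by
  refine h.bigAnd_mem (List.mem_map.2 ⟨m, ?_, rfl⟩)
  cases ms with
  | nil => cases hm
  | cons _ _ => exact hm

/-- The self variable has all the declared types of the members. -/
theorem HasTy.self_mem (Γ : Env) {ms : List (Def × Typ)} {m : Def × Typ} (hm : m ∈ ms) :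
    HasTy (membersTy ms :: Γ) (.path (.var 0)) m.2 :=
  (HasTy.self Γ (membersTy ms)).membersTy_mem hm

theorem HasTy.mkObj {Γ : Env} {q : Path} {A : TyLab} {ms : List (Def × Typ)}
    (hA : HasTy (membersTy ms :: Γ) (.path (.var 0)) (.sel q A))
    (h : ∀ m ∈ ms, DefTy (.var 0) (membersTy ms :: Γ) m.1 m.2)
    (hd : ms.Pairwise fun m m' => Disjoint m.1.dom m'.1.dom) :
    HasTy Γ (.val (mkObj q A ms)) (.mu (membersTy ms)) := by
  refine .objI _ _ _ _ _ (DefTy.bigDef ?_ ?_ ?_) hA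
  · cases ms <;> simp [withPad]
  · cases ms with
    | nil =>
        intro m hm
        obtain rfl := List.mem_singleton.1 hm
        exact .typ _ _ _ _
    | cons _ _ => exact h
  · cases ms with
    | nil => exact List.pairwise_singleton _ _
    | cons _ _ => exact hd

end CDOT

/-! ### The encoding of types under substitution -/

namespace GMu

variable {S : Shape}

theorem Ty.rename_id (τ : Ty S) : τ.rename (fun α => α) = τ := by
  induction τ with
  | var | unit => rfl
  | prod _ _ iha ihb | arr _ _ iha ihb => simp [Ty.rename, iha, ihb]
  | gadt t args ih => simp [Ty.rename, ih]
  | all a ih =>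
      rw [Ty.rename]
      congr 1
      convert ih using 2
      funext α
      cases α <;> rfl

theorem Ty.subst_var (τ : Ty S) : τ.subst Ty.var = τ := by
  induction τ with
  | var | unit => rfl
  | prod _ _ iha ihb | arr _ _ iha ihb => simp [Ty.subst, iha, ihb]
  | gadt t args ih => simp [Ty.subst, ih]
  | all a ih =>
      rw [Ty.subst]
      congr 1
      convert ih using 2
      funext α
      cases α <;> rfl

end GMu

namespace CDOT

theorem Path.subst_shift (σ : ℕ → Path) (k : ℕ) (p : Path) :
    (p.subst σ).shift k = p.subst (fun x => (σ x).shift k) :=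
  Path.subst_subst _ _ _

end CDOT

namespace Enc

open CDOT
open GMu (Shape Ty Sig Constr)

variable {S : Shape}

@[simp] theorem Subst.shift_lib (Θ : Subst) (k : ℕ) : (Θ.shift k).lib = Θ.lib.shift k := rfl

@[simp] theorem Subst.shift_env (Θ : Subst) (k : ℕ) : (Θ.shift k).env = Θ.env.shift k := rfl

@[simp] theorem Subst.addTys_lib (Θ : Subst) (k : ℕ) (f : ℕ → Path × TyLab) :
    (Θ.addTys k f).lib = Θ.lib := rfl

@[simp] theorem Subst.addTys_env (Θ : Subst) (k : ℕ) (f : ℕ → Path × TyLab) :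
    (Θ.addTys k f).env = Θ.env := rfl

/-- The encoding commutes with substitution on the cDOT side and renaming on the source side. -/
theorem encTy_subst_rename (τ : Ty S) : ∀ (Θ Θ' : Subst) (σ : ℕ → Path) (ρ : ℕ → ℕ),
    Θ'.lib = Θ.lib.subst σ → Θ'.env = Θ.env.subst σ →
    (∀ α ∈ τ.fv, Θ'.ty (ρ α) = (Θ.ty α).map fun s => (s.1.subst σ, s.2)) →
    (encTy Θ τ).subst σ = encTy Θ' (τ.rename ρ) := by
  induction τ with
  | var α =>
      intro Θ Θ' σ ρ hl he h
      have h := h α rfl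
      simp only [encTy, Ty.rename, h]
      cases Θ.ty α <;> rfl
  | unit =>
      intro Θ Θ' σ ρ hl he h
      simp [encTy, Ty.rename, Typ.subst, hl]
  | prod a b iha ihb =>
      intro Θ Θ' σ ρ hl he h
      simp [encTy, Ty.rename, Typ.subst, eqDecl, hl,
        iha Θ Θ' σ ρ hl he fun α hα => h α (.inl hα),
        ihb Θ Θ' σ ρ hl he fun α hα => h α (.inr hα)]
  | arr a b iha ihb =>
      intro Θ Θ' σ ρ hl he h
      simp [encTy, Ty.rename, Typ.subst, Typ.shift_subst_lift,
        iha Θ Θ' σ ρ hl he fun α hα => h α (.inl hα),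
        ihb Θ Θ' σ ρ hl he fun α hα => h α (.inr hα)]
  | gadt t args ih =>
      intro Θ Θ' σ ρ hl he h
      simp only [encTy, Ty.rename, Typ.subst_foldl_and, List.map_ofFn, Typ.subst, he]
      congr 2
      funext j
      simp [eqDecl, Typ.subst,
        ih j Θ Θ' σ ρ hl he fun α hα => h α (Set.mem_iUnion.2 ⟨j, hα⟩)]
  | all a ih =>
      intro Θ Θ' σ ρ hl he h
      simp only [encTy, Ty.rename, Typ.subst, absDecl]
      congr 1
      refine ih _ _ _ _ ?_ ?_ ?_
      · simp [hl, Path.shift_subst_lift]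
      · simp [he, Path.shift_subst_lift]
      · rintro (_ | α) hα
        · rfl
        · have hα' := h α hα
          simp [Subst.addTys, Subst.shift, hα', Function.comp_def, Path.shift_subst_lift]

theorem encTy_subst_path (τ : Ty S) {Θ Θ' : Subst} {σ : ℕ → Path}
    (hl : Θ'.lib = Θ.lib.subst σ) (he : Θ'.env = Θ.env.subst σ)
    (h : ∀ α ∈ τ.fv, Θ'.ty α = (Θ.ty α).map fun s => (s.1.subst σ, s.2)) :
    (encTy Θ τ).subst σ = encTy Θ' τ := by
  have := encTy_subst_rename τ Θ Θ' σ (fun α => α) hl he h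
  rwa [Ty.rename_id] at this

theorem encTy_shift (Θ : Subst) (τ : Ty S) (k : ℕ) :
    (encTy Θ τ).shift k = encTy (Θ.shift k) τ :=
  encTy_subst_path τ rfl rfl fun _ _ => rfl

theorem encTy_congr (τ : Ty S) {Θ Θ' : Subst} (hl : Θ'.lib = Θ.lib) (he : Θ'.env = Θ.env)
    (h : ∀ α ∈ τ.fv, Θ'.ty α = Θ.ty α) : encTy Θ τ = encTy Θ' τ := by
  rw [← Typ.subst_var (encTy Θ τ)]
  refine encTy_subst_path τ ?_ ?_ ?_
  · rw [Path.subst_var, hl]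
  · rw [Path.subst_var, he]
  · intro α hα
    rw [h α hα]
    cases Θ.ty α <;> simp [Path.subst_var]

@[simp] theorem encTy_addTm (Θ : Subst) (t : Tm) (τ : Ty S) :
    encTy (Θ.addTm t) τ = encTy Θ τ :=
  encTy_congr τ rfl rfl fun _ _ => rfl

theorem encTy_addTys_shift (Θ : Subst) (k : ℕ) (f : ℕ → Path × TyLab) (τ : Ty S) :
    encTy (Θ.addTys k f) (τ.shift k) = encTy Θ τ := by
  rw [← Typ.subst_var (encTy Θ τ)]
  refine (encTy_subst_rename τ Θ _ _ _ ?_ ?_ ?_).symm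
  · rw [Path.subst_var, Subst.addTys_lib]
  · rw [Path.subst_var, Subst.addTys_env]
  · intro α _
    simp only [Subst.addTys, Nat.add_sub_cancel, Path.subst_var]
    cases Θ.ty α <;> simp

/-- Substitution on the source side: the encoding of `τ.subst s` under `Θ` is equal to the
encoding of `τ` under any `Θ'` that maps each `α` to a type equal to the encoding of `s α`. -/
theorem encTy_subst (τ : Ty S) : ∀ (Γ : Env) (Θ Θ' : Subst) (s : ℕ → Ty S),
    Θ'.lib = Θ.lib → Θ'.env = Θ.env →
    (∀ α ∈ τ.fv, TyEq Γ (encTy (S := S) Θ' (.var α)) (encTy Θ (s α))) →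
    TyEq Γ (encTy Θ' τ) (encTy Θ (τ.subst s)) := by
  induction τ with
  | var α =>
      intro Γ Θ Θ' s _ _ h
      exact h α rfl
  | unit =>
      intro Γ Θ Θ' s hl _ _
      simp only [encTy, Ty.subst, hl]
      exact .refl _ _
  | prod a b iha ihb =>
      intro Γ Θ Θ' s hl he h
      simp only [encTy, Ty.subst, hl]
      exact ((TyEq.refl _ _).and (.eqDecl _ (iha _ _ _ _ hl he fun α hα => h α (.inl hα)))).and
        (.eqDecl _ (ihb _ _ _ _ hl he fun α hα => h α (.inr hα)))
  | arr a b iha ihb =>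
      intro Γ Θ Θ' s hl he h
      have hb := ihb _ _ _ _ hl he fun α hα => h α (.inr hα)
      simp only [encTy, Ty.subst]
      exact .all (iha _ _ _ _ hl he fun α hα => h α (.inl hα)) (hb.weaken_cons _)
        (hb.weaken_cons _)
  | gadt t args ih =>
      intro Γ Θ Θ' s hl he h
      simp only [encTy, Ty.subst, he]
      exact .foldl_and (fun j => .eqDecl _
        (ih j _ _ _ _ hl he fun α hα => h α (Set.mem_iUnion.2 ⟨j, hα⟩))) (.refl _ _)
  | all a ih =>
      intro Γ Θ Θ' s hl he h
      have ha : TyEq (Γ.bind (absDecl .T))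
          (encTy ((Θ'.shift 1).addTys 1 fun _ => (.var 0, .T)) a)
          (encTy ((Θ.shift 1).addTys 1 fun _ => (.var 0, .T)) (a.subst (GMu.liftTy s))) := by
        refine ih _ _ _ _ (by simp [hl]) (by simp [he]) ?_
        rintro (_ | α) hα
        · exact .refl _ _
        · have hα := (h α hα).weaken_cons ((absDecl .T).shift 1)
          rw [encTy_shift, encTy_shift] at hα
          rw [GMu.liftTy, encTy_addTys_shift]
          exact hα
      simp only [encTy, Ty.subst]
      exact .all (.refl _ _) ha ha

theorem encTy_tyEq (τ : Ty S) {Γ : Env} {Θ Θ' : Subst}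
    (hl : Θ'.lib = Θ.lib) (he : Θ'.env = Θ.env)
    (h : ∀ α ∈ τ.fv, TyEq Γ (encTy (S := S) Θ' (.var α)) (encTy (S := S) Θ (.var α))) :
    TyEq Γ (encTy Θ' τ) (encTy Θ τ) := by
  have := encTy_subst τ Γ Θ Θ' Ty.var hl he h
  rwa [Ty.subst_var] at this

theorem encTy_theta_subst (σ : ℕ → Path) (lib env x : Path) (i k : ℕ) (τ : Ty S) :
    (encTy (theta lib env x i k) τ).subst σ =
      encTy (theta (lib.subst σ) (env.subst σ) (x.subst σ) i k) τ := by
  refine encTy_subst_path τ rfl rfl fun α _ => ?_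
  simp only [theta, Subst.addTys, Subst.empty]
  split <;> rfl

theorem encTy_theta_shift (k : ℕ) (lib env x : Path) (i m : ℕ) (τ : Ty S) :
    (encTy (theta lib env x i m) τ).shift k =
      encTy (theta (lib.shift k) (env.shift k) (x.shift k) i m) τ :=
  encTy_theta_subst _ _ _ _ _ _ _

/-! ### The types of the members of `lib` and `env` under substitution -/

theorem caseTy_subst (σ : ℕ → Path) (env s r : Path) (t i : ℕ) :
    (caseTy env s r t i).subst σ = caseTy (env.subst σ) (s.subst σ) (r.subst σ) t i := by
  simp [caseTy, Typ.subst, Path.shift_subst_lift]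

theorem casesTy_subst (t : ℕ) (is : List ℕ) : ∀ (σ : ℕ → Path) (env s r : Path),
    (casesTy t is env s r).subst σ = casesTy t is (env.subst σ) (s.subst σ) (r.subst σ) := by
  induction is with
  | nil => intros; rfl
  | cons i is ih =>
      intro σ env s r
      simp [casesTy, Typ.subst, caseTy_subst, ih, Path.shift_subst_lift]

theorem pmatchTy_subst (σ : ℕ → Path) (env s : Path) (t n : ℕ) :
    (pmatchTy env s t n).subst σ = pmatchTy (env.subst σ) (s.subst σ) t n := by
  simp [pmatchTy, Typ.subst, casesTy_subst, Path.shift_subst_lift, absDecl]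
  rfl

theorem gadtTy_subst (σ : ℕ → Path) (sg : Sig) (env : Path) (t : Fin sg.N) :
    (gadtTy sg env t).subst σ = gadtTy sg (env.subst σ) t := by
  simp only [gadtTy, Typ.subst, Typ.subst_bigAnd, List.map_append, List.map_ofFn,
    List.map_cons, List.map_nil, pmatchTy_subst, Path.shift_subst_lift]
  rfl

theorem conTy_subst (σ : ℕ → Path) (sg : Sig) (lib env : Path) (t : Fin sg.N)
    (i : Fin (sg.ncon t)) :
    (conTy sg lib env t i).subst σ = conTy sg (lib.subst σ) (env.subst σ) t i := by
  simp only [conTy, Typ.subst, Typ.subst_bigAnd, List.map_append, List.map_ofFn,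
    List.map_cons, List.map_nil, encTy_theta_subst, Path.shift_subst_lift, Function.comp_def,
    eqDecl, absDecl]
  rfl

theorem conFunTy_subst (σ : ℕ → Path) (sg : Sig) (lib env : Path) (t : Fin sg.N)
    (i : Fin (sg.ncon t)) :
    (conFunTy sg lib env t i).subst σ = conFunTy sg (lib.subst σ) (env.subst σ) t i := by
  simp only [conFunTy, tsTy, Typ.subst, Typ.subst_bigAnd, List.map_ofFn, encTy_theta_subst,
    Function.comp_def, absDecl, Path.shift_subst, Path.subst_shift]
  simp [lift, Path.subst]

theorem libTy_subst (σ : ℕ → Path) (lib : Path) :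
    (libTy lib).subst σ = libTy (lib.subst σ) := by
  simp [libTy, Enc.bigAnd, Typ.subst, eqDecl, unitTy, tupleTy, tupleFunTy, absDecl,
    Path.shift_subst, Path.subst_shift, lift, Path.subst]

theorem envTy_subst (σ : ℕ → Path) (sg : Sig) (lib env : Path) :
    (envTy sg lib env).subst σ = envTy sg (lib.subst σ) (env.subst σ) := by
  simp only [envTy, Typ.subst_bigAnd, envMembers, encGadt, tyMem, List.map_flatten, List.map_ofFn,
    Function.comp_def, List.map_cons, List.map_nil, eqDecl, Typ.subst, gadtTy_subst, conTy_subst,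
    conFunTy_subst]

end Enc

/-! ### The names `lib` and `env` -/

namespace Enc

open CDOT
open GMu (Shape Ty Sig Constr Entails)

/-- The paths `lib` and `env` have the types declared by the encoding in `Γ`. -/
structure Globals (sg : Sig) (lib env : Path) (Γ : Env) : Prop where
  libTy : HasTy Γ (.path lib) (libTy lib)
  envTy : HasTy Γ (.path env) (envTy sg lib env)

theorem EqCorr.globals {sg : Sig} {Δ : Constr sg.toShape} {Θ : Subst} {Γ : Env}
    (h : EqCorr sg Δ Θ Γ) : Globals sg Θ.lib Θ.env Γ :=
  ⟨h.lib, h.env⟩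

namespace Globals

variable {sg : Sig} {lib env : Path} {Γ : Env}

theorem weaken (h : Globals sg lib env Γ) (D : Env) :
    Globals sg (lib.shift D.length) (env.shift D.length) (D ++ Γ) := by
  have hl := h.libTy.weaken D
  have he := h.envTy.weaken D
  rw [Tm.shift_path, Typ.shift, libTy_subst] at hl
  rw [Tm.shift_path, Typ.shift, envTy_subst] at he
  exact ⟨hl, he⟩

theorem any (h : Globals sg lib env Γ) {t : Tm} {T : Typ} (ht : HasTy Γ t T) :
    HasTy Γ t (.sel lib .any) :=
  .sub _ _ _ _ ht.top
    (.subSel _ _ _ _ _ (h.libTy.bigAnd_mem (T := eqDecl .any .top) (by simp)))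

theorem unit (h : Globals sg lib env Γ) :
    HasTy Γ (.path (.sel lib .unit)) (.sel lib .unit) :=
  .fldE _ _ _ _ (h.libTy.bigAnd_mem (by simp))

theorem tuple (h : Globals sg lib env Γ) :
    HasTy Γ (.path (.sel lib .tuple)) (tupleFunTy lib) :=
  .fldE _ _ _ _ (h.libTy.bigAnd_mem (by simp))

theorem tuple_tyEq (h : Globals sg lib env Γ) : TyEq Γ (.sel lib .tuple) tupleTy :=
  .sel (h.libTy.bigAnd_mem (by simp))

theorem gadt_tyEq (h : Globals sg lib env Γ) (t : Fin sg.N) :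
    TyEq Γ (.sel env (.gadt t)) (gadtTy sg env t) := by
  refine .sel (h.envTy.bigAnd_mem (List.mem_map.2 ⟨tyMem (.gadt t) (gadtTy sg env t), ?_, rfl⟩))
  exact List.mem_flatten.2 ⟨_, List.mem_ofFn.2 ⟨t, rfl⟩, by simp [encGadt]⟩

theorem con_tyEq (h : Globals sg lib env Γ) (t : Fin sg.N) (i : Fin (sg.ncon t)) :
    TyEq Γ (.sel env (.con t i)) (conTy sg lib env t i) := by
  refine .sel (h.envTy.bigAnd_mem (List.mem_map.2
    ⟨tyMem (.con t i) (conTy sg lib env t i), ?_, rfl⟩))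
  exact List.mem_flatten.2 ⟨_, List.mem_ofFn.2 ⟨t, rfl⟩,
    .tail _ (List.mem_flatten.2 ⟨_, List.mem_ofFn.2 ⟨i, rfl⟩, by simp⟩)⟩

theorem con (h : Globals sg lib env Γ) (t : Fin sg.N) (i : Fin (sg.ncon t)) :
    HasTy Γ (.path (.sel env (.con t i))) (conFunTy sg lib env t i) := by
  refine .fldE _ _ _ _ (h.envTy.bigAnd_mem (List.mem_map.2
    ⟨(.val (.con t i) (conFun sg lib env t i), .fld (.con t i) (conFunTy sg lib env t i)),
      ?_, rfl⟩))
  exact List.mem_flatten.2 ⟨_, List.mem_ofFn.2 ⟨t, rfl⟩,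
    .tail _ (List.mem_flatten.2 ⟨_, List.mem_ofFn.2 ⟨i, rfl⟩, by simp⟩)⟩

/-- An object with a datatype as its type has the visitor method of that datatype. -/
theorem pmatch (h : Globals sg lib env Γ) {t : Fin sg.N} {p : Path}
    (hp : HasTy Γ (.path p) (.sel env (.gadt t))) :
    HasTy Γ (.path (.sel p .pmatch)) (pmatchTy env p t (sg.ncon t)) := by
  have h₁ := HasTy.recE _ _ _ (.sub _ _ _ _ hp (h.gadt_tyEq t).1)
  rw [Typ.subst_bigAnd] at h₁
  refine .fldE _ _ _ _ (h₁.bigAnd_mem (List.mem_map.2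
    ⟨.fld .pmatch (pmatchTy (env.shift 1) (.var 0) t (sg.ncon t)), by simp, ?_⟩))
  simp [Typ.subst, pmatchTy_subst, Path.subst, inst]

end Globals

/-! ### Soundness of the entailment -/

theorem uniqueLab_foldl_init {U T : Typ} {L : Set Label} (hU : UniqueLab U T L)
    {l : List (TyLab × Typ)} (hl : ∀ m ∈ l, Label.ty m.1 ∉ L) (hn : (l.map Prod.fst).Nodup) :
    Unique ((l.map fun m => eqDecl m.1 m.2).foldl Typ.and U) T := by
  induction l generalizing U L with
  | nil => exact ⟨L, hU⟩
  | cons m l ih =>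
      obtain ⟨hm, hn⟩ := List.nodup_cons.1 hn
      refine ih (.andLeft _ _ _ _ _ _ hU (.oneTyp m.1 m.2 m.2) ?_) ?_ hn
      · exact Set.inter_singleton_eq_empty.2 (hl m (by simp))
      · rintro m' hm' (h | h)
        · exact hl m' (by simp [hm']) h
        · exact hm (List.mem_map.2 ⟨m', hm', by simpa using h⟩)

/-- Declarations `{A = T}` with distinct labels, intersected with a type that has no type members
with these labels, are unique members. -/
theorem unique_foldl_mem {U T : Typ} {L : Set Label} (hU : UniqueLab U T L)
    {l : List (TyLab × Typ)} (hl : ∀ m ∈ l, Label.ty m.1 ∉ L) (hn : (l.map Prod.fst).Nodup)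
    {m : TyLab × Typ} (hm : m ∈ l) :
    Unique ((l.map fun m => eqDecl m.1 m.2).foldl Typ.and U) (eqDecl m.1 m.2) := by
  induction l generalizing U T L with
  | nil => cases hm
  | cons m' l ih =>
      obtain ⟨hm', hn'⟩ := List.nodup_cons.1 hn
      have hd : L ∩ {Label.ty m'.1} = ∅ :=
        Set.inter_singleton_eq_empty.2 (hl m' (by simp))
      have hl' : ∀ n ∈ l, Label.ty n.1 ∉ L ∪ {Label.ty m'.1} := by
        rintro n hn (h | h)
        · exact hl n (by simp [hn]) h
        · exact hm' (List.mem_map.2 ⟨n, hn, by simpa using h⟩)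
      rcases List.mem_cons.1 hm with rfl | hm
      · exact uniqueLab_foldl_init (.andRight _ _ _ _ _ _ hU (.oneTyp _ _ _) hd) hl' hn'
      · exact ih (.andLeft _ _ _ _ _ _ hU (.oneTyp m'.1 m'.2 m'.2) hd) hl' hn' hm

/-- Inversion for the intersection of a named recursive type with declarations `{A = T}`.  A
projection has no label set, but the recursive type it is equal to has the empty one. -/
theorem tyEq_of_sub_eqDecl {Γ : Env} {P X : Typ} (hP : TyEq Γ P (.mu X))
    {l : List (TyLab × Typ)} (hn : (l.map Prod.fst).Nodup) {A : TyLab} {T T' : Typ}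
    (hm : (A, T) ∈ l)
    (h : Sub Γ ((l.map fun m => eqDecl m.1 m.2).foldl Typ.and P) (eqDecl A T')) :
    TyEq Γ T T' := by
  have hu := unique_foldl_mem (.oneRec X) (fun _ _ => Set.notMem_empty _) hn hm
  have h := (Sub.foldl_and_mono _ hP.2).trans _ _ _ _ h
  exact ⟨.typInvHi _ _ _ _ _ _ _ hu h, .typInvLo _ _ _ _ _ _ _ hu h⟩

theorem tyEq_of_gadt {sg : Sig} {Γ : Env} {Θ : Subst} (hg : Globals sg Θ.lib Θ.env Γ)
    {t : Fin sg.N} {a b : Fin (sg.ar t) → Ty sg.toShape}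
    (h : TyEq Γ (encTy Θ (.gadt t a)) (encTy Θ (.gadt t b))) (j : Fin (sg.ar t)) :
    TyEq Γ (encTy Θ (a j)) (encTy Θ (b j)) := by
  refine tyEq_of_sub_eqDecl (hg.gadt_tyEq t)
    (l := List.ofFn fun j : Fin (sg.ar t) => (TyLab.A j, encTy Θ (a j))) ?_
    (List.mem_ofFn.2 ⟨j, rfl⟩) ?_
  · rw [List.map_ofFn, List.nodup_ofFn]
    intro j k hjk
    simpa [Fin.ext_iff] using hjk
  · have h₁ := h.1
    simp only [encTy] at h₁
    rw [List.map_ofFn]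
    exact h₁.trans _ _ _ _ (.foldl_and_mem _ (List.mem_ofFn.2 ⟨j, rfl⟩) _)

theorem tyEq_of_prod {sg : Sig} {Γ : Env} {Θ : Subst} (hg : Globals sg Θ.lib Θ.env Γ)
    {a₁ a₂ b₁ b₂ : Ty sg.toShape}
    (h : TyEq Γ (encTy Θ (.prod a₁ a₂)) (encTy Θ (.prod b₁ b₂))) :
    TyEq Γ (encTy Θ a₁) (encTy Θ b₁) ∧ TyEq Γ (encTy Θ a₂) (encTy Θ b₂) := by
  have h₁ := h.1
  simp only [encTy] at h₁
  constructor
  · exact tyEq_of_sub_eqDecl hg.tuple_tyEq (l := [(.T1, encTy Θ a₁), (.T2, encTy Θ a₂)])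
      (by simp) (by simp) (h₁.trans _ _ _ _ (.trans _ _ _ _ (.andLeft _ _ _) (.andRight _ _ _)))
  · exact tyEq_of_sub_eqDecl hg.tuple_tyEq (l := [(.T1, encTy Θ a₁), (.T2, encTy Θ a₂)])
      (by simp) (by simp) (h₁.trans _ _ _ _ (.andRight _ _ _))

/-- If `α` and `τ` have equal encodings, then substituting `τ` for `α` does not change the encoding
of a type up to type equality. -/
theorem encTy_replTy {S : Shape} {Γ : Env} {Θ : Subst} {α : ℕ} {τ : Ty S}
    (h : TyEq Γ (encTy (S := S) Θ (.var α)) (encTy Θ τ)) (τ' : Ty S) :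
    TyEq Γ (encTy Θ τ') (encTy Θ (τ'.subst (GMu.replTy α τ))) := by
  refine encTy_subst τ' Γ Θ Θ _ rfl rfl fun β _ => ?_
  rw [GMu.replTy]
  split
  · next hβ => rwa [hβ]
  · exact .refl _ _

theorem encTy_substEqs {S : Shape} {Γ : Env} {Θ : Subst} {α : ℕ} {τ : Ty S}
    (h : TyEq Γ (encTy (S := S) Θ (.var α)) (encTy Θ τ)) {E : List (Ty S × Ty S)}
    (hE : ∀ e ∈ E, TyEq Γ (encTy Θ e.1) (encTy Θ e.2)) :
    ∀ e ∈ GMu.substEqs (GMu.replTy α τ) E, TyEq Γ (encTy Θ e.1) (encTy Θ e.2) := by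
  intro e he
  obtain ⟨e, he', rfl⟩ := List.mem_map.1 he
  exact ((encTy_replTy h e.1).symm.trans (hE e he')).trans (encTy_replTy h e.2)

theorem tyEq_of_entails {sg : Sig} {Δ : Constr sg.toShape} {τ₁ τ₂ : Ty sg.toShape}
    (h : Entails Δ τ₁ τ₂) {Γ : Env} {Θ : Subst} (hg : Globals sg Θ.lib Θ.env Γ)
    (hE : ∀ e ∈ Δ.eqs, TyEq Γ (encTy Θ e.1) (encTy Θ e.2)) :
    TyEq Γ (encTy Θ τ₁) (encTy Θ τ₂) := by
  induction h with
  | refl n τ h => exact .refl _ _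
  | drop n E α τ₁ τ₂ _ ih => exact ih fun e he => hE e (.tail _ he)
  | substL n E α τ τ₁ τ₂ _ _ ih =>
      have h := (hE _ (.head _)).symm
      exact ((encTy_replTy h τ₁).trans
        (ih (encTy_substEqs h fun e he => hE e (.tail _ he)))).trans (encTy_replTy h τ₂).symm
  | substR n E α τ τ₁ τ₂ _ _ ih =>
      have h := hE _ (.head _)
      exact ((encTy_replTy h τ₁).trans
        (ih (encTy_substEqs h fun e he => hE e (.tail _ he)))).trans (encTy_replTy h τ₂).symm
  | gadt n E t a b τ₁ τ₂ _ ih =>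
      refine ih fun e he => ?_
      rcases List.mem_append.1 he with he | he
      · obtain ⟨j, rfl⟩ := List.mem_ofFn.1 he
        exact tyEq_of_gadt hg (hE _ (.head _)) j
      · exact hE e (.tail _ he)
  | prod n E a₁ a₂ b₁ b₂ τ₁ τ₂ _ ih =>
      have h := tyEq_of_prod hg (hE _ (.head _))
      refine ih fun e he => ?_
      rcases List.mem_cons.1 he with rfl | he
      · exact h.1
      · rcases List.mem_cons.1 he with rfl | he
        · exact h.2
        · exact hE e (.tail _ he)
  | perm n E E' τ₁ τ₂ hp _ ih => exact ih fun e he => hE e (hp.mem_iff.1 he)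

end Enc

/-! ### Correspondence of environments -/

namespace Enc

open CDOT
open GMu (Shape Ty Exp Sig Constr)

theorem Subst.shift_shift (Θ : Subst) (j k : ℕ) : (Θ.shift j).shift k = Θ.shift (j + k) := by
  simp [Subst.shift, Function.comp_def]

section

variable {sg : Sig} {Δ : Constr sg.toShape} {P : List (Ty sg.toShape)} {Θ : Subst} {Γ : Env}

theorem EqCorr.weaken (h : EqCorr sg Δ Θ Γ) (D : Env) :
    EqCorr sg Δ (Θ.shift D.length) (D ++ Γ) := by
  refine ⟨fun α hα => ?_, fun e he => ?_, (h.globals.weaken D).libTy, (h.globals.weaken D).envTy⟩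
  · obtain ⟨p, A, hp, ht⟩ := h.vars α hα
    exact ⟨p.shift D.length, A, by simp [Subst.shift, hp], by simpa using! ht.weaken D⟩
  · rw [← encTy_shift, ← encTy_shift]
    exact (h.eqs e he).weaken D

theorem EnvCorr.weaken (h : EnvCorr sg Δ P Θ Γ) (D : Env) :
    EnvCorr sg Δ P (Θ.shift D.length) (D ++ Γ) := by
  refine ⟨h.eqCorr.weaken D, fun x τ hx => ?_⟩
  obtain ⟨t, ht, hτ⟩ := h.terms x τ hx
  refine ⟨t.shift D.length, by simp [Subst.shift, ht], ?_⟩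
  rw [← encTy_shift]
  exact hτ.weaken D

theorem EnvCorr.globals (h : EnvCorr sg Δ P Θ Γ) : Globals sg Θ.lib Θ.env Γ := h.eqCorr.globals

theorem EnvCorr.addTm (h : EnvCorr sg Δ P Θ Γ) {t : Tm} {τ : Ty sg.toShape}
    (ht : HasTy Γ t (encTy Θ τ)) : EnvCorr sg Δ (τ :: P) (Θ.addTm t) Γ := by
  refine ⟨⟨h.eqCorr.vars, fun e he => ?_, h.eqCorr.lib, h.eqCorr.env⟩, ?_⟩
  · rw [encTy_addTm, encTy_addTm]
    exact h.eqCorr.eqs e he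
  · rintro (_ | x) τ' hx
    · obtain rfl : τ = τ' := by simpa using hx
      exact ⟨t, rfl, by rwa [encTy_addTm]⟩
    · obtain ⟨u, hu, hτ⟩ := h.terms x τ' (by simpa using hx)
      exact ⟨u, hu, by rwa [encTy_addTm]⟩

/-- Binding a new term variable on both sides. -/
theorem EnvCorr.bind (h : EnvCorr sg Δ P Θ Γ) (τ : Ty sg.toShape) :
    EnvCorr sg Δ (τ :: P) ((Θ.shift 1).addTm (.path (.var 0))) (Γ.bind (encTy Θ τ)) := by
  refine (h.weaken [_]).addTm ?_
  rw [← encTy_shift]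
  exact .var_zero _ _

theorem EnvCorr.addTys (h : EnvCorr sg Δ P Θ Γ) (k : ℕ) (f : ℕ → Path × TyLab)
    (hf : ∀ j < k, HasTy Γ (.path (f j).1) (absDecl (f j).2)) :
    EnvCorr sg (Δ.addVars k) (P.map (Ty.shift k)) (Θ.addTys k f) Γ := by
  refine ⟨⟨fun α hα => ?_, fun e he => ?_, h.eqCorr.lib, h.eqCorr.env⟩, fun x τ hx => ?_⟩
  · by_cases hk : α < k
    · exact ⟨_, _, by simp [Subst.addTys, hk], hf α hk⟩
    · obtain ⟨p, A, hp, ht⟩ := h.eqCorr.vars (α - k) (by simp [Constr.addVars] at hα; omega)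
      exact ⟨p, A, by simp [Subst.addTys, hk, hp], ht⟩
  · obtain ⟨e, he', rfl⟩ := List.mem_map.1 he
    simp only [encTy_addTys_shift]
    exact h.eqCorr.eqs e he'
  · rw [List.getElem?_map, Option.map_eq_some_iff] at hx
    obtain ⟨τ, hx, rfl⟩ := hx
    rw [encTy_addTys_shift]
    exact h.terms x τ hx

theorem EnvCorr.addEqs (h : EnvCorr sg Δ P Θ Γ) {E : List (Ty sg.toShape × Ty sg.toShape)}
    (hE : ∀ e ∈ E, TyEq Γ (encTy Θ e.1) (encTy Θ e.2)) : EnvCorr sg (Δ.addEqs E) P Θ Γ := by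
  refine ⟨⟨h.eqCorr.vars, fun e he => ?_, h.eqCorr.lib, h.eqCorr.env⟩, h.terms⟩
  rcases List.mem_append.1 he with he | he
  exacts [h.eqCorr.eqs e he, hE e he]

end

/-! ### Typing the building blocks of the encoding of terms -/

theorem encTy_addTys_inst {S : Shape} (Θ : Subst) (k : ℕ) (f : ℕ → TyLab) (q : Path) (τ : Ty S) :
    (encTy ((Θ.shift 1).addTys k fun j => (.var 0, f j)) τ).subst (inst q) =
      encTy (Θ.addTys k fun j => (q, f j)) τ := by
  refine encTy_subst_path τ (by simp) (by simp) fun α _ => ?_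
  simp only [Subst.addTys, Subst.shift]
  split
  · rfl
  · simp [Function.comp_def]

section

variable {sg : Sig} {lib env : Path} {Γ : Env}

/-- `tyObj lib l` is typeable, and a variable bound to it has the type members `l`. -/
theorem hasTy_tyObj (hg : Globals sg lib env Γ) {l : List (TyLab × Typ)}
    (hl : (l.map Prod.fst).Nodup) :
    ∃ X, HasTy Γ (.val (tyObj lib l)) X ∧
      ∀ m ∈ l, HasTy (Γ.bind X) (.path (.var 0)) (eqDecl m.1 (m.2.shift 1)) := by
  refine ⟨_, HasTy.mkObj ((hg.weaken [_]).any (.self _ _)) ?_ ?_, fun m hm => ?_⟩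
  · intro m hm
    obtain ⟨m, _, rfl⟩ := List.mem_map.1 hm
    exact .typ _ _ _ _
  · rw [List.pairwise_map]
    refine (List.pairwise_map.1 hl).imp fun h => ?_
    simpa [tyMem, Def.dom] using h
  · exact (HasTy.var_zero_mu _ _).membersTy_mem (List.mem_map.2 ⟨m, hm, rfl⟩)

/-- `Spine Γ T rs U`: a function of type `T`, applied to the arguments `rs`, has type `U`. -/
inductive Spine (Γ : Env) : Typ → List Path → Typ → Prop
  | nil (T : Typ) : Spine Γ T [] T
  | cons {r : Path} {rs : List Path} {S T U : Typ} (hr : HasTy Γ (.path r) S)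
      (h : Spine Γ (T.subst (inst r)) rs U) : Spine Γ (.all S T) (r :: rs) U

theorem hasTy_appsAux {T U : Typ} {rs : List Path} (h : Spine Γ T rs U) :
    ∀ {D : Env} {p q : Path}, HasTy (D ++ Γ) (.app p q) (T.shift D.length) →
      HasTy (D ++ Γ) (appsAux D.length p q rs) (U.shift D.length) := by
  induction h with
  | nil T => exact fun h => h
  | @cons r rs S T U hr _ ih =>
      intro D p q hp
      refine .letIn _ _ _ _ _ hp ?_
      have hr := hr.weaken (((Typ.all S T).shift D.length).shift 1 :: D)
      have h0 := HasTy.var_zero (D ++ Γ) ((Typ.all S T).shift D.length)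
      rw [Typ.shift_shift] at h0 ⊢
      refine ih (D := ((Typ.all S T).shift D.length).shift 1 :: D) ?_
      have h₁ := HasTy.allE _ _ _ _ _ h0 hr
      have h₂ := Typ.subst_inst_subst (up (D.length + 1)) r T
      exact cast (congrArg (HasTy _ _) h₂.symm) h₁

theorem hasTy_apps {T U : Typ} {p q : Path} {rs : List Path} (hp : HasTy Γ (.path p) T)
    (h : Spine Γ T (q :: rs) U) : HasTy Γ (apps p q rs) U := by
  cases h with
  | @cons _ _ S T _ hr h =>
      have h := hasTy_appsAux h (D := []) (p := p) (q := q)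
        (by simpa using HasTy.allE _ _ _ _ _ hp hr)
      rwa [List.length_nil, Typ.shift_zero] at h

/-- Application of `lib.tuple`. -/
theorem hasTy_apps_tuple (hg : Globals sg lib env Γ) {tl x₁ x₂ : Path} {T₁ T₂ : Typ}
    (h₁ : HasTy Γ (.path tl) (eqDecl .T1 T₁)) (h₂ : HasTy Γ (.path tl) (eqDecl .T2 T₂))
    (hx₁ : HasTy Γ (.path x₁) T₁) (hx₂ : HasTy Γ (.path x₂) T₂) :
    HasTy Γ (apps (.sel lib .tuple) tl [x₁, x₂])
      (.and (.and (.sel lib .tuple) (eqDecl .T1 T₁)) (eqDecl .T2 T₂)) := by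
  have h : Spine Γ (tupleFunTy lib) [tl, x₁, x₂]
      (.and (.and (.sel lib .tuple) (eqDecl .T1 (.sel tl .T1))) (eqDecl .T2 (.sel tl .T2))) := by
    refine .cons (.andI _ _ _ _ h₁.abs h₂.abs) (.cons (.sub _ _ _ _ hx₁ (TyEq.sel h₁).2)
      (.cons ?_ ?_))
    · simpa [Typ.subst, Path.subst, lift, inst] using HasTy.sub _ _ _ _ hx₂ (TyEq.sel h₂).2
    · convert Spine.nil _ using 1
      simp [Typ.subst, Path.subst, lift, inst, eqDecl, Path.shift_subst, Path.subst_subst,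
        Path.subst_var]
  exact .sub _ _ _ _ (hasTy_apps hg.tuple h)
    (((TyEq.refl _ _).and (.eqDecl _ (.sel h₁))).and (.eqDecl _ (.sel h₂))).1

/-- Application of the function `env.c` for a constructor `c` with the type arguments `args`. -/
theorem hasTy_apps_con {Θ : Subst} (hsg : sg.Closed) (hg : Globals sg Θ.lib Θ.env Γ)
    {t : Fin sg.N} {i : Fin (sg.ncon t)} {args : Fin (sg.tvs t i) → Ty sg.toShape} {ts v : Path}
    {T : Typ} (hts : HasTy Γ (.path ts) T)
    (hB : ∀ j : Fin (sg.tvs t i), HasTy Γ (.path ts) (eqDecl (.B i j) (encTy Θ (args j))))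
    (hv : HasTy Γ (.path v) (encTy Θ ((sg.arg t i).subst (GMu.instTys (sg.tvs t i) args)))) :
    HasTy Γ (apps (.sel Θ.env (.con t i)) ts [v])
      (encTy Θ ((Ty.gadt t (sg.idx t i)).subst (GMu.instTys (sg.tvs t i) args))) := by
  -- The members `B_{i,j}` of `ts` are equal to the encodings of the type arguments.
  have key : ∀ τ : Ty sg.toShape, τ.WF (sg.tvs t i) →
      TyEq Γ (encTy (theta Θ.lib Θ.env ts i (sg.tvs t i)) τ)
        (encTy Θ (τ.subst (GMu.instTys (sg.tvs t i) args))) := by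
    intro τ hτ
    refine encTy_subst τ _ _ _ _ rfl rfl fun α hα => ?_
    have hα := hτ α hα
    simp only [encTy, theta, Subst.addTys, hα, if_true, GMu.instTys, dif_pos]
    exact .sel (hB ⟨α, hα⟩)
  have hts' : HasTy Γ (.path ts) (tsTy sg t i) := by
    refine .bigAnd hts fun T hT => ?_
    obtain ⟨j, rfl⟩ := List.mem_ofFn.1 hT
    exact (hB j).abs
  have h : Spine Γ (conFunTy sg Θ.lib Θ.env t i) [ts, v]
      (encTy (theta Θ.lib Θ.env ts i (sg.tvs t i)) (Ty.gadt t (sg.idx t i))) := by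
    refine .cons hts' (.cons (.sub _ _ _ _ hv ?_) ?_)
    · rw [encTy_theta_subst, Path.shift_subst_inst, Path.shift_subst_inst]
      exact (key _ (hsg t i).1).2
    · convert Spine.nil _ using 1
      simp [encTy_theta_subst, Path.subst, lift, inst, Path.shift_subst, Path.subst_subst,
        Path.subst_var]
  refine .sub _ _ _ _ (hasTy_apps (hg.con t i) h) (key _ fun α hα => ?_).1
  obtain ⟨j, hj⟩ := Set.mem_iUnion.1 hα
  exact (hsg t i).2 j α hj

end

end Enc

namespace Enc

open CDOT
open GMu (Shape Ty Exp Sig Constr)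

/-- `Γ, x₀ : C 0, …, x_{n-1} : C (n-1)` for types `C i` scoped in `Γ`. -/
def bindAll (Γ : Env) (C : ℕ → Typ) : ℕ → Env
  | 0 => Γ
  | n + 1 => (bindAll Γ C n).bind ((C n).shift n)

theorem exists_bindAll_eq (Γ : Env) (C : ℕ → Typ) (n : ℕ) :
    ∃ D : Env, D.length = n ∧ bindAll Γ C n = D ++ Γ := by
  induction n with
  | zero => exact ⟨[], rfl, rfl⟩
  | succ n ih =>
      obtain ⟨D, hD, h⟩ := ih
      exact ⟨((C n).shift n).shift 1 :: D, by simp [hD], by simp [bindAll, Env.bind, h]⟩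

theorem hasTy_bindAll {Γ : Env} {t : Tm} {T : Typ} (h : HasTy Γ t T) (C : ℕ → Typ) (n : ℕ) :
    HasTy (bindAll Γ C n) (t.shift n) (T.shift n) := by
  obtain ⟨D, rfl, hD⟩ := exists_bindAll_eq Γ C n
  rw [hD]
  exact h.weaken D

theorem hasTy_bindAll_var (Γ : Env) (C : ℕ → Typ) {i n : ℕ} (h : i < n) :
    HasTy (bindAll Γ C n) (.path (.var (n - 1 - i))) ((C i).shift n) := by
  induction n with
  | zero => omega
  | succ n ih =>
      rcases Nat.lt_succ_iff_lt_or_eq.1 h with h | rfl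
      · have h' := (ih h).weaken_cons (((C n).shift n).shift 1)
        rw [Tm.shift_path, Typ.shift_shift n 1 (C i), Path.shift_var] at h'
        rwa [show n + 1 - 1 - i = n - 1 - i + 1 by omega]
      · have h' := HasTy.var_zero (bindAll Γ C i) ((C i).shift i)
        rw [Typ.shift_shift] at h'
        rwa [show i + 1 - 1 - i = 0 by omega]

theorem hasTy_lets (Γ : Env) (C : ℕ → Typ) {u : Tm} {U : Typ} : ∀ (ts : List Tm) (k : ℕ),
    (∀ j (hj : j < ts.length), HasTy (bindAll Γ C (k + j)) ts[j] ((C (k + j)).shift (k + j))) →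
    HasTy (bindAll Γ C (k + ts.length)) u (U.shift (k + ts.length)) →
    HasTy (bindAll Γ C k) (lets ts u) (U.shift k)
  | [], k, _, hu => hu
  | t :: ts, k, ht, hu => by
      refine .letIn _ _ _ _ _ (ht 0 (by simp)) ?_
      rw [Typ.shift_shift]
      refine hasTy_lets Γ C ts (k + 1) (fun j hj => ?_) ?_
      · have h := ht (j + 1) (by simpa using hj)
        rwa [← Nat.add_assoc, Nat.add_right_comm] at h
      · rwa [List.length_cons, ← Nat.add_assoc, Nat.add_right_comm] at hu

theorem spine_casesTy {Γ : Env} {t : ℕ} {env s r : Path} {is : List ℕ} {qs : List Path}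
    (h : List.Forall₂ (fun i q => HasTy Γ (.path q) (caseTy env s r t i)) is qs) :
    Spine Γ (casesTy t is env s r) qs (.sel r .R) := by
  induction h with
  | nil => exact .nil _
  | cons hq _ ih =>
      refine .cons hq ?_
      simpa only [casesTy_subst, Path.shift_subst_inst] using ih

/-- Application of the visitor method `p.pmatch`. -/
theorem hasTy_apps_pmatch {sg : Sig} {Γ : Env} {lib env p r : Path} (hg : Globals sg lib env Γ)
    {t : Fin sg.N} (hp : HasTy Γ (.path p) (.sel env (.gadt t)))
    (hr : HasTy Γ (.path r) (absDecl .R)) {qs : List Path}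
    (h : List.Forall₂ (fun i q => HasTy Γ (.path q) (caseTy env p r t i))
      (List.range (sg.ncon t)) qs) :
    HasTy Γ (apps (.sel p .pmatch) r qs) (.sel r .R) := by
  refine hasTy_apps (hg.pmatch hp) (.cons hr ?_)
  simpa only [casesTy_subst, Path.shift_subst_inst, Path.subst, inst] using spine_casesTy h

/-- The members of an object `p` of the type `env.T_c`. -/
theorem Globals.con_mem {sg : Sig} {Γ : Env} {lib env p : Path} (hg : Globals sg lib env Γ)
    {t : Fin sg.N} {i : Fin (sg.ncon t)} (hp : HasTy Γ (.path p) (.sel env (.con t i))) :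
    HasTy Γ (.path p) (.sel env (.gadt t)) ∧
    (∀ j : Fin (sg.tvs t i), HasTy Γ (.path p) (absDecl (.B i j))) ∧
    (∀ j : Fin (sg.ar t), HasTy Γ (.path p)
      (eqDecl (.A j) (encTy (theta lib env p i (sg.tvs t i)) (sg.idx t i j)))) ∧
    HasTy Γ (.path p) (.fld .data (encTy (theta lib env p i (sg.tvs t i)) (sg.arg t i))) := by
  have h := HasTy.recE _ _ _ (.sub _ _ _ _ hp (hg.con_tyEq t i).1)
  rw [Typ.subst_bigAnd] at h
  refine ⟨?_, fun j => ?_, fun j => ?_, ?_⟩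
  · refine h.bigAnd_mem (List.mem_map.2 ⟨.sel (env.shift 1) (.gadt t), by simp, ?_⟩)
    simp [Typ.subst]
  · exact h.bigAnd_mem (List.mem_map.2 ⟨absDecl (.B i j), by simp, rfl⟩)
  · refine h.bigAnd_mem (List.mem_map.2 ⟨eqDecl (.A j)
      (encTy (theta (lib.shift 1) (env.shift 1) (.var 0) i (sg.tvs t i)) (sg.idx t i j)),
      by simp, ?_⟩)
    simp [eqDecl, Typ.subst, encTy_theta_subst, Path.subst, inst]
  · refine h.bigAnd_mem (List.mem_map.2 ⟨.fld .data
      (encTy (theta (lib.shift 1) (env.shift 1) (.var 0) i (sg.tvs t i)) (sg.arg t i)),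
      by simp, ?_⟩)
    simp [Typ.subst, encTy_theta_subst, Path.subst, inst]

/-- The encoding of a branch of a match on `v`.  Its argument is both a constructor object and
(by the singleton type) `v`, so that the arguments of the two datatype types have the same
encodings; this is the equation that the branch is typed with. -/
theorem hasTy_branch {sg : Sig} (hsg : sg.Closed) {Δ : Constr sg.toShape}
    {P : List (Ty sg.toShape)} {Θ : Subst} {Γ : Env} (hc : EnvCorr sg Δ P Θ Γ) {t : Fin sg.N}
    (i : Fin (sg.ncon t)) {v : Path} {δ : Fin (sg.ar t) → Ty sg.toShape}
    (hv : HasTy Γ (.path v) (encTy Θ (.gadt t δ))) {e : Exp sg.toShape} {τ : Ty sg.toShape}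
    (ih : ∀ (Θ : Subst) (Γ : Env), EnvCorr sg ((Δ.addVars (sg.tvs t i)).addEqs
          (List.ofFn (fun j => (sg.idx t i j, (δ j).shift (sg.tvs t i)))))
        (sg.arg t i :: P.map (Ty.shift (sg.tvs t i))) Θ Γ →
      HasTy Γ (encTm Θ e) (encTy Θ (τ.shift (sg.tvs t i)))) :
    HasTy Γ (.val (.lam (.and (.sel Θ.env (.con t i)) (.sngl v))
        (.letIn (.path (.sel (.var 0) .data))
          (encTm (((Θ.shift 2).addTys (sg.tvs t i) (fun j => (.var 1, .B i j))).addTm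
            (.path (.var 0))) e))))
      (.all (.and (.sel Θ.env (.con t i)) (.sngl v)) ((encTy Θ τ).shift 1)) := by
  refine .allI _ _ _ _ ?_
  set k := sg.tvs t i with hk
  set X : Typ := .and (.sel Θ.env (.con t i)) (.sngl v)
  have hc₁ : EnvCorr sg Δ P (Θ.shift 1) (Γ.bind X) := hc.weaken [_]
  have harg := HasTy.var_zero Γ X
  obtain ⟨-, hB, hA, hdata⟩ := hc₁.globals.con_mem (t := t) (i := i) (p := .var 0) harg.andLeft
  have hv₁ : HasTy (Γ.bind X) (.path (.var 0)) (encTy (Θ.shift 1) (.gadt t δ)) := by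
    rw [← encTy_shift]
    exact .snglTrans _ _ _ _ harg.andRight (hv.weaken_cons _)
  -- The type variables of the constructor are mapped to the type members of the argument.
  have hc₂ := (hc₁.addTys k (fun j => (.var 0, .B i j)) fun j hj => hB ⟨j, hj⟩).addEqs
    (E := List.ofFn fun j => (sg.idx t i j, (δ j).shift k)) (by
      intro e he
      obtain ⟨j, rfl⟩ := List.mem_ofFn.1 he
      simp only [encTy_addTys_shift]
      have h₁ : encTy (theta (Θ.shift 1).lib (Θ.shift 1).env (.var 0) i k) (sg.idx t i j) =
          encTy ((Θ.shift 1).addTys k fun j => (.var 0, .B i j)) (sg.idx t i j) := by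
        refine encTy_congr _ rfl rfl fun α hα => ?_
        have hα : α < k := (hsg t i).2 j α hα
        simp [theta, Subst.addTys, hα]
      rw [← h₁]
      refine (TyEq.sel (hA j)).symm.trans (.sel (.sub _ _ _ _ hv₁ ?_))
      exact .foldl_and_mem _ (List.mem_ofFn.2 ⟨j, rfl⟩) _)
  have hc₃ := hc₂.bind (sg.arg t i)
  have h₁ : encTy (theta (Θ.shift 1).lib (Θ.shift 1).env (.var 0) i k) (sg.arg t i) =
      encTy ((Θ.shift 1).addTys k fun j => (.var 0, .B i j)) (sg.arg t i) := by
    refine encTy_congr _ rfl rfl fun α hα => ?_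
    have hα : α < k := (hsg t i).1 α hα
    simp [theta, Subst.addTys, hα]
  refine .letIn _ _ _ _ _ (.fldE _ _ _ _ hdata) ?_
  have h := ih _ _ hc₃
  have h₂ : ((Θ.shift 1).addTys k fun j => (.var 0, .B i j)).shift 1 =
      (Θ.shift 2).addTys k fun j => (.var 1, .B i j) := by
    rw [← Subst.shift_shift Θ 1 1]
    simp only [Subst.addTys, Subst.shift]
    congr 1
    funext α
    split <;> rfl
  rw [h₂, encTy_addTm, encTy_addTys_shift, ← encTy_shift, ← h₁] at h
  rw [Typ.shift_shift]
  exact h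

end Enc

/-! ### The encoding of terms -/

namespace Enc

open CDOT
open GMu (Shape Ty Exp Sig Constr)

theorem hasTy_var_one (Γ : Env) (S T : Typ) :
    HasTy ((Γ.bind S).bind T) (.path (.var 1)) (S.shift 2) := by
  have h := (HasTy.var_zero Γ S).weaken_cons (T.shift 1)
  rwa [Typ.shift_shift] at h

theorem encTy_shift_two {S : Shape} (Θ : Subst) (τ : Ty S) :
    ((encTy Θ τ).shift 1).shift 1 = encTy (Θ.shift 2) τ := by
  rw [Typ.shift_shift, encTy_shift]

theorem encTy_shift_three {S : Shape} (Θ : Subst) (τ : Ty S) :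
    (((encTy Θ τ).shift 1).shift 1).shift 1 = encTy (Θ.shift 3) τ := by
  rw [Typ.shift_shift, Typ.shift_shift, encTy_shift]

section

variable {sg : Sig} {Δ : Constr sg.toShape} {P : List (Ty sg.toShape)} {Θ : Subst} {Γ : Env}

theorem EnvCorr.bind_typ (h : EnvCorr sg Δ P Θ Γ) (T : Typ) :
    EnvCorr sg Δ P (Θ.shift 1) (Γ.bind T) :=
  h.weaken [_]

theorem EnvCorr.bind_typ_two (h : EnvCorr sg Δ P Θ Γ) (S T : Typ) :
    EnvCorr sg Δ P (Θ.shift 2) ((Γ.bind S).bind T) :=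
  h.weaken [_, _]

theorem hasTy_encTm_con (hsg : sg.Closed) (hc : EnvCorr sg Δ P Θ Γ) {t : Fin sg.N}
    {i : Fin (sg.ncon t)} {args : Fin (sg.tvs t i) → Ty sg.toShape} {e : Exp sg.toShape}
    (he : HasTy Γ (encTm Θ e)
      (encTy Θ ((sg.arg t i).subst (GMu.instTys (sg.tvs t i) args)))) :
    HasTy Γ (encTm Θ (.con t i args e))
      (encTy Θ ((Ty.gadt t (sg.idx t i)).subst (GMu.instTys (sg.tvs t i) args))) := by
  obtain ⟨X, hX, hm⟩ := hasTy_tyObj hc.globals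
    (l := List.ofFn fun j => (TyLab.B i j, encTy Θ (args j))) (by
      rw [List.map_ofFn, List.nodup_ofFn]
      intro j k hjk
      simpa [Fin.ext_iff] using hjk)
  rw [encTm]
  refine .letIn _ _ _ _ _ hX (.letIn _ _ _ _ _ (he.weaken_cons _) ?_)
  rw [encTy_shift_two Θ]
  refine hasTy_apps_con hsg (hc.bind_typ_two _ _).globals (hasTy_var_one _ _ _)
    (fun j => ?_) ?_
  · have h := (hm _ (List.mem_ofFn.2 ⟨j, rfl⟩)).weaken_cons
      (((encTy Θ ((sg.arg t i).subst (GMu.instTys (sg.tvs t i) args))).shift 1).shift 1)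
    rw [← encTy_shift_two]
    exact h
  · have h := HasTy.var_zero (Γ.bind X)
      ((encTy Θ ((sg.arg t i).subst (GMu.instTys (sg.tvs t i) args))).shift 1)
    rwa [encTy_shift_two Θ] at h

theorem hasTy_encTm_pair (hc : EnvCorr sg Δ P Θ Γ) {e₁ e₂ : Exp sg.toShape}
    {τ₁ τ₂ : Ty sg.toShape} (h₁ : HasTy Γ (encTm Θ e₁) (encTy Θ τ₁))
    (h₂ : HasTy Γ (encTm Θ e₂) (encTy Θ τ₂)) :
    HasTy Γ (encTm Θ (.pair e₁ τ₁ e₂ τ₂)) (encTy Θ (.prod τ₁ τ₂)) := by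
  obtain ⟨X, hX, hm⟩ := hasTy_tyObj
    (hc.bind_typ_two (encTy Θ τ₁) ((encTy Θ τ₂).shift 1)).globals
    (l := [(.T1, (encTy Θ τ₁).shift 2), (.T2, (encTy Θ τ₂).shift 2)]) (by simp)
  rw [encTm]
  refine .letIn _ _ _ _ _ h₁ (.letIn _ _ _ _ _ (h₂.weaken_cons _) (.letIn _ _ _ _ _ hX ?_))
  have hx₁ := (hasTy_var_one Γ (encTy Θ τ₁) ((encTy Θ τ₂).shift 1)).weaken_cons (X.shift 1)
  have hx₂ := (HasTy.var_zero (Γ.bind (encTy Θ τ₁)) ((encTy Θ τ₂).shift 1)).weaken_cons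
    (X.shift 1)
  have hg := ((hc.bind_typ_two (encTy Θ τ₁) ((encTy Θ τ₂).shift 1)).bind_typ X).globals
  have h := hasTy_apps_tuple (T₁ := encTy (Θ.shift 3) τ₁) (T₂ := encTy (Θ.shift 3) τ₂) hg
    (by
      have h := hm _ (.head _)
      rwa [Typ.shift_shift 2 1 (encTy Θ τ₁), encTy_shift Θ τ₁ 3] at h)
    (by
      have h := hm _ (.tail _ (.head _))
      rwa [Typ.shift_shift 2 1 (encTy Θ τ₂), encTy_shift Θ τ₂ 3] at h)
    (x₁ := .var 2) (x₂ := .var 1)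
    (by rw [Typ.shift_shift 2 1 (encTy Θ τ₁), encTy_shift Θ τ₁ 3] at hx₁; exact hx₁)
    (by rw [encTy_shift_three Θ τ₂] at hx₂; exact hx₂)
  rw [Subst.shift_shift] at h
  rw [encTy_shift_three Θ]
  exact h

theorem hasTy_encTm_fst (hc : EnvCorr sg Δ P Θ Γ) {e : Exp sg.toShape} {τ₁ τ₂ : Ty sg.toShape}
    (h : HasTy Γ (encTm Θ e) (encTy Θ (.prod τ₁ τ₂))) :
    HasTy Γ (encTm Θ (.fst e)) (encTy Θ τ₁) := by
  rw [encTm]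
  refine .letIn _ _ _ _ _ h ?_
  have hx := HasTy.var_zero Γ (encTy Θ (.prod τ₁ τ₂))
  rw [encTy_shift] at hx ⊢
  have hm := HasTy.recE _ _ _
    (.sub _ _ _ _ hx.andLeft.andLeft (hc.bind_typ _).globals.tuple_tyEq.1)
  have hf : HasTy _ (.path (.var 0)) (.fld .fst (.sel (.var 0) .T1)) :=
    hm.andRight.andRight.andLeft
  exact .sub _ _ _ _ (.fldE _ _ _ _ hf) (TyEq.sel hx.andLeft.andRight).1

theorem hasTy_encTm_snd (hc : EnvCorr sg Δ P Θ Γ) {e : Exp sg.toShape} {τ₁ τ₂ : Ty sg.toShape}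
    (h : HasTy Γ (encTm Θ e) (encTy Θ (.prod τ₁ τ₂))) :
    HasTy Γ (encTm Θ (.snd e)) (encTy Θ τ₂) := by
  rw [encTm]
  refine .letIn _ _ _ _ _ h ?_
  have hx := HasTy.var_zero Γ (encTy Θ (.prod τ₁ τ₂))
  rw [encTy_shift] at hx ⊢
  have hm := HasTy.recE _ _ _
    (.sub _ _ _ _ hx.andLeft.andLeft (hc.bind_typ _).globals.tuple_tyEq.1)
  have hf : HasTy _ (.path (.var 0)) (.fld .snd (.sel (.var 0) .T2)) :=
    hm.andRight.andRight.andRight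
  exact .sub _ _ _ _ (.fldE _ _ _ _ hf) (TyEq.sel hx.andRight).1

theorem hasTy_encTm_app {e₁ e₂ : Exp sg.toShape} {τ₁ τ₂ : Ty sg.toShape}
    (h₁ : HasTy Γ (encTm Θ e₁) (encTy Θ (.arr τ₁ τ₂)))
    (h₂ : HasTy Γ (encTm Θ e₂) (encTy Θ τ₁)) :
    HasTy Γ (encTm Θ (.app e₁ e₂)) (encTy Θ τ₂) := by
  rw [encTm]
  refine .letIn _ _ _ _ _ h₁ (.letIn _ _ _ _ _ (h₂.weaken_cons _) ?_)
  have hf := hasTy_var_one Γ (encTy Θ (.arr τ₁ τ₂)) ((encTy Θ τ₁).shift 1)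
  have hx := HasTy.var_zero (Γ.bind (encTy Θ (.arr τ₁ τ₂))) ((encTy Θ τ₁).shift 1)
  rw [encTy_shift_two] at hx
  rw [encTy_shift Θ (.arr τ₁ τ₂)] at hf
  rw [encTy_shift_two Θ τ₂]
  have h := HasTy.allE _ _ _ _ _ hf hx
  rwa [Typ.shift_subst_inst] at h

theorem hasTy_encTm_tapp (hc : EnvCorr sg Δ P Θ Γ) {e : Exp sg.toShape} {τ τ₁ : Ty sg.toShape}
    (h : HasTy Γ (encTm Θ e) (encTy Θ (.all τ))) :
    HasTy Γ (encTm Θ (.tapp e τ₁)) (encTy Θ (τ.subst (GMu.instTys 1 fun _ => τ₁))) := by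
  obtain ⟨X, hX, hm⟩ := hasTy_tyObj (hc.bind_typ (encTy Θ (.all τ))).globals
    (l := [(.T, (encTy Θ τ₁).shift 1)]) (by simp)
  rw [encTm]
  refine .letIn _ _ _ _ _ h (.letIn _ _ _ _ _ hX ?_)
  have hf := hasTy_var_one Γ (encTy Θ (.all τ)) X
  have hx := hm _ (.head _)
  rw [encTy_shift_two] at hx
  rw [encTy_shift Θ (.all τ)] at hf
  rw [encTy_shift_two Θ (τ.subst _)]
  have ha := HasTy.allE _ _ _ _ _ hf hx.abs
  rw [encTy_addTys_inst _ _ fun _ => .T] at ha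
  refine .sub _ _ _ _ ha (encTy_subst τ _ (Θ.shift 2)
    ((Θ.shift 2).addTys 1 fun _ => (.var 0, .T)) _ rfl rfl ?_).1
  rintro (_ | α) _
  · exact .sel hx
  · exact .refl _ _

theorem hasTy_encTm_fix (hc : EnvCorr sg Δ P Θ Γ) {e : Exp sg.toShape} {τ : Ty sg.toShape}
    (ih : ∀ (Θ : Subst) (Γ : Env), EnvCorr sg Δ (τ :: P) Θ Γ →
      HasTy Γ (encTm Θ e) (encTy Θ τ)) :
    HasTy Γ (encTm Θ (.fix τ e)) (encTy Θ τ) := by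
  -- For the recursive object `s`, the term `s.fix lib.unit` has the encoding of `τ` as its type.
  have call : ∀ {Γ' : Env} {s : Path} {Θ' : Subst}, EnvCorr sg Δ P Θ' Γ' →
      HasTy Γ' (.path s) (.fld .fix (.all (.sel Θ'.lib .unit) ((encTy Θ' τ).shift 1))) →
      HasTy Γ' (.app (.sel s .fix) (.sel Θ'.lib .unit)) (encTy Θ' τ) := by
    intro Γ' s Θ' hc' hs
    simpa using HasTy.allE _ _ _ _ _ (.fldE _ _ _ _ hs) hc'.globals.unit
  rw [encTm]
  refine .letIn _ _ _ _ _ (HasTy.mkObj ((hc.weaken [_]).globals.any (.self _ _)) ?_ ?_) ?_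
  · intro m hm
    obtain rfl := List.mem_singleton.1 hm
    refine .lam _ _ _ _ _ _ _ (.allI _ _ _ _ ?_)
    set ms : List (Def × Typ) := [_]
    have hc₂ := (hc.weaken [membersTy ms]).bind_typ (.sel (Θ.lib.shift 1) .unit)
    rw [Subst.shift_shift] at hc₂
    have hs := (HasTy.self_mem Γ (ms := ms) (.head _)).weaken_cons
      ((Typ.sel (Θ.lib.shift 1) .unit).shift 1)
    have h := ih _ _ (hc₂.addTm (call hc₂ (s := .var 1) ?_))
    · rw [encTy_addTm, ← encTy_shift] at h
      exact h
    · have e : (Typ.fld .fix (.all (.sel (Θ.lib.shift 1) .unit) ((encTy Θ τ).shift 2))).shift 1 =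
          .fld .fix (.all (.sel (Θ.shift 2).lib .unit) ((encTy (Θ.shift 2) τ).shift 1)) := by
        rw [← encTy_shift]
        simp [Typ.shift, Typ.subst, Typ.subst_subst, lift, Path.subst, up, Path.shift,
          Path.subst_subst]
        rfl
      rw [e] at hs
      exact hs
  · exact List.pairwise_singleton _ _
  · set ms : List (Def × Typ) := [_]
    have hs := (HasTy.var_zero_mu Γ (membersTy ms)).membersTy_mem (.head _)
    have h := call (Θ' := Θ.shift 1) (s := .var 0) (hc.bind_typ _) (by
      rw [encTy_shift, Subst.shift_shift, ← encTy_shift]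
      exact hs)
    rw [← encTy_shift] at h
    exact h

theorem hasTy_encTm_matchG (hsg : sg.Closed) (hc : EnvCorr sg Δ P Θ Γ) {t : Fin sg.N}
    {e : Exp sg.toShape} {τ : Ty sg.toShape} {ms : Fin (sg.ncon t) → Exp sg.toShape}
    {δ : Fin (sg.ar t) → Ty sg.toShape} (he : HasTy Γ (encTm Θ e) (encTy Θ (.gadt t δ)))
    (ih : ∀ (i : Fin (sg.ncon t)) (Θ : Subst) (Γ : Env),
      EnvCorr sg ((Δ.addVars (sg.tvs t i)).addEqs
          (List.ofFn (fun j => (sg.idx t i j, (δ j).shift (sg.tvs t i)))))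
        (sg.arg t i :: P.map (Ty.shift (sg.tvs t i))) Θ Γ →
      HasTy Γ (encTm Θ (ms i)) (encTy Θ (τ.shift (sg.tvs t i)))) :
    HasTy Γ (encTm Θ (.matchG t e τ ms)) (encTy Θ τ) := by
  obtain ⟨X, hX, hm⟩ := hasTy_tyObj hc.globals (l := [(.R, encTy Θ τ)]) (by simp)
  rw [encTm]
  refine .letIn _ _ _ _ _ hX (.letIn _ _ _ _ _ (he.weaken_cons _) ?_)
  set V : Typ := (encTy Θ (.gadt t δ)).shift 1 with hV
  set C : ℕ → Typ := fun i => caseTy (Θ.env.shift 2) (.var 0) (.var 1) t i with hC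
  have hr : HasTy ((Γ.bind X).bind V) (.path (.var 1)) (eqDecl .R (encTy (Θ.shift 2) τ)) := by
    have h := (hm _ (.head _)).weaken_cons (V.shift 1)
    rw [← encTy_shift_two]
    exact h
  have hv : HasTy ((Γ.bind X).bind V) (.path (.var 0)) (encTy (Θ.shift 2) (.gadt t δ)) := by
    rw [← encTy_shift_two]
    exact HasTy.var_zero _ _
  -- Below the bindings of `r`, `v` and `k` cases.
  have hck : ∀ k, EnvCorr sg Δ P (Θ.shift (k + 2)) (bindAll ((Γ.bind X).bind V) C k) := by
    intro k
    obtain ⟨D, rfl, hD⟩ := exists_bindAll_eq ((Γ.bind X).bind V) C k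
    have h := (hc.bind_typ_two X V).weaken D
    rwa [Subst.shift_shift, Nat.add_comm, ← hD] at h
  have hrk : ∀ k, HasTy (bindAll ((Γ.bind X).bind V) C k) (.path (.var (k + 1)))
      (eqDecl .R (encTy (Θ.shift (k + 2)) τ)) := by
    intro k
    have h := hasTy_bindAll hr C k
    rw [Nat.add_comm k 2, ← Subst.shift_shift, ← encTy_shift, Nat.add_comm k 1]
    exact h
  have hvk : ∀ k, HasTy (bindAll ((Γ.bind X).bind V) C k) (.path (.var k))
      (encTy (Θ.shift (k + 2)) (.gadt t δ)) := by
    intro k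
    have h := hasTy_bindAll hv C k
    rw [encTy_shift, Subst.shift_shift, Nat.add_comm 2 k, Tm.shift_path, Path.shift_var,
      Nat.zero_add] at h
    exact h
  have hCk : ∀ i k, (C i).shift k = caseTy (Θ.shift (k + 2)).env (.var k) (.var (k + 1)) t i := by
    intro i k
    rw [hC, Typ.shift, caseTy_subst, Nat.add_comm k 2, ← Subst.shift_shift]
    simp [Path.subst, up, Path.shift, Nat.add_comm]
  rw [encTy_shift_two Θ τ]
  have h := hasTy_lets ((Γ.bind X).bind V) C (U := encTy (Θ.shift 2) τ)
    (u := apps (.sel (.var (sg.ncon t)) .pmatch) (.var (sg.ncon t + 1))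
      ((List.range (sg.ncon t)).map fun i => .var (sg.ncon t - 1 - i)))
    (List.ofFn fun i : Fin (sg.ncon t) => .val (.lam
      (.and (.sel (Θ.env.shift (i + 2)) (.con t i)) (.sngl (.var i)))
      (.letIn (.path (.sel (.var 0) .data))
        (encTm (((Θ.shift (i + 4)).addTys (sg.tvs t i) (fun j => (.var 1, .B i j))).addTm
          (.path (.var 0))) (ms i))))) 0 ?_ ?_
  · rwa [Typ.shift_zero] at h
  · intro j hj
    rw [List.length_ofFn] at hj
    rw [List.getElem_ofFn, Nat.zero_add, hCk]
    have hb := hasTy_branch hsg (hck j) ⟨j, hj⟩ (hvk j) (ih ⟨j, hj⟩)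
    rw [Subst.shift_shift] at hb
    refine .sub _ _ _ _ hb (.all _ _ _ _ _ (.refl _ _) ?_)
    exact (TyEq.sel (hrk j)).2.weaken_cons _
  · rw [List.length_ofFn, Nat.zero_add]
    have ha := hasTy_apps_pmatch (hck _).globals (r := .var (sg.ncon t + 1))
      (qs := (List.range (sg.ncon t)).map fun i => .var (sg.ncon t - 1 - i))
      (.sub _ _ _ _ (hvk _) (.foldl_and_init _ _ _)) (hrk _).abs ?_
    · refine .sub _ _ _ _ ha ?_
      rw [encTy_shift, Subst.shift_shift, Nat.add_comm 2 (sg.ncon t)]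
      exact (TyEq.sel (hrk _)).1
    · rw [List.forall₂_map_right_iff, List.forall₂_same]
      intro i hi
      rw [← hCk]
      exact hasTy_bindAll_var _ _ (List.mem_range.1 hi)

end

/-- The encoding of terms preserves typing.  No condition on the domain of `Θ` is needed: the
correspondence of environments provides for the term variables, and type variables outside of the
domain are consistently encoded as `⊤`. -/
theorem hasTy_encTm {sg : Sig} (hsg : sg.Closed) {Δ : Constr sg.toShape}
    {P : List (Ty sg.toShape)} {e : Exp sg.toShape} {τ : Ty sg.toShape}
    (h : GMu.HasTy sg Δ P e τ) : ∀ (Θ : Subst) (Γ : Env), EnvCorr sg Δ P Θ Γ →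
      HasTy Γ (encTm Θ e) (encTy Θ τ) := by
  induction h with
  | var Δ P x τ h =>
      intro Θ Γ hc
      obtain ⟨t, ht, hτ⟩ := hc.terms x τ h
      simpa [encTm, ht] using hτ
  | con Δ P t i args e _ _ ih => exact fun Θ Γ hc => hasTy_encTm_con hsg hc (ih Θ Γ hc)
  | unit Δ P =>
      intro Θ Γ hc
      rw [encTm, encTy]
      exact hc.globals.unit
  | pair Δ P e₁ e₂ τ₁ τ₂ _ _ ih₁ ih₂ =>
      exact fun Θ Γ hc => hasTy_encTm_pair hc (ih₁ Θ Γ hc) (ih₂ Θ Γ hc)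
  | fst Δ P e τ₁ τ₂ _ ih => exact fun Θ Γ hc => hasTy_encTm_fst hc (ih Θ Γ hc)
  | snd Δ P e τ₁ τ₂ _ ih => exact fun Θ Γ hc => hasTy_encTm_snd hc (ih Θ Γ hc)
  | lam Δ P e τ₁ τ₂ _ _ ih =>
      intro Θ Γ hc
      have h := ih _ _ (hc.bind τ₁)
      rw [encTy_addTm, ← encTy_shift] at h
      rw [encTm, encTy]
      exact .allI _ _ _ _ h
  | app Δ P e₁ e₂ τ₁ τ₂ _ _ ih₁ ih₂ =>
      exact fun Θ Γ hc => hasTy_encTm_app (ih₁ Θ Γ hc) (ih₂ Θ Γ hc)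
  | tlam Δ P e τ _ ih =>
      intro Θ Γ hc
      have h := ih _ _ ((hc.bind_typ (absDecl .T)).addTys 1 (fun _ => (.var 0, .T))
        fun _ _ => .var_zero Γ (absDecl .T))
      rw [encTm, encTy]
      exact .allI _ _ _ _ h
  | tapp Δ P e τ τ₁ _ _ ih => exact fun Θ Γ hc => hasTy_encTm_tapp hc (ih Θ Γ hc)
  | fix Δ P e τ _ _ ih => exact fun Θ Γ hc => hasTy_encTm_fix hc ih
  | letIn Δ P e₁ e₂ τ₁ τ₂ _ _ ih₁ ih₂ =>
      intro Θ Γ hc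
      have h := ih₂ _ _ (hc.bind τ₁)
      rw [encTy_addTm, ← encTy_shift] at h
      rw [encTm]
      exact .letIn _ _ _ _ _ (ih₁ Θ Γ hc) h
  | matchG Δ P t e τ ms δ _ _ _ ihe ihms =>
      exact fun Θ Γ hc => hasTy_encTm_matchG hsg hc (ihe Θ Γ hc) ihms
  | eq Δ P e τ₁ τ₂ _ hτ ih =>
      exact fun Θ Γ hc =>
        .sub _ _ _ _ (ih Θ Γ hc) (tyEq_of_entails hτ hc.globals hc.eqCorr.eqs).1

end Enc

/-! ### The object `lib` -/

namespace Enc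

open CDOT
open GMu (Shape Ty Exp Sig Constr)

theorem libTy_shift (k : ℕ) (lib : Path) : (libTy lib).shift k = libTy (lib.shift k) :=
  libTy_subst _ _

theorem caseTy_shift (k : ℕ) (env s r : Path) (t i : ℕ) :
    (caseTy env s r t i).shift k = caseTy (env.shift k) (s.shift k) (r.shift k) t i :=
  caseTy_subst _ _ _ _ _ _

/-- The members of the object bound to `lib`, in the scope of its self variable. -/
def libMembers : List (Def × Typ) :=
  [tyMem .any .top, tyMem .unit unitTy,
    (.val .unit (mkObj (.var 1) .unit [tyMem .U .top]), .fld .unit (.mu (eqDecl .U .top))),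
    tyMem .tuple tupleTy,
    (.val .tuple (tupleFun (.var 0)), .fld .tuple (tupleFunTy (.var 0)))]

/-- The declared type of `lib.unit` in the object is a structural one; it is a subtype of the
nominal type `lib.Unit`. -/
theorem hasTy_libTy {Γ : Env} (h : HasTy Γ (.path (.var 0)) (membersTy libMembers)) :
    HasTy Γ (.path (.var 0)) (libTy (.var 0)) ∧
      HasTy Γ (.path (.sel (.var 0) .unit)) (.sel (.var 0) .unit) := by
  have hm : ∀ m ∈ libMembers, HasTy Γ (.path (.var 0)) m.2 := fun m hm => h.membersTy_mem hm
  simp only [libMembers, List.mem_cons, List.not_mem_nil, or_false, forall_eq_or_imp,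
    forall_eq] at hm
  obtain ⟨h₁, h₂, h₃, h₄, h₅⟩ := hm
  have hu : HasTy Γ (.path (.sel (.var 0) .unit)) (.sel (.var 0) .unit) := by
    have hU : HasTy Γ (.path (.sel (.var 0) .unit)) (eqDecl .U .top) :=
      .recE _ _ _ (.fldE _ _ _ _ h₃)
    exact .sub _ _ _ _ hU.abs (TyEq.sel h₂).2
  refine ⟨.bigAnd h ?_, hu⟩
  simp only [List.mem_cons, List.not_mem_nil, or_false, forall_eq_or_imp, forall_eq]
  exact ⟨h₁, h₂, .fldI _ _ _ _ hu, h₄, h₅⟩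

/-- The object created by `lib.tuple` has the type `lib.Tuple`: its fields are aliases of `x₁` and
`x₂`, whose types are equal to its own type members. -/
theorem hasTy_tuple_self {Γ : Env} {lib s x₁ x₂ : Path} {T₁ T₂ : Typ}
    (hl : HasTy Γ (.path lib) (libTy lib))
    (h₁ : HasTy Γ (.path s) (eqDecl .T1 T₁)) (h₂ : HasTy Γ (.path s) (eqDecl .T2 T₂))
    (hf : HasTy Γ (.path s) (.fld .fst (.sngl x₁))) (hs : HasTy Γ (.path s) (.fld .snd (.sngl x₂)))
    (hx₁ : HasTy Γ (.path x₁) T₁) (hx₂ : HasTy Γ (.path x₂) T₂) :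
    HasTy Γ (.path s) (.sel lib .tuple) := by
  have ht : TyEq Γ (.sel lib .tuple) tupleTy := .sel (hl.bigAnd_mem (by simp))
  refine .sub _ _ _ _ (.recI _ _ _ ?_) ht.2
  refine .andI _ _ _ _ h₁.abs (.andI _ _ _ _ h₂.abs (.andI _ _ _ _ ?_ ?_))
  · exact .fldI _ _ _ _ (.sub _ _ _ _ (.snglTrans _ _ _ _ (.fldE _ _ _ _ hf) hx₁) (TyEq.sel h₁).2)
  · exact .fldI _ _ _ _ (.sub _ _ _ _ (.snglTrans _ _ _ _ (.fldE _ _ _ _ hs) hx₂) (TyEq.sel h₂).2)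

theorem hasTy_tupleFun {Γ : Env} {lib : Path} (hl : HasTy Γ (.path lib) (libTy lib)) :
    HasTy Γ (.val (tupleFun lib)) (tupleFunTy lib) := by
  refine .allI _ _ _ _ (.allI _ _ _ _ (.allI _ _ _ _ ?_))
  set Γ₃ : Env := ((Γ.bind (bigAnd [absDecl .T1, absDecl .T2])).bind (.sel (.var 0) .T1)).bind
    (.sel (.var 1) .T2) with hΓ₃
  have hl₃ (S : Typ) : HasTy (S :: Γ₃) (.path (lib.shift 4)) (libTy (lib.shift 4)) := by
    have h : HasTy (S :: Γ₃) ((Tm.path lib).shift 4) ((libTy lib).shift 4) :=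
      hl.weaken [S, _, _, _]
    rwa [Tm.shift_path, libTy_shift] at h
  have hx₁ (S : Typ) : HasTy (S :: Γ₃) (.path (.var 2)) (.sel (.var 3) .T1) :=
    (hasTy_var_one (Γ.bind (bigAnd [absDecl .T1, absDecl .T2])) (.sel (.var 0) .T1)
      (.sel (.var 1) .T2)).weaken_cons S
  have hx₂ (S : Typ) : HasTy (S :: Γ₃) (.path (.var 1)) (.sel (.var 3) .T2) :=
    (HasTy.var_zero ((Γ.bind (bigAnd [absDecl .T1, absDecl .T2])).bind (.sel (.var 0) .T1))
      (.sel (.var 1) .T2)).weaken_cons S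
  set ms : List (Def × Typ) := [tyMem .T1 (.sel (.var 3) .T1), tyMem .T2 (.sel (.var 3) .T2),
    (.path .fst (.var 2), .fld .fst (.sngl (.var 2))),
    (.path .snd (.var 1), .fld .snd (.sngl (.var 1)))] with hms
  have key {S : Typ} (hs : HasTy (S :: Γ₃) (.path (.var 0)) (membersTy ms)) :
      HasTy (S :: Γ₃) (.path (.var 0)) (.sel (lib.shift 4) .tuple) ∧
      HasTy (S :: Γ₃) (.path (.var 0)) (eqDecl .T1 (.sel (.var 3) .T1)) ∧
      HasTy (S :: Γ₃) (.path (.var 0)) (eqDecl .T2 (.sel (.var 3) .T2)) := by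
    have hm : ∀ m ∈ ms, HasTy (S :: Γ₃) (.path (.var 0)) m.2 := fun m hm => hs.membersTy_mem hm
    simp only [hms, List.mem_cons, List.not_mem_nil, or_false, forall_eq_or_imp,
      forall_eq] at hm
    obtain ⟨h₁, h₂, h₃, h₄⟩ := hm
    exact ⟨hasTy_tuple_self (hl₃ S) h₁ h₂ h₃ h₄ (hx₁ S) (hx₂ S), h₁, h₂⟩
  refine .letIn _ _ _ _ _ (HasTy.mkObj (ms := ms) (key (.self _ _)).1 ?_ ?_) ?_
  · simp only [hms, List.mem_cons, List.not_mem_nil, or_false, forall_eq_or_imp, forall_eq]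
    exact ⟨.typ _ _ _ _, .typ _ _ _ _, .path _ _ _ _ _ (hx₁ _), .path _ _ _ _ _ (hx₂ _)⟩
  · simp [hms, tyMem, Def.dom]
  · obtain ⟨h, h₁, h₂⟩ := key (HasTy.var_zero_mu Γ₃ (membersTy ms))
    have e : lib.shift 4 = (lib.shift 3).shift 1 := by rw [Path.shift_shift]
    rw [e] at h
    exact .andI _ _ _ _ (.andI _ _ _ _ h h₁) h₂

theorem hasTy_libVal (Γ : Env) : HasTy Γ (.val libVal) (.mu (membersTy libMembers)) := by
  have hs := HasTy.self Γ (membersTy libMembers)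
  obtain ⟨hl, hu⟩ := hasTy_libTy hs
  refine HasTy.mkObj (ms := libMembers) ?_ ?_ ?_
  · exact .sub _ _ _ _ hs.top
      (TyEq.sel (hl.bigAnd_mem (T := eqDecl .any .top) (by simp))).2
  · simp only [libMembers, List.mem_cons, List.not_mem_nil, or_false, forall_eq_or_imp, forall_eq]
    exact ⟨.typ _ _ _ _, .typ _ _ _ _, .obj _ _ _ _ _ _ _ (.typ _ _ _ _) hu rfl, .typ _ _ _ _,
      .lam _ _ _ _ _ _ _ (hasTy_tupleFun hl)⟩
  · simp [libMembers, tyMem, Def.dom]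

/-! ### The object `env` -/

theorem theta_tyEq {S : Shape} {Γ : Env} {lib env p q : Path} {i k : ℕ}
    (h : ∀ j < k, TyEq Γ (.sel p (.B i j)) (.sel q (.B i j))) (τ : Ty S) :
    TyEq Γ (encTy (theta lib env p i k) τ) (encTy (theta lib env q i k) τ) := by
  refine encTy_tyEq τ rfl rfl fun α _ => ?_
  by_cases hα : α < k
  · simpa [encTy, theta, Subst.addTys, hα] using h α hα
  · simpa [encTy, theta, Subst.addTys, hα, Subst.empty] using TyEq.refl _ _

section

variable {sg : Sig} {lib env : Path} {Γ : Env}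

/-- The object created by the constructor function has the type `env.T_c`. -/
theorem hasTy_con_self (hg : Globals sg lib env Γ) {t : Fin sg.N} {i : Fin (sg.ncon t)}
    {s ts v : Path}
    (hB : ∀ j : Fin (sg.tvs t i), HasTy Γ (.path s) (eqDecl (.B i j) (.sel ts (.B i j))))
    (hA : ∀ j : Fin (sg.ar t), HasTy Γ (.path s)
      (eqDecl (.A j) (encTy (theta lib env s i (sg.tvs t i)) (sg.idx t i j))))
    (hd : HasTy Γ (.path s) (.fld .data (.sngl v)))
    (hp : HasTy Γ (.path s) (.fld .pmatch (pmatchTy env s t (sg.ncon t))))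
    (hv : HasTy Γ (.path v) (encTy (theta lib env ts i (sg.tvs t i)) (sg.arg t i))) :
    HasTy Γ (.path s) (.sel env (.con t i)) := by
  refine .sub _ _ _ _ (.recI _ _ _ ?_) (hg.con_tyEq t i).2
  rw [Typ.subst_bigAnd]
  refine .bigAnd hd fun T hT => ?_
  obtain ⟨T, hT', rfl⟩ := List.mem_map.1 hT
  simp only [List.mem_cons, List.mem_append, List.mem_ofFn, List.not_mem_nil, or_false] at hT'
  rcases hT' with rfl | (⟨j, rfl⟩ | ⟨j, rfl⟩) | rfl
  · simp only [Typ.subst, Path.shift_subst_inst]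
    refine .sub _ _ _ _ (.recI _ _ _ ?_) (hg.gadt_tyEq t).2
    rw [Typ.subst_bigAnd]
    refine .bigAnd hd fun T hT => ?_
    obtain ⟨T, hT', rfl⟩ := List.mem_map.1 hT
    simp only [List.mem_append, List.mem_ofFn, List.mem_singleton] at hT'
    rcases hT' with ⟨j, rfl⟩ | rfl
    · exact (hA j).abs
    · simpa [Typ.subst, pmatchTy_subst, Path.subst, inst] using hp
  · exact (hB j).abs
  · simpa [eqDecl, Typ.subst, encTy_theta_subst, Path.subst, inst] using hA j
  · simp only [Typ.subst, encTy_theta_subst, Path.shift_subst_inst, Path.subst, inst]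
    refine .fldI _ _ _ _ (.sub _ _ _ _ (.snglTrans _ _ _ _ (.fldE _ _ _ _ hd) hv) ?_)
    exact (theta_tyEq (fun j hj => .sel (hB ⟨j, hj⟩)) _).2

theorem hasTy_casesLam {Γ : Env} {t : ℕ} {env s r : Path} {body : Tm} (m : ℕ) : ∀ k : ℕ,
    HasTy (bindAll Γ (caseTy env s r t) (k + m)) body (.sel (r.shift (k + m)) .R) →
    HasTy (bindAll Γ (caseTy env s r t) k)
      (casesLam t (List.range' k m) (env.shift k) (s.shift k) (r.shift k) body)
      (casesTy t (List.range' k m) (env.shift k) (s.shift k) (r.shift k)) := by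
  induction m with
  | zero => exact fun k h => h
  | succ m ih =>
      intro k h
      rw [List.range'_succ]
      have e : caseTy (env.shift k) (s.shift k) (r.shift k) t k = (caseTy env s r t k).shift k :=
        (caseTy_shift _ _ _ _ _ _).symm
      have h' := ih (k + 1) (by rwa [Nat.add_right_comm, Nat.add_assoc])
      rw [casesLam, casesTy, Path.shift_shift, Path.shift_shift, Path.shift_shift]
      refine .allI _ _ _ _ ?_
      rw [e]
      exact h'

/-- The visitor method of the constructor `c_i` calls the `i`-th case with its own object, which is
passed as a field of an auxiliary object so that its singleton type is the declared one. -/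
theorem hasTy_pmatchVal (hg : Globals sg lib env Γ) {t i n : ℕ} (hi : i < n) {s : Path}
    (hs : HasTy Γ (.path s) (.sel env (.con t i))) :
    HasTy Γ (.val (pmatchVal lib env s t n i)) (pmatchTy env s t n) := by
  refine .allI _ _ _ _ ?_
  set C := caseTy (env.shift 1) (s.shift 1) (.var 0) t with hC
  set Γ₁ := Γ.bind (absDecl .R)
  have h := hasTy_casesLam (Γ := Γ₁) (t := t) (env := env.shift 1) (s := s.shift 1) (r := .var 0)
    (body := .letIn
        (.val (mkObj (lib.shift (n + 2)) .any
          [(.path .z (s.shift (n + 2)), .fld .z (.sngl (s.shift (n + 2))))]))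
        (.app (.var (n - i)) (.sel (.var 0) .z))) n 0 ?_
  · rw [Path.shift_zero, Path.shift_zero, Path.shift_zero] at h
    rw [List.range_eq_range']
    exact h
  rw [Nat.zero_add]
  obtain ⟨D, hD, hb⟩ := exists_bindAll_eq Γ₁ C n
  -- All facts about `Γ` hold below `r`, the cases, and one more variable.
  have up {p : Path} {T : Typ} (h : HasTy Γ (.path p) T) (S : Typ) :
      HasTy (S :: bindAll Γ₁ C n) (.path (p.shift (n + 2))) (T.shift (n + 2)) := by
    have h := h.weaken (S :: D ++ [(absDecl .R).shift 1])
    rw [hb]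
    simpa [hD, Γ₁, Env.bind] using h
  have hs' := up hs
  have hg' (S : Typ) :
      Globals sg (lib.shift (n + 2)) (env.shift (n + 2)) (S :: bindAll Γ₁ C n) := by
    have h := hg.weaken (S :: D ++ [(absDecl .R).shift 1])
    rw [hb]
    simpa [hD, Γ₁, Env.bind] using h
  set ms : List (Def × Typ) := [(.path .z (s.shift (n + 2)), .fld .z (.sngl (s.shift (n + 2))))]
  refine .letIn _ _ _ _ _ (HasTy.mkObj (ms := ms) ((hg' _).any (.self _ _)) ?_
    (List.pairwise_singleton _ _)) ?_
  · intro m hm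
    obtain rfl := List.mem_singleton.1 hm
    exact .path _ _ _ _ _ (hs' _)
  · have hz : HasTy ((bindAll Γ₁ C n).bind (.mu (membersTy ms))) (.path (.sel (.var 0) .z))
        (.sngl (s.shift (n + 2))) :=
      .fldE _ _ _ _ ((HasTy.var_zero_mu _ (membersTy ms)).membersTy_mem (.head _))
    have hc := (hasTy_bindAll_var Γ₁ C hi).weaken_cons ((Typ.mu (membersTy ms)).shift 1)
    have e : ((C i).shift n).shift 1 =
        caseTy (env.shift (n + 2)) (s.shift (n + 2)) (.var (n + 1)) t i := by
      rw [Typ.shift_shift, hC, caseTy_shift, Path.shift_shift, Path.shift_shift, Path.shift_var,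
        Nat.zero_add, Nat.add_comm 1]
    rw [e, Tm.shift_path, Path.shift_var, show n - 1 - i + 1 = n - i by omega] at hc
    rw [Path.shift_var, Nat.zero_add]
    exact HasTy.allE _ _ _ _ _ hc (.andI _ _ _ _ (.snglTrans _ _ _ _ hz (hs' _)) hz)

theorem hasTy_conFun (hg : Globals sg lib env Γ) (t : Fin sg.N) (i : Fin (sg.ncon t)) :
    HasTy Γ (.val (conFun sg lib env t i)) (conFunTy sg lib env t i) := by
  refine .allI _ _ _ _ (.allI _ _ _ _ ?_)
  set k := sg.tvs t i with hk
  set V : Typ := encTy (theta (lib.shift 1) (env.shift 1) (.var 0) i k) (sg.arg t i) with hV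
  set Γ₂ : Env := (Γ.bind (tsTy sg t i)).bind V with hΓ₂
  have hg₃ (S : Typ) : Globals sg (lib.shift 3) (env.shift 3) (S :: Γ₂) := hg.weaken [S, _, _]
  have hv (S : Typ) : HasTy (S :: Γ₂) (.path (.var 1))
      (encTy (theta (lib.shift 3) (env.shift 3) (.var 2) i k) (sg.arg t i)) := by
    have h := (HasTy.var_zero (Γ.bind (tsTy sg t i)) V).weaken_cons S
    rw [Typ.shift_shift, hV, encTy_theta_shift] at h
    simpa using h
  set ms : List (Def × Typ) :=
    List.ofFn (fun j : Fin (sg.tvs t i) => tyMem (.B i j) (.sel (.var 2) (.B i j))) ++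
      List.ofFn (fun j : Fin (sg.ar t) => tyMem (.A j)
        (encTy (theta (lib.shift 3) (env.shift 3) (.var 0) i (sg.tvs t i)) (sg.idx t i j))) ++
      [(.path .data (.var 1), .fld .data (.sngl (.var 1))),
        (.val .pmatch (pmatchVal (lib.shift 3) (env.shift 3) (.var 0) t (sg.ncon t) i),
          .fld .pmatch (pmatchTy (env.shift 3) (.var 0) t (sg.ncon t)))] with hms
  have key {S : Typ} (hs : HasTy (S :: Γ₂) (.path (.var 0)) (membersTy ms)) :
      HasTy (S :: Γ₂) (.path (.var 0)) (.sel (env.shift 3) (.con t i)) := by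
    refine hasTy_con_self (hg₃ S) (ts := .var 2) (v := .var 1) (fun j => ?_) (fun j => ?_) ?_ ?_
      (hv S)
    · exact hs.membersTy_mem (m := tyMem (.B i j) (.sel (.var 2) (.B i j))) (by simp [hms])
    · exact hs.membersTy_mem (m := tyMem (.A j)
        (encTy (theta (lib.shift 3) (env.shift 3) (.var 0) i (sg.tvs t i)) (sg.idx t i j)))
        (by simp [hms])
    · exact hs.membersTy_mem (m := (.path .data (.var 1), .fld .data (.sngl (.var 1))))
        (by simp [hms])
    · exact hs.membersTy_mem
        (m := (.val .pmatch (pmatchVal (lib.shift 3) (env.shift 3) (.var 0) t (sg.ncon t) i),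
          .fld .pmatch (pmatchTy (env.shift 3) (.var 0) t (sg.ncon t)))) (by simp [hms])
  refine .letIn _ _ _ _ _ (HasTy.mkObj (ms := ms) (key (.self _ _)) ?_ ?_) ?_
  · intro m hm
    simp only [hms, List.mem_cons, List.mem_append, List.mem_ofFn, List.not_mem_nil, or_false] at hm
    rcases hm with (⟨j, rfl⟩ | ⟨j, rfl⟩) | rfl | rfl
    · exact .typ _ _ _ _
    · exact .typ _ _ _ _
    · exact .path _ _ _ _ _ (hv _)
    · exact .lam _ _ _ _ _ _ _ (hasTy_pmatchVal (hg₃ _) i.2 (key (.self _ _)))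
  · simp only [hms, List.pairwise_append, List.pairwise_ofFn, List.mem_append, List.mem_ofFn]
    refine ⟨⟨fun j k h => ?_, fun j k h => ?_, ?_⟩, ?_, ?_⟩
    · simpa [tyMem, Def.dom, Fin.val_inj] using h.ne
    · simpa [tyMem, Def.dom, Fin.val_inj] using h.ne
    · rintro _ ⟨j, rfl⟩ _ ⟨k, rfl⟩
      simp [tyMem, Def.dom]
    · simp [Def.dom]
    · rintro _ (⟨j, rfl⟩ | ⟨j, rfl⟩) m hm
      all_goals
        simp only [List.mem_cons, List.not_mem_nil, or_false] at hm
        rcases hm with rfl | rfl <;> simp [tyMem, Def.dom]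
  · have hs := HasTy.var_zero_mu Γ₂ (membersTy ms)
    obtain ⟨hgadt, -, hA, -⟩ := (hg₃ ((Typ.mu (membersTy ms)).shift 1)).con_mem (key hs)
    rw [encTy_theta_shift, Path.shift_shift, Path.shift_shift]
    refine .foldl_and hgadt fun T hT => ?_
    obtain ⟨j, rfl⟩ := List.mem_ofFn.1 hT
    refine .sub _ _ _ _ (hA j) (TyEq.eqDecl _ (theta_tyEq (fun j hj => .sel ?_) _)).1
    exact hs.membersTy_mem (m := tyMem (.B i j) (.sel (.var 2) (.B i j)))
      (by simp only [hms, List.mem_append, List.mem_ofFn]; exact .inl (.inl ⟨⟨j, hj⟩, rfl⟩))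

theorem mem_encGadt {t : Fin sg.N} {m : Def × Typ} : m ∈ encGadt sg lib env t ↔
    m = tyMem (.gadt t) (gadtTy sg env t) ∨ ∃ i : Fin (sg.ncon t),
      m = tyMem (.con t i) (conTy sg lib env t i) ∨
      m = (.val (.con t i) (conFun sg lib env t i), .fld (.con t i) (conFunTy sg lib env t i)) := by
  simp [encGadt, List.mem_flatten, List.mem_ofFn]

theorem hasTy_encSig (hl : HasTy Γ (.path lib) (libTy lib)) :
    HasTy Γ (.val (encSig sg lib)) (.mu (membersTy (envMembers sg (lib.shift 1) (.var 0)))) := by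
  set ms := envMembers sg (lib.shift 1) (.var 0) with hms
  have hg : Globals sg (lib.shift 1) (.var 0) (membersTy ms :: Γ) := by
    refine ⟨?_, .bigAnd (.self _ _) fun T hT => ?_⟩
    · have h := hl.weaken_cons (membersTy ms)
      rwa [Tm.shift_path, libTy_shift] at h
    · obtain ⟨m, hm, rfl⟩ := List.mem_map.1 hT
      exact .self_mem _ hm
  refine HasTy.mkObj (ms := ms) (hg.any (.self _ _)) ?_ ?_
  · intro m hm
    obtain ⟨l, hl, hm⟩ := List.mem_flatten.1 hm
    obtain ⟨t, rfl⟩ := List.mem_ofFn.1 hl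
    rcases mem_encGadt.1 hm with rfl | ⟨i, rfl | rfl⟩
    · exact .typ _ _ _ _
    · exact .typ _ _ _ _
    · exact .lam _ _ _ _ _ _ _ (hasTy_conFun hg t i)
  · rw [hms, envMembers, List.pairwise_flatten, List.pairwise_ofFn]
    refine ⟨fun l hl => ?_, fun t t' ht m hm m' hm' => ?_⟩
    · obtain ⟨t, rfl⟩ := List.mem_ofFn.1 hl
      rw [encGadt, List.pairwise_cons, List.pairwise_flatten, List.pairwise_ofFn]
      refine ⟨fun m hm => ?_, fun l hl => ?_, fun i i' hi => ?_⟩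
      · obtain ⟨l, hl, hm⟩ := List.mem_flatten.1 hm
        obtain ⟨i, rfl⟩ := List.mem_ofFn.1 hl
        simp only [List.mem_cons, List.not_mem_nil, or_false] at hm
        rcases hm with rfl | rfl <;> simp [tyMem, Def.dom]
      · obtain ⟨i, rfl⟩ := List.mem_ofFn.1 hl
        simp [tyMem, Def.dom]
      · simp [tyMem, Def.dom, hi.ne', Fin.val_inj]
    · rcases mem_encGadt.1 hm with rfl | ⟨i, rfl | rfl⟩ <;>
        rcases mem_encGadt.1 hm' with rfl | ⟨i', rfl | rfl⟩ <;>
        simp [tyMem, Def.dom, ht.ne, Fin.val_inj]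

end

theorem hasTy_envTy {sg : Sig} {lib : Path} {Γ : Env}
    (h : HasTy Γ (.path (.var 0)) (membersTy (envMembers sg lib (.var 0)))) :
    HasTy Γ (.path (.var 0)) (envTy sg lib (.var 0)) := by
  refine .bigAnd h fun T hT => ?_
  obtain ⟨m, hm, rfl⟩ := List.mem_map.1 hT
  exact h.membersTy_mem hm

/-- The correspondence of the empty environments, with `lib` and `env` bound to their objects. -/
theorem envCorr_empty (sg : Sig) :
    ∃ L E : Typ, HasTy [] (.val libVal) L ∧
      HasTy (Env.bind [] L) (.val (encSig sg (.var 0))) E ∧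
      EnvCorr sg ⟨0, []⟩ [] (Subst.empty (.var 1) (.var 0)) ((Env.bind [] L).bind E) := by
  have hl := (hasTy_libTy (HasTy.var_zero_mu [] (membersTy libMembers))).1
  refine ⟨_, _, hasTy_libVal [], hasTy_encSig hl, ⟨⟨?_, ?_, ?_, ?_⟩, ?_⟩⟩
  · intro α hα
    exact absurd hα (Nat.not_lt_zero α)
  · intro e he
    cases he
  · have h := hl.weaken_cons
      ((Typ.mu (membersTy (envMembers sg ((Path.var 0).shift 1) (.var 0)))).shift 1)
    rw [Tm.shift_path, libTy_shift] at h
    exact h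
  · exact hasTy_envTy (HasTy.var_zero_mu _ _)
  · intro x τ hx
    simp at hx

end Enc

theorem mainTheorem7 (sg : GMu.Sig) (hsg : sg.Closed) :
    (∀ (Δ : GMu.Constr sg.toShape) (P : List (GMu.Ty sg.toShape)) (e : GMu.Exp sg.toShape)
        (τ : GMu.Ty sg.toShape), GMu.HasTy sg Δ P e τ →
      ∀ (Θ : Enc.Subst) (Γ : CDOT.Env),
        e.fvTy ∪ τ.fv ⊆ Θ.domTy → e.fvTm ⊆ Θ.domTm → Enc.EnvCorr sg Δ P Θ Γ →
        CDOT.HasTy Γ (Enc.encTm Θ e) (Enc.encTy Θ τ)) ∧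
    (∃ L E : CDOT.Typ, CDOT.HasTy [] (.val Enc.libVal) L ∧
      CDOT.HasTy (CDOT.Env.bind [] L) (.val (Enc.encSig sg (.var 0))) E ∧
      Enc.EnvCorr sg ⟨0, []⟩ [] (Enc.Subst.empty (.var 1) (.var 0))
        ((CDOT.Env.bind [] L).bind E)) ∧
    (∀ (e : GMu.Exp sg.toShape) (τ : GMu.Ty sg.toShape), GMu.HasTy sg ⟨0, []⟩ [] e τ →
      ∃ U : CDOT.Typ, CDOT.HasTy [] (Enc.encProgram sg e) U) := by
  refine ⟨fun Δ P e τ h Θ Γ _ _ hc => Enc.hasTy_encTm hsg h Θ Γ hc, Enc.envCorr_empty sg,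
    fun e τ h => ?_⟩
  obtain ⟨L, E, hL, hE, hc⟩ := Enc.envCorr_empty sg
  -- The type of `e` may mention `lib` and `env`; the supertype `⊤` avoids them.
  exact ⟨.top, .letIn _ _ _ _ _ hL (.letIn _ _ _ _ _ hE (Enc.hasTy_encTm hsg h _ _ hc).top)⟩
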